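/- **Proposition 1.2.** Let $K$ be an algebraically closed field of characteristic $p>0$ and let $(X,D)$ be a toric pair: $X=X(\Delta)$ is the toric variety over $K$, of dimension $d-1\ge 1$, of a complete fan $\Delta$ in $N_{\mathbb R}$, $N\cong\mathbb Z^{d-1}$, and $D=\sum_i a_iD_i$ is a very ample torus-invariant Cartier divisor, where the $D_i$ correspond to the rays of $\Delta$, with primitive generators $v_i\in N$. For an integer $k\ge 1$ let $$P_{kD}=\{u\in\mathbb R^{d-1} : \langle u,v_i\rangle\ge -ka_i\text{ for all } i\},$$ let $C_{kD}\subseteq\mathbb R^{d-1}\times\mathbb R$ be the cone spanned by $P_{kD}\times\{1\}$, and let $R(k)=K[\chi^{(u,1)} : u\in P_{kD}\cap\mathbb Z^{d-1}]$ be the homogeneous coordinate ring of $(X,kD)$, graded by the last coordinate, with graded maximal ideal $\mathbf m_k$. With $q=p^N$ and $\mathbf m_k^{[q]}$ the ideal generated by the $q$-th powers of the elements of $\mathbf m_k$, put $$HKd(X,kD)(\lambda)=\lim_{N\to\infty}\frac{1}{q^{d-1}}\,\ell\Big(\big(R(k)/\mathbf m_k^{[q]}\big)_{\lfloor q\lambda\rfloor}\Big)\quad(\lambda\ge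 0),\qquad e_0(X,D)=\lim_{N\to\infty}\frac{d!}{N^d}\,\ell\big(R(1)/\mathbf m_1^N\big).$$ For $v\in\mathbb Z^{d-1}$ let $W_v=v+[0,1]^{d-1}$, and for $\lambda\ge0$ let $$\varphi_{kD}(\lambda)=\mathrm{Vol}_{d-1}\Big(\big(W_v\times\{z=\lambda+1\}\big)\setminus\bigcup_{u\in\mathbb Z^{d-1}}\big((u,1)+C_{kD}\big)\Big).$$ Then the two limits above exist; $\varphi_{kD}(\lambda)$ does not depend on $v$; $\varphi_{kD}$ is a compactly supported continuous function $[0,\infty)\to[0,1]$; $\varphi_{kD}(\lambda)=\varphi_D(k\lambda)$ for all $\lambda\ge0$ and all $k\ge1$; and $$HKd(X,kD)(\lambda+1)=\frac{e_0(X,D)\,k^{d-1}}{(d-1)!}\,\varphi_{kD}(\lambda)+O(k^{d-2}),$$ where the constant in the error term depends only on the toric pair $(X,D)$: the estimate holds uniformly in $\lambda\ge 0$ and $k\ge 1$. -/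

import Mathlib

open CategoryTheory CategoryTheory.Limits AlgebraicGeometry MeasureTheory Filter Topology

noncomputable section

namespace ToricHK

universe u

/-! ## Lattices, cones and fans

The lattices `N` and `M = Hom(N, ℤ)` of rank `n = d - 1` are both written `Fin n → ℤ`, with the
dot product as the dual pairing; `N_ℝ` and `M_ℝ` are `Fin n → ℝ`. -/

/-- The inclusion `ℤⁿ → ℝⁿ`. -/
def toReal {n : ℕ} (m : Fin n → ℤ) : Fin n → ℝ := fun i => (m i : ℝ)

/-- The lattice points of a subset of `ℝⁿ`. -/
def latticePoints {n : ℕ} (P : Set (Fin n → ℝ)) : Set (Fin n → ℤ) := {m | toReal m ∈ P}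

/-- `τ` is a face of the rational cone `σ`: it is cut out of `σ` by a hyperplane `m^⊥` with `m` a
lattice point of the dual cone `σ^∨`. -/
def IsFace {n : ℕ} (τ σ : PointedCone ℝ (Fin n → ℝ)) : Prop :=
  ∃ m : Fin n → ℤ, (∀ v ∈ σ, 0 ≤ toReal m ⬝ᵥ v) ∧ ∀ v, v ∈ τ ↔ v ∈ σ ∧ toReal m ⬝ᵥ v = 0

/-- A fan in `N_ℝ`: a finite collection of strongly convex rational polyhedral cones, containing
the cone `{0}` (i.e. nonempty), closed under faces, any two of which meet in a common face. -/
structure Fan (n : ℕ) where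
  cones : Set (PointedCone ℝ (Fin n → ℝ))
  finite : cones.Finite
  bot_mem : ⊥ ∈ cones
  rational : ∀ σ ∈ cones, ∃ s : Finset (Fin n → ℤ), σ = PointedCone.hull ℝ (toReal '' (s : Set _))
  stronglyConvex : ∀ σ ∈ cones, ∀ v ∈ σ, -v ∈ σ → v = 0
  face_mem : ∀ σ ∈ cones, ∀ τ, IsFace τ σ → τ ∈ cones
  inter_face : ∀ σ ∈ cones, ∀ τ ∈ cones, IsFace (σ ⊓ τ) σ

/-- The fan is complete if its cones cover `N_ℝ`. -/
def Fan.IsComplete {n : ℕ} (Δ : Fan n) : Prop := ∀ v : Fin n → ℝ, ∃ σ ∈ Δ.cones, v ∈ σ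

/-! ## The toric variety of a fan -/

/-- The semigroup `S_σ = σ^∨ ∩ M`. -/
def dualSemigroup {n : ℕ} (σ : PointedCone ℝ (Fin n → ℝ)) : AddSubmonoid (Fin n → ℤ) where
  carrier := {m | ∀ v ∈ σ, 0 ≤ toReal m ⬝ᵥ v}
  zero_mem' := by
    intro v _
    have h : toReal (0 : Fin n → ℤ) = 0 := by ext i; simp [toReal]
    simp [h]
  add_mem' := by
    intro a b ha hb v hv
    have h : toReal (a + b) = toReal a + toReal b := by ext i; simp [toReal]
    rw [h, add_dotProduct]
    exact add_nonneg (ha v hv) (hb v hv)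

lemma dualSemigroup_anti {n : ℕ} {σ τ : PointedCone ℝ (Fin n → ℝ)} (h : τ ≤ σ) :
    dualSemigroup σ ≤ dualSemigroup τ := fun _ hm v hv => hm v (h hv)

/-- The inclusion `K[S_σ] → K[S_τ]` for `τ ⊆ σ`. -/
def restrictHom (K : Type u) [Field K] {n : ℕ} {σ τ : PointedCone ℝ (Fin n → ℝ)} (h : τ ≤ σ) :
    AddMonoidAlgebra K (dualSemigroup σ) →+* AddMonoidAlgebra K (dualSemigroup τ) :=
  AddMonoidAlgebra.mapDomainRingHom K (AddSubmonoid.inclusion (dualSemigroup_anti h))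

/-- The affine toric variety `U_σ = Spec K[S_σ]`. -/
abbrev affineChart (K : Type u) [Field K] {n : ℕ} (σ : PointedCone ℝ (Fin n → ℝ)) : Scheme.{u} :=
  Spec (CommRingCat.of (AddMonoidAlgebra K (dualSemigroup σ)))

/-- The map `U_τ → U_σ` for `τ ⊆ σ`. -/
abbrev chartMap (K : Type u) [Field K] {n : ℕ} {σ τ : PointedCone ℝ (Fin n → ℝ)} (h : τ ≤ σ) :
    affineChart K τ ⟶ affineChart K σ :=
  Spec.map (CommRingCat.ofHom (restrictHom K h))

lemma restrictHom_refl (K : Type u) [Field K] {n : ℕ} (σ : PointedCone ℝ (Fin n → ℝ)) :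
    restrictHom K (le_refl σ) = RingHom.id _ := by
  have h : AddSubmonoid.inclusion (dualSemigroup_anti (le_refl σ)) = AddMonoidHom.id _ := rfl
  rw [restrictHom, h, AddMonoidAlgebra.mapDomainRingHom_id]

lemma restrictHom_comp (K : Type u) [Field K] {n : ℕ} {σ τ ρ : PointedCone ℝ (Fin n → ℝ)}
    (h : τ ≤ σ) (h' : ρ ≤ τ) :
    (restrictHom K h').comp (restrictHom K h) = restrictHom K (h'.trans h) := by
  rw [restrictHom, restrictHom, ← AddMonoidAlgebra.mapDomainRingHom_comp]
  rfl

/-- The diagram of the charts `U_σ`, `σ ∈ Δ`, ordered by inclusion (that is, by the face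
relation). -/
def chartDiagram (K : Type u) [Field K] {n : ℕ} (Δ : Fan n) : Δ.cones ⥤ Scheme.{u} where
  obj σ := affineChart K σ.1
  map f := chartMap K (leOfHom f)
  map_id σ := by
    rw [chartMap, restrictHom_refl]
    exact Spec.map_id _
  map_comp f g := by
    rw [chartMap, chartMap, chartMap, ← Spec.map_comp, ← CommRingCat.ofHom_comp,
      restrictHom_comp]

lemma Fan.isFace_of_le {n : ℕ} (Δ : Fan n) {σ τ : PointedCone ℝ (Fin n → ℝ)} (hσ : σ ∈ Δ.cones)
    (hτ : τ ∈ Δ.cones) (h : τ ≤ σ) : IsFace τ σ := by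
  have := Δ.inter_face σ hσ τ hτ
  rwa [inf_eq_right.mpr h] at this

/-- If `τ = σ ∩ m^⊥` then every element of `S_τ` is of the form `s - N m` with `s ∈ S_σ`. -/
lemma exists_add_nsmul_mem {n : ℕ} {σ τ : PointedCone ℝ (Fin n → ℝ)} {s : Finset (Fin n → ℤ)}
    (hs : σ = PointedCone.hull ℝ (toReal '' (s : Set _))) {m : Fin n → ℤ}
    (hm : m ∈ dualSemigroup σ) (hτ : ∀ v, v ∈ τ ↔ v ∈ σ ∧ toReal m ⬝ᵥ v = 0)
    {w : Fin n → ℤ} (hw : w ∈ dualSemigroup τ) :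
    ∃ N : ℕ, ∀ N' ≥ N, w + N' • m ∈ dualSemigroup σ := by
  have hadd : ∀ N : ℕ, ∀ v, toReal (w + N • m) ⬝ᵥ v = toReal w ⬝ᵥ v + N * (toReal m ⬝ᵥ v) := by
    intro N v
    have h : toReal (w + N • m) = toReal w + (N : ℝ) • toReal m := by ext i; simp [toReal]
    rw [h, add_dotProduct, smul_dotProduct, smul_eq_mul]
  have hgen : ∀ a ∈ s, toReal a ∈ σ := fun a ha => by
    rw [hs]; exact PointedCone.subset_hull ⟨a, ha, rfl⟩
  have key : ∀ a ∈ s, ∃ N : ℕ, ∀ N' ≥ N, 0 ≤ toReal (w + N' • m) ⬝ᵥ toReal a := by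
    intro a ha
    rcases (hm _ (hgen a ha)).eq_or_lt with h0 | hpos
    · refine ⟨0, fun N' _ => ?_⟩
      rw [hadd, ← h0, mul_zero, add_zero]
      exact hw _ ((hτ _).2 ⟨hgen a ha, h0.symm⟩)
    · obtain ⟨N, hN⟩ := exists_nat_ge (-(toReal w ⬝ᵥ toReal a) / (toReal m ⬝ᵥ toReal a))
      refine ⟨N, fun N' hN' => ?_⟩
      rw [hadd]
      have h1 : (N : ℝ) ≤ N' := by exact_mod_cast hN'
      have h2 := (div_le_iff₀ hpos).1 (hN.trans h1)
      linarith
  choose! f hf using key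
  refine ⟨s.sup f, fun N' hN' v hv => ?_⟩
  rw [hs] at hv
  induction hv using Submodule.span_induction with
  | mem x hx =>
    obtain ⟨a, ha, rfl⟩ := hx
    exact hf a ha N' ((Finset.le_sup ha).trans hN')
  | zero => simp
  | add x y _ _ hx hy => rw [dotProduct_add]; exact add_nonneg hx hy
  | smul c x _ hx =>
    have : c • x = (c : ℝ) • x := rfl
    rw [this, dotProduct_smul]
    exact mul_nonneg c.2 hx

/-- For a face `τ = σ ∩ m^⊥`, the ring `K[S_τ]` is the localization of `K[S_σ]` at `χ^m`. -/
lemma isLocalization_of_face (K : Type u) [Field K] {n : ℕ} {σ τ : PointedCone ℝ (Fin n → ℝ)}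
    {s : Finset (Fin n → ℤ)} (hs : σ = PointedCone.hull ℝ (toReal '' (s : Set _)))
    (h : τ ≤ σ) {m : Fin n → ℤ} (hm : m ∈ dualSemigroup σ)
    (hτ : ∀ v, v ∈ τ ↔ v ∈ σ ∧ toReal m ⬝ᵥ v = 0) :
    letI := (restrictHom K h).toAlgebra
    IsLocalization.Away (AddMonoidAlgebra.single (⟨m, hm⟩ : dualSemigroup σ) (1 : K))
      (AddMonoidAlgebra K (dualSemigroup τ)) := by
  let _ := (restrictHom K h).toAlgebra
  have hal : ∀ x, algebraMap (AddMonoidAlgebra K (dualSemigroup σ))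
      (AddMonoidAlgebra K (dualSemigroup τ)) x = restrictHom K h x := fun _ => rfl
  have hsingle : ∀ (a : dualSemigroup σ) (c : K),
      restrictHom K h (AddMonoidAlgebra.single a c) =
        AddMonoidAlgebra.single (⟨a.1, dualSemigroup_anti h a.2⟩ : dualSemigroup τ) c := by
    intro a c
    exact AddMonoidAlgebra.mapDomain_single
  have hneg : -m ∈ dualSemigroup τ := by
    intro v hv
    have h1 : toReal (-m) = - toReal m := by ext i; simp [toReal]
    rw [h1, neg_dotProduct, ((hτ v).1 hv).2, neg_zero]
  refine IsLocalization.Away.mk _ ?_ ?_ ?_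
  · rw [hal, hsingle]
    refine IsUnit.of_mul_eq_one (AddMonoidAlgebra.single ⟨-m, hneg⟩ 1) ?_
    rw [AddMonoidAlgebra.single_mul_single, AddMonoidAlgebra.one_def]
    congr 1
    · ext1; simp
    · simp
  · intro z
    have key : ∃ N : ℕ, ∀ N' ≥ N, ∃ a : AddMonoidAlgebra K (dualSemigroup σ),
        z * algebraMap _ _ (AddMonoidAlgebra.single (⟨m, hm⟩ : dualSemigroup σ) (1 : K)) ^ N' =
          algebraMap _ _ a := by
      induction z using AddMonoidAlgebra.induction_linear with
      | zero => exact ⟨0, fun _ _ => ⟨0, by simp⟩⟩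
      | add f g hf hg =>
        obtain ⟨N₁, h₁⟩ := hf
        obtain ⟨N₂, h₂⟩ := hg
        refine ⟨max N₁ N₂, fun N' hN' => ?_⟩
        obtain ⟨a, ha⟩ := h₁ N' (le_trans (le_max_left _ _) hN')
        obtain ⟨b, hb⟩ := h₂ N' (le_trans (le_max_right _ _) hN')
        exact ⟨a + b, by rw [add_mul, ha, hb, map_add]⟩
      | single w c =>
        obtain ⟨N, hN⟩ := exists_add_nsmul_mem hs hm hτ w.2
        refine ⟨N, fun N' hN' => ⟨AddMonoidAlgebra.single ⟨w.1 + N' • m, hN N' hN'⟩ c, ?_⟩⟩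
        rw [hal, hal, hsingle, hsingle, AddMonoidAlgebra.single_pow, one_pow,
          AddMonoidAlgebra.single_mul_single, mul_one]
        rfl
    obtain ⟨N, hN⟩ := key
    obtain ⟨a, ha⟩ := hN N le_rfl
    exact ⟨N, a, ha⟩
  · intro a b hab
    refine ⟨0, ?_⟩
    have hinj : Function.Injective (restrictHom K h) := AddMonoidAlgebra.mapDomain_injective
      (Set.inclusion_injective (dualSemigroup_anti h))
    rw [hinj hab]

lemma isOpenImmersion_chartMap (K : Type u) [Field K] {n : ℕ} (Δ : Fan n)
    {σ τ : PointedCone ℝ (Fin n → ℝ)} (hσ : σ ∈ Δ.cones) (hτ : τ ∈ Δ.cones) (h : τ ≤ σ) :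
    IsOpenImmersion (chartMap K h) := by
  obtain ⟨s, hs⟩ := Δ.rational σ hσ
  obtain ⟨m, hm, hτm⟩ := Δ.isFace_of_le hσ hτ h
  let _ := (restrictHom K h).toAlgebra
  have := isLocalization_of_face K hs h hm hτm
  exact IsOpenImmersion.of_isLocalization
    (AddMonoidAlgebra.single (⟨m, hm⟩ : dualSemigroup σ) (1 : K))

instance (K : Type u) [Field K] {n : ℕ} (Δ : Fan n) {σ τ : Δ.cones} (f : σ ⟶ τ) :
    IsOpenImmersion ((chartDiagram K Δ).map f) :=
  isOpenImmersion_chartMap K Δ τ.2 σ.2 (leOfHom f)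

/-- The image of `U_τ → U_σ`, for the face `τ = σ ∩ m^⊥`, is the locus where `χ^m` does not
vanish. -/
lemma range_chartMap (K : Type u) [Field K] {n : ℕ} {σ τ : PointedCone ℝ (Fin n → ℝ)}
    {s : Finset (Fin n → ℤ)} (hs : σ = PointedCone.hull ℝ (toReal '' (s : Set _)))
    (h : τ ≤ σ) {m : Fin n → ℤ} (hm : m ∈ dualSemigroup σ)
    (hτ : ∀ v, v ∈ τ ↔ v ∈ σ ∧ toReal m ⬝ᵥ v = 0) :
    Set.range (chartMap K h) =
      (PrimeSpectrum.basicOpen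
        (AddMonoidAlgebra.single (⟨m, hm⟩ : dualSemigroup σ) (1 : K)) :
        Set (PrimeSpectrum (AddMonoidAlgebra K (dualSemigroup σ)))) := by
  let _ := (restrictHom K h).toAlgebra
  have := isLocalization_of_face K hs h hm hτ
  exact PrimeSpectrum.localization_away_comap_range
    (AddMonoidAlgebra K (dualSemigroup τ))
    (AddMonoidAlgebra.single (⟨m, hm⟩ : dualSemigroup σ) (1 : K))

instance (K : Type u) [Field K] {n : ℕ} (Δ : Fan n) :
    (chartDiagram K Δ ⋙ Scheme.forget).IsLocallyDirected where
  cond := by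
    intro τ₁ τ₂ σ f₁ f₂ x₁ x₂ hx
    change (chartMap K (leOfHom f₁)) x₁ = (chartMap K (leOfHom f₂)) x₂ at hx
    obtain ⟨s, hs⟩ := Δ.rational σ.1 σ.2
    obtain ⟨m₁, hm₁, h₁⟩ := Δ.isFace_of_le σ.2 τ₁.2 (leOfHom f₁)
    obtain ⟨m₂, hm₂, h₂⟩ := Δ.isFace_of_le σ.2 τ₂.2 (leOfHom f₂)
    have hm₁' : m₁ ∈ dualSemigroup σ.1 := hm₁
    have hm₂' : m₂ ∈ dualSemigroup σ.1 := hm₂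
    have hadd : toReal (m₁ + m₂) = toReal m₁ + toReal m₂ := by ext i; simp [toReal]
    have hle : τ₁.1 ⊓ τ₂.1 ≤ σ.1 := inf_le_left.trans (leOfHom f₁)
    have h₁₂ : ∀ v, v ∈ τ₁.1 ⊓ τ₂.1 ↔ v ∈ σ.1 ∧ toReal (m₁ + m₂) ⬝ᵥ v = 0 := by
      intro v
      rw [Submodule.mem_inf, h₁, h₂, hadd, add_dotProduct]
      constructor
      · rintro ⟨⟨hv, e₁⟩, _, e₂⟩
        exact ⟨hv, by rw [e₁, e₂, add_zero]⟩
      · rintro ⟨hv, e⟩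
        have e₁ := hm₁ v hv
        have e₂ := hm₂ v hv
        exact ⟨⟨hv, by linarith⟩, hv, by linarith⟩
    have hmem : τ₁.1 ⊓ τ₂.1 ∈ Δ.cones :=
      Δ.face_mem _ τ₁.2 _ (Δ.inter_face _ τ₁.2 _ τ₂.2)
    have hr := range_chartMap K hs hle (add_mem hm₁' hm₂') h₁₂
    have hr₁ := range_chartMap K hs (leOfHom f₁) hm₁' h₁
    have hr₂ := range_chartMap K hs (leOfHom f₂) hm₂' h₂
    have hx₁ : (chartMap K (leOfHom f₁)) x₁ ∈ Set.range (chartMap K (leOfHom f₁)) := ⟨_, rfl⟩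
    have hx₂ : (chartMap K (leOfHom f₁)) x₁ ∈ Set.range (chartMap K (leOfHom f₂)) := ⟨_, hx.symm⟩
    have hy : (chartMap K (leOfHom f₁)) x₁ ∈ Set.range (chartMap K hle) := by
      have e : (AddMonoidAlgebra.single (⟨m₁ + m₂, add_mem hm₁' hm₂'⟩ : dualSemigroup σ.1) (1 : K))
          = AddMonoidAlgebra.single ⟨m₁, hm₁'⟩ 1 * AddMonoidAlgebra.single ⟨m₂, hm₂'⟩ 1 := by
        rw [AddMonoidAlgebra.single_mul_single, mul_one]; rfl
      rw [hr, e, PrimeSpectrum.basicOpen_mul]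
      exact ⟨hr₁.subset hx₁, hr₂.subset hx₂⟩
    obtain ⟨y, hy⟩ := hy
    have := isOpenImmersion_chartMap K Δ σ.2 τ₁.2 (leOfHom f₁)
    have := isOpenImmersion_chartMap K Δ σ.2 τ₂.2 (leOfHom f₂)
    have c₁ : chartMap K (inf_le_left : τ₁.1 ⊓ τ₂.1 ≤ τ₁.1) ≫ chartMap K (leOfHom f₁) =
        chartMap K hle := by
      rw [chartMap, chartMap, chartMap, ← Spec.map_comp, ← CommRingCat.ofHom_comp, restrictHom_comp]
    have c₂ : chartMap K (inf_le_right : τ₁.1 ⊓ τ₂.1 ≤ τ₂.1) ≫ chartMap K (leOfHom f₂) =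
        chartMap K hle := by
      rw [chartMap, chartMap, chartMap, ← Spec.map_comp, ← CommRingCat.ofHom_comp, restrictHom_comp]
    have l₁ : (⟨τ₁.1 ⊓ τ₂.1, hmem⟩ : Δ.cones) ≤ τ₁ := (inf_le_left : τ₁.1 ⊓ τ₂.1 ≤ τ₁.1)
    have l₂ : (⟨τ₁.1 ⊓ τ₂.1, hmem⟩ : Δ.cones) ≤ τ₂ := (inf_le_right : τ₁.1 ⊓ τ₂.1 ≤ τ₂.1)
    refine ⟨⟨τ₁.1 ⊓ τ₂.1, hmem⟩, homOfLE l₁, homOfLE l₂, y, ?_, ?_⟩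
    · apply (chartMap K (leOfHom f₁)).isOpenEmbedding.injective
      rw [← hy, ← c₁, Scheme.Hom.comp_apply]
      rfl
    · apply (chartMap K (leOfHom f₂)).isOpenEmbedding.injective
      rw [← hx, ← hy, ← c₂, Scheme.Hom.comp_apply]
      rfl

/-- The toric variety `X(Δ)` over `K`: the charts `U_σ`, `σ ∈ Δ`, glued along the open immersions
`U_τ → U_σ` for the faces `τ` of `σ`. -/
def toricVariety (K : Type u) [Field K] {n : ℕ} (Δ : Fan n) : Scheme.{u} :=
  colimit (chartDiagram K Δ)

/-- The open immersion `U_σ → X(Δ)`. -/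
def chartι (K : Type u) [Field K] {n : ℕ} (Δ : Fan n) (σ : Δ.cones) :
    affineChart K σ.1 ⟶ toricVariety K Δ :=
  colimit.ι (chartDiagram K Δ) σ

/-- The embedding of the torus `T = Spec K[M]` in `X(Δ)`, through the chart `U_{0}`. -/
def torusι (K : Type u) [Field K] {n : ℕ} (Δ : Fan n) :
    Spec (CommRingCat.of (AddMonoidAlgebra K (Fin n → ℤ))) ⟶ toricVariety K Δ :=
  Spec.map (CommRingCat.ofHom
    (AddMonoidAlgebra.mapDomainRingHom K (dualSemigroup (⊥ : PointedCone ℝ (Fin n → ℝ))).subtype))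
    ≫ chartι K Δ ⟨⊥, Δ.bot_mem⟩

/-! ## Torus-invariant divisors -/

/-- The primitive generators `v_i` of the rays (one-dimensional cones) of the fan. -/
def Fan.rays {n : ℕ} (Δ : Fan n) : Set (Fin n → ℤ) :=
  {v | (∀ (k : ℤ) (w : Fin n → ℤ), v = k • w → IsUnit k) ∧
    PointedCone.hull ℝ {toReal v} ∈ Δ.cones}

/-- A `T`-divisor `D = ∑ a_i D_i`, given by the integers `a_i`; here `D_i` is the closure of the
torus orbit of the `i`-th ray. -/
abbrev Fan.TDivisor {n : ℕ} (Δ : Fan n) : Type := Δ.rays → ℤ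

/-- The polytope `P_D = {u ∈ M_ℝ | ⟨u, v_i⟩ ≥ -a_i for all i}`. -/
def polytope {n : ℕ} {Δ : Fan n} (D : Δ.TDivisor) : Set (Fin n → ℝ) :=
  {u | ∀ i : Δ.rays, -(D i : ℝ) ≤ u ⬝ᵥ toReal i.1}

/-- The character `χ^u`, a rational function on `X`, generates the invertible sheaf `O(D)` on the
chart `U_σ`: the divisor `div(χ^u) + D = ∑ (⟨u, v_i⟩ + a_i) D_i` is zero on `U_σ`, which meets
exactly those `D_i` with `v_i ∈ σ`. -/
def GeneratesOn {n : ℕ} {Δ : Fan n} (D : Δ.TDivisor) (u : Fin n → ℤ)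
    (σ : PointedCone ℝ (Fin n → ℝ)) : Prop :=
  ∀ i : Δ.rays, toReal i.1 ∈ σ → u ⬝ᵥ i.1 + D i = 0

/-- `D` is Cartier: it is principal on every chart. -/
def IsCartier {n : ℕ} {Δ : Fan n} (D : Δ.TDivisor) : Prop :=
  ∀ σ ∈ Δ.cones, ∃ u : Fin n → ℤ, GeneratesOn D u σ

/-- `O(D)` is generated by its global sections. These are spanned by the `χ^u` with
`u ∈ P_D ∩ M`, and every chart `U_σ` has a point in all the `D_i` that meet it, so this says
that one of these sections generates `O(D)` on `U_σ`, for every `σ`. -/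
def IsGloballyGenerated {n : ℕ} {Δ : Fan n} (D : Δ.TDivisor) : Prop :=
  ∀ σ ∈ Δ.cones, ∃ u ∈ latticePoints (polytope D), GeneratesOn D u σ

attribute [local instance] MvPolynomial.gradedAlgebra

/-- The projective space over `K` with homogeneous coordinates `Y_u`, `u ∈ A`. -/
def projSpace (K : Type u) [Field K] {n : ℕ} (A : Set (Fin n → ℤ)) : Scheme.{u} :=
  Proj (MvPolynomial.homogeneousSubmodule A K)

/-- The ring homomorphism `K[Y_u | u ∈ A] → K[M]`, `Y_u ↦ χ^u`. -/
def monomialHom (K : Type u) [Field K] {n : ℕ} (A : Set (Fin n → ℤ)) :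
    MvPolynomial A K →+* AddMonoidAlgebra K (Fin n → ℤ) :=
  (MvPolynomial.aeval fun w : A => AddMonoidAlgebra.single w.1 (1 : K)).toRingHom

lemma isUnit_monomialHom_X (K : Type u) [Field K] {n : ℕ} (A : Set (Fin n → ℤ)) (w : A) :
    IsUnit (monomialHom K A (MvPolynomial.X w)) := by
  refine IsUnit.of_mul_eq_one (AddMonoidAlgebra.single (-w.1) 1) ?_
  simp [monomialHom, AddMonoidAlgebra.single_mul_single, AddMonoidAlgebra.one_def]

/-- The homomorphism from the coordinate ring of `{Y_w ≠ 0}` to `K[M]`,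
`Y_u / Y_w ↦ χ^u / χ^w`. -/
def awayMonomialHom (K : Type u) [Field K] {n : ℕ} (A : Set (Fin n → ℤ)) (w : A) :
    HomogeneousLocalization.Away (MvPolynomial.homogeneousSubmodule A K) (MvPolynomial.X w) →+*
      AddMonoidAlgebra K (Fin n → ℤ) :=
  (IsLocalization.Away.lift (S := Localization.Away (MvPolynomial.X w : MvPolynomial A K))
    (MvPolynomial.X w) (isUnit_monomialHom_X K A w)).comp
    (algebraMap _ (Localization.Away (MvPolynomial.X w : MvPolynomial A K)))

/-- The morphism from the torus to projective space `x ↦ (χ^u(x))_{u ∈ A}`, written in the affine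
chart `{Y_w ≠ 0}`; it does not depend on `w ∈ A`. -/
def torusToProj (K : Type u) [Field K] {n : ℕ} (A : Set (Fin n → ℤ)) (w : A) :
    Spec (CommRingCat.of (AddMonoidAlgebra K (Fin n → ℤ))) ⟶ projSpace K A :=
  Spec.map (CommRingCat.ofHom (awayMonomialHom K A w)) ≫
    Proj.awayι (MvPolynomial.homogeneousSubmodule A K) (MvPolynomial.X w)
      (MvPolynomial.isHomogeneous_X K w) Nat.one_pos

/-- `D` is a very ample `T`-Cartier divisor on `X(Δ)`: `O(D)` is generated by its global
sections, and the morphism that these define, `φ_D : x ↦ (χ^u(x))_{u ∈ P_D ∩ M}`, is a closed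
immersion. As the torus is dense in the integral scheme `X(Δ)` and projective space is separated,
`φ_D` is determined by its restriction to the torus. -/
structure IsVeryAmple (K : Type u) [Field K] {n : ℕ} {Δ : Fan n} (D : Δ.TDivisor) : Prop where
  cartier : IsCartier D
  globallyGenerated : IsGloballyGenerated D
  closedImmersion : ∃ φ : toricVariety K Δ ⟶ projSpace K (latticePoints (polytope D)),
    (∀ w, torusι K Δ ≫ φ = torusToProj K (latticePoints (polytope D)) w) ∧ IsClosedImmersion φ

/-! ## The homogeneous coordinate ring, its Hilbert-Kunz density function and multiplicity -/

/-- The semigroup `S ⊆ M × ℕ` generated by the `(u, 1)` with `u ∈ P_D ∩ M`. -/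
def coordSemigroup {n : ℕ} {Δ : Fan n} (D : Δ.TDivisor) : AddSubmonoid ((Fin n → ℤ) × ℕ) :=
  AddSubmonoid.closure ((fun u => (u, 1)) '' latticePoints (polytope D))

/-- The homogeneous coordinate ring `R = K[S]` of `(X, D)`. -/
abbrev CoordRing (K : Type u) [Field K] {n : ℕ} {Δ : Fan n} (D : Δ.TDivisor) : Type u :=
  AddMonoidAlgebra K (coordSemigroup D)

/-- The graded piece `R_j`, where `χ^{(u, j)}` has degree `j`. -/
def gradedPiece (K : Type u) [Field K] {n : ℕ} {Δ : Fan n} (D : Δ.TDivisor) (j : ℕ) :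
    Submodule K (CoordRing K D) :=
  Submodule.span K {x | ∃ s : coordSemigroup D, s.1.2 = j ∧ x = AddMonoidAlgebra.single s 1}

/-- The graded maximal ideal of `R`, generated by the elements of positive degree. -/
def gradedMaxIdeal (K : Type u) [Field K] {n : ℕ} {Δ : Fan n} (D : Δ.TDivisor) :
    Ideal (CoordRing K D) :=
  Ideal.span {x | ∃ j, 0 < j ∧ x ∈ gradedPiece K D j}

/-- The ideal `I^{[q]}` generated by the `q`-th powers of the elements of `I`. -/
def bracketPower {R : Type*} [CommRing R] (I : Ideal R) (q : ℕ) : Ideal R :=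
  Ideal.span ((fun x => x ^ q) '' I)

/-- `ℓ((R / I)_j)`, the length of the degree `j` part of `R / I` for a homogeneous ideal `I`,
that is, its dimension over the field `K = R_0`. -/
def quotientLength (K : Type u) [Field K] {n : ℕ} {Δ : Fan n} (D : Δ.TDivisor)
    (I : Ideal (CoordRing K D)) (j : ℕ) : ℕ :=
  Module.finrank K ((gradedPiece K D j).map (Ideal.Quotient.mkₐ K I).toLinearMap)

/-- `f_N(x) = q^{-(d-1)} ℓ(R / m^{[q]})_{⌊q x⌋}`, where `q = p^N` and `d - 1 = n = dim X`. -/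
def hkDensitySeq (p : ℕ) (K : Type u) [Field K] {n : ℕ} {Δ : Fan n} (D : Δ.TDivisor) (N : ℕ)
    (x : ℝ) : ℝ :=
  (quotientLength K D (bracketPower (gradedMaxIdeal K D) (p ^ N)) ⌊(p : ℝ) ^ N * x⌋₊ : ℝ) /
    ((p : ℝ) ^ N) ^ n

/-- The Hilbert-Kunz density function `HKd(X, D) = lim f_N`. -/
def HKd (p : ℕ) (K : Type u) [Field K] {n : ℕ} {Δ : Fan n} (D : Δ.TDivisor) (x : ℝ) : ℝ :=
  limUnder atTop fun N => hkDensitySeq p K D N x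

/-- `d! ℓ(R / m^N) / N^d`, where `d = n + 1 = dim R`; as `R / m = K`, lengths are dimensions
over `K`. -/
def multiplicitySeq (K : Type u) [Field K] {n : ℕ} {Δ : Fan n} (D : Δ.TDivisor) (N : ℕ) : ℝ :=
  (Nat.factorial (n + 1) : ℝ) * (Module.finrank K (CoordRing K D ⧸ gradedMaxIdeal K D ^ N) : ℝ) /
    (N : ℝ) ^ (n + 1)

/-- The multiplicity `e_0(X, D) = e_0(R, m) = lim d! ℓ(R / m^N) / N^d`. -/
def e₀ (K : Type u) [Field K] {n : ℕ} {Δ : Fan n} (D : Δ.TDivisor) : ℝ :=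
  limUnder atTop (multiplicitySeq K D)

/-! ## The function `φ_D` -/

/-- The cone `C_D ⊆ M_ℝ × ℝ` spanned by `P_D × {1}`. -/
def polytopeCone {n : ℕ} {Δ : Fan n} (D : Δ.TDivisor) : PointedCone ℝ ((Fin n → ℝ) × ℝ) :=
  PointedCone.hull ℝ (polytope D ×ˢ {1})

/-- The translate `(u, 1) + C_D`. -/
def translatedCone {n : ℕ} {Δ : Fan n} (D : Δ.TDivisor) (u : Fin n → ℤ) :
    Set ((Fin n → ℝ) × ℝ) :=
  (fun c => (toReal u, 1) + c) '' (polytopeCone D : Set ((Fin n → ℝ) × ℝ))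

/-- The unit cell `W_v = v + [0,1]^{d-1}`. -/
def unitCell {n : ℕ} (v : Fin n → ℤ) : Set (Fin n → ℝ) :=
  (fun x => toReal v + x) '' Set.Icc 0 1

/-- The volume of the part of `W_v × {z = λ + 1}` outside of all the `(u, 1) + C_D`, `u ∈ ℤ^{d-1}`.
The hyperplane `{z = λ + 1}` is identified with `ℝ^{d-1}`, with the Lebesgue measure. -/
def uncoveredVolume {n : ℕ} {Δ : Fan n} (D : Δ.TDivisor) (v : Fin n → ℤ) (t : ℝ) : ℝ :=
  (volume {x | x ∈ unitCell v ∧ (x, t + 1) ∉ ⋃ u : Fin n → ℤ, translatedCone D u}).toReal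

/-- The function `φ_D`, computed in the unit cell `W_0 = [0,1]^{d-1}`. -/
def phi {n : ℕ} {Δ : Fan n} (D : Δ.TDivisor) (t : ℝ) : ℝ := uncoveredVolume D 0 t

end ToricHK
end

open ToricHK

/-!
Write `n = d - 1`, `P = P_D`, let `A` be the set of lattice points of `P`, fix `w ∈ A`, and let
`Q = P - w`, a convex body containing the origin. Three facts about very ample divisors carry the
proof (`HasSpanningSections`): `P` is bounded, `P` is the convex hull of `A`, and the differences of
elements of `A` generate `ℤⁿ`. The first two hold because the cones of a complete fan are generated by
their rays (`Fan.le_hull_rays`), so that the sections generating `O(D)` on the charts minimize all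
linear functionals on `P` (`IsGloballyGenerated.polytope_eq`). For the third, a closed immersion
is a monomorphism, hence so is the map from the torus to projective space, and this fails if the
differences generate a proper sublattice (`differenceLattice_eq_top_of_mono`).

The ideals `m^{[q]}` (by additivity of the Frobenius) and `m^N` are monomial, so the lengths count
elements of the semigroup `S ⊆ ℤⁿ × ℕ` of the coordinate ring (`quotientLength_bracketPower`,
`finrank_quotient_gradedMaxIdeal_pow`). As `S` contains a translate of its saturation
(`HasSpanningSections.exists_conductor`), in degree `j` it has all lattice points of `jP` up to
`o(j^n)` of them. Counting lattice points by volume gives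
`HKd(X, D)(t) = vol (tP \ ⋃_{u ∈ A} (u + (t - 1)P))` (`HasSpanningSections.tendsto_hkDensitySeq`)
and `e₀ = n! vol P` (`HasSpanningSections.tendsto_multiplicitySeq`).

At height `t` the cone `C_D` is `tP`, so `φ_D(t)` is the part of a unit cell not covered by the
translates `u + tP`, `u ∈ ℤⁿ` (`HasSpanningSections.uncoveredVolume_eq`), which gives
`φ_{kD}(t) = φ_D(kt)`. The uncovered set is periodic, so averaging over translations by a unit cube
shows that it fills the proportion `φ_D` of a large convex body, up to a boundary term
(`IsPeriodic.mul_le_volume`, `IsPeriodic.volume_le_mul`). With `μ = kt`, the region computing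
`HKd(X, kD)(t + 1)` differs from the uncovered part of `kP` only near the boundary of `kP` if `μ` is
bounded, and both are empty for large `μ`, where translates by lattice points of `kP` already cover
`(k + μ)P`. Boundary terms are at most `(k + a)^n - (k - b)^n = O(k^{n-1})`
(`exists_abs_volume_remainder_sub_le`).
-/

noncomputable section

namespace ToricHK

universe u

section

attribute [local instance] MvPolynomial.gradedAlgebra

/-! ### Very ampleness and the lattice spanned by the sections -/

lemma isOpenImmersion_chartι (K : Type u) [Field K] {n : ℕ} (Δ : Fan n) (σ : Δ.cones) :
    IsOpenImmersion (chartι K Δ σ) :=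
  (Scheme.IsLocallyDirected.openCover (chartDiagram K Δ)).map_prop σ

lemma mono_torusι (K : Type u) [Field K] {n : ℕ} (Δ : Fan n) : Mono (torusι K Δ) := by
  have h₁ := isOpenImmersion_chartι K Δ ⟨⊥, Δ.bot_mem⟩
  have hsurj : Function.Surjective (AddMonoidAlgebra.mapDomainRingHom K
      (dualSemigroup (⊥ : PointedCone ℝ (Fin n → ℝ))).subtype) := by
    intro x
    induction x using AddMonoidAlgebra.induction_linear with
    | zero => exact ⟨0, map_zero _⟩
    | add f g hf hg =>
      obtain ⟨a, rfl⟩ := hf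
      obtain ⟨b, rfl⟩ := hg
      exact ⟨a + b, map_add _ _ _⟩
    | single m c =>
      have hm : m ∈ dualSemigroup (⊥ : PointedCone ℝ (Fin n → ℝ)) := by
        intro v hv
        rw [Submodule.mem_bot] at hv
        simp [hv]
      exact ⟨AddMonoidAlgebra.single ⟨m, hm⟩ c, AddMonoidAlgebra.mapDomain_single⟩
  have h₂ : Mono (Spec.map (CommRingCat.ofHom (AddMonoidAlgebra.mapDomainRingHom K
      (dualSemigroup (⊥ : PointedCone ℝ (Fin n → ℝ))).subtype))) := by
    have := IsClosedImmersion.spec_of_surjective (CommRingCat.ofHom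
      (AddMonoidAlgebra.mapDomainRingHom K
        (dualSemigroup (⊥ : PointedCone ℝ (Fin n → ℝ))).subtype)) hsurj
    infer_instance
  exact mono_comp _ _

/-- The differences of the elements of `A` generate this subgroup of `ℤⁿ`. -/
def differenceLattice {n : ℕ} (A : Set (Fin n → ℤ)) : AddSubgroup (Fin n → ℤ) :=
  AddSubgroup.closure {x | ∃ a ∈ A, ∃ b ∈ A, x = a - b}

/-- The `K`-algebra homomorphism `K[M] → K[M / M']`, `χ^m ↦ χ^{[m]}`. -/
def quotientCharHom (K : Type u) [Field K] {n : ℕ} (H : AddSubgroup (Fin n → ℤ)) :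
    AddMonoidAlgebra K (Fin n → ℤ) →ₐ[K] AddMonoidAlgebra K ((Fin n → ℤ) ⧸ H) :=
  AddMonoidAlgebra.mapDomainAlgHom K K (QuotientAddGroup.mk' H)

/-- The `K`-algebra homomorphism `K[M] → K[M / M']`, `χ^m ↦ 1`. -/
def augmentationCharHom (K : Type u) [Field K] {n : ℕ} (H : AddSubgroup (Fin n → ℤ)) :
    AddMonoidAlgebra K (Fin n → ℤ) →ₐ[K] AddMonoidAlgebra K ((Fin n → ℤ) ⧸ H) :=
  AddMonoidAlgebra.mapDomainAlgHom K K (0 : (Fin n → ℤ) →+ (Fin n → ℤ) ⧸ H)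

lemma quotientCharHom_single (K : Type u) [Field K] {n : ℕ} (H : AddSubgroup (Fin n → ℤ))
    (m : Fin n → ℤ) (c : K) : quotientCharHom K H (AddMonoidAlgebra.single m c) =
      AddMonoidAlgebra.single (QuotientAddGroup.mk m) c := AddMonoidAlgebra.mapDomain_single

lemma augmentationCharHom_single (K : Type u) [Field K] {n : ℕ} (H : AddSubgroup (Fin n → ℤ))
    (m : Fin n → ℤ) (c : K) : augmentationCharHom K H (AddMonoidAlgebra.single m c) =
      AddMonoidAlgebra.single 0 c := AddMonoidAlgebra.mapDomain_single

/-- On a homogeneous polynomial of degree `i` in the sections, the two homomorphisms differ by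
the factor `χ^{i[w]}`, because all `u ∈ A` have the same class `[w]` modulo the differences. -/
lemma quotientCharHom_monomialHom (K : Type u) [Field K] {n : ℕ} (A : Set (Fin n → ℤ)) (w : A)
    {F : MvPolynomial A K} {i : ℕ} (hF : F.IsHomogeneous i) :
    quotientCharHom K (differenceLattice A) (monomialHom K A F) =
      AddMonoidAlgebra.single (QuotientAddGroup.mk w.1) 1 ^ i *
        augmentationCharHom K (differenceLattice A) (monomialHom K A F) := by
  have hcl : ∀ u : A, (QuotientAddGroup.mk u.1 : (Fin n → ℤ) ⧸ differenceLattice A) =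
      QuotientAddGroup.mk w.1 := fun u => by
    rw [QuotientAddGroup.eq]
    refine AddSubgroup.subset_closure ⟨w.1, w.2, u.1, u.2, by abel⟩
  have h1 : quotientCharHom K (differenceLattice A) (monomialHom K A F) =
      MvPolynomial.aeval (fun _ : A =>
        (AddMonoidAlgebra.single (QuotientAddGroup.mk w.1) 1 :
          AddMonoidAlgebra K ((Fin n → ℤ) ⧸ differenceLattice A))) F := by
    change ((quotientCharHom K (differenceLattice A)).comp (MvPolynomial.aeval _)) F = _
    congr 1
    ext u : 1
    simp [quotientCharHom_single, hcl]
  have h2 : augmentationCharHom K (differenceLattice A) (monomialHom K A F) =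
      MvPolynomial.aeval (fun _ : A =>
        (1 : AddMonoidAlgebra K ((Fin n → ℤ) ⧸ differenceLattice A))) F := by
    change ((augmentationCharHom K (differenceLattice A)).comp (MvPolynomial.aeval _)) F = _
    congr 1
    ext u : 1
    simp [augmentationCharHom_single, AddMonoidAlgebra.one_def]
  rw [h1, h2, MvPolynomial.aeval_def, MvPolynomial.aeval_def, MvPolynomial.eval₂_eq,
    MvPolynomial.eval₂_eq, Finset.mul_sum]
  refine Finset.sum_congr rfl fun d hd => ?_
  have hdeg : ∑ j ∈ d.support, d j = i := by
    have := hF (MvPolynomial.mem_support_iff.1 hd)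
    rw [← this, Finsupp.weight_apply]
    simp [Finsupp.sum]
  rw [Finset.prod_pow_eq_pow_sum, hdeg]
  simp [mul_comm]

/-- If the torus embeds in projective space by the characters in `A`, then the differences of the
elements of `A` generate the character lattice: the two homomorphisms `K[M] → K[M / M']` agree on
the degree-zero fractions of the sections. -/
theorem differenceLattice_eq_top_of_mono (K : Type u) [Field K] {n : ℕ} (A : Set (Fin n → ℤ))
    (w : A) (h : Mono (torusToProj K A w)) : differenceLattice A = ⊤ := by
  set H := differenceLattice A
  have hm : Mono (Spec.map (CommRingCat.ofHom (awayMonomialHom K A w))) := by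
    have h' : Mono (Spec.map (CommRingCat.ofHom (awayMonomialHom K A w)) ≫
      Proj.awayι (MvPolynomial.homogeneousSubmodule A K) (MvPolynomial.X w)
        (MvPolynomial.isHomogeneous_X K w) Nat.one_pos) := h
    exact @mono_of_mono _ _ _ _ _ _ _ h'
  have hX : (MvPolynomial.X w : MvPolynomial A K) ∈ MvPolynomial.homogeneousSubmodule A K 1 :=
    MvPolynomial.isHomogeneous_X K w
  have hcomp : ((quotientCharHom K H).toRingHom).comp (awayMonomialHom K A w) =
      ((augmentationCharHom K H).toRingHom).comp (awayMonomialHom K A w) := by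
    ext1 z
    obtain ⟨i, F, hF, rfl⟩ := HomogeneousLocalization.Away.mk_surjective
      (MvPolynomial.homogeneousSubmodule A K) hX z
    have hF' : F.IsHomogeneous i := by simpa using hF
    set z := HomogeneousLocalization.Away.mk (MvPolynomial.homogeneousSubmodule A K) hX i F hF
      with hz_def
    have hz : awayMonomialHom K A w z * AddMonoidAlgebra.single w.1 1 ^ i = monomialHom K A F := by
      have e : z.val * algebraMap (MvPolynomial A K) (Localization.Away (MvPolynomial.X w))
          (MvPolynomial.X w ^ i) = algebraMap _ _ F := by
        rw [hz_def, HomogeneousLocalization.Away.val_mk, Localization.mk_eq_mk']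
        exact IsLocalization.mk'_spec _ F
          (⟨MvPolynomial.X w ^ i, i, rfl⟩ : Submonoid.powers (MvPolynomial.X w : MvPolynomial A K))
      have := congrArg (IsLocalization.Away.lift (MvPolynomial.X w) (isUnit_monomialHom_X K A w)) e
      rw [map_mul, IsLocalization.Away.lift_eq, IsLocalization.Away.lift_eq, map_pow] at this
      rw [← this]
      congr 1
      simp [monomialHom]
    have e1 := congrArg (quotientCharHom K H) hz
    have e2 := congrArg (augmentationCharHom K H) hz
    rw [quotientCharHom_monomialHom K A w hF', ← e2, map_mul, map_mul, map_pow, map_pow,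
      quotientCharHom_single, augmentationCharHom_single, ← AddMonoidAlgebra.one_def, one_pow,
      mul_one, mul_comm] at e1
    have hu : IsUnit ((AddMonoidAlgebra.single (QuotientAddGroup.mk w.1) 1 :
        AddMonoidAlgebra K ((Fin n → ℤ) ⧸ H)) ^ i) := by
      refine IsUnit.pow _ (IsUnit.of_mul_eq_one
        (AddMonoidAlgebra.single (-QuotientAddGroup.mk w.1) 1) ?_)
      rw [AddMonoidAlgebra.single_mul_single, AddMonoidAlgebra.one_def]
      simp
    exact hu.mul_left_cancel e1
  have hg : CommRingCat.ofHom (quotientCharHom K H).toRingHom =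
      CommRingCat.ofHom (augmentationCharHom K H).toRingHom := by
    apply Spec.map_injective
    rw [← cancel_mono (Spec.map (CommRingCat.ofHom (awayMonomialHom K A w))),
      ← Spec.map_comp, ← Spec.map_comp, ← CommRingCat.ofHom_comp, ← CommRingCat.ofHom_comp, hcomp]
  rw [eq_top_iff]
  intro m _
  have hm := congrArg (fun f => f.hom (AddMonoidAlgebra.single m 1)) hg
  change quotientCharHom K H _ = augmentationCharHom K H _ at hm
  rw [quotientCharHom_single, augmentationCharHom_single] at hm
  rw [← QuotientAddGroup.eq_zero_iff]
  exact AddMonoidAlgebra.single_left_injective one_ne_zero hm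

theorem IsVeryAmple.differenceLattice_eq_top {K : Type u} [Field K] {n : ℕ} {Δ : Fan n}
    {D : Δ.TDivisor} (hD : IsVeryAmple K D) :
    differenceLattice (latticePoints (polytope D)) = ⊤ := by
  obtain ⟨φ, hφ, hc⟩ := hD.closedImmersion
  obtain ⟨w, hw, -⟩ := hD.globallyGenerated ⊥ Δ.bot_mem
  have := mono_torusι K Δ
  have h : Mono (torusι K Δ ≫ φ) := mono_comp _ _
  rw [hφ ⟨w, hw⟩] at h
  exact differenceLattice_eq_top_of_mono K _ ⟨w, hw⟩ h

end

/-! ### Lattice points -/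

lemma toReal_zero {n : ℕ} : toReal (0 : Fin n → ℤ) = 0 := by ext i; simp [toReal]

lemma toReal_add {n : ℕ} (x y : Fin n → ℤ) : toReal (x + y) = toReal x + toReal y := by
  ext i; simp [toReal]

lemma toReal_sub {n : ℕ} (x y : Fin n → ℤ) : toReal (x - y) = toReal x - toReal y := by
  ext i; simp [toReal]

lemma toReal_neg {n : ℕ} (x : Fin n → ℤ) : toReal (-x) = -toReal x := by
  ext i; simp [toReal]

lemma toReal_zsmul {n : ℕ} (k : ℤ) (x : Fin n → ℤ) : toReal (k • x) = (k : ℝ) • toReal x := by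
  ext i; simp [toReal]

lemma toReal_nsmul {n : ℕ} (k : ℕ) (x : Fin n → ℤ) : toReal (k • x) = (k : ℝ) • toReal x := by
  ext i; simp [toReal]

lemma toReal_injective {n : ℕ} : Function.Injective (toReal : (Fin n → ℤ) → Fin n → ℝ) := by
  intro x y h
  ext i
  have := congrFun h i
  simpa [toReal] using this

lemma toReal_dotProduct {n : ℕ} (x y : Fin n → ℤ) :
    toReal x ⬝ᵥ toReal y = ((x ⬝ᵥ y : ℤ) : ℝ) := by
  simp [toReal, dotProduct]

lemma finite_latticePoints {n : ℕ} {P : Set (Fin n → ℝ)} (hP : Bornology.IsBounded P) :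
    (latticePoints P).Finite := by
  obtain ⟨C, hC⟩ := hP.exists_norm_le
  refine (Set.finite_Icc (fun _ => -⌈C⌉) (fun _ : Fin n => ⌈C⌉)).subset fun m hm => ?_
  have hb : ∀ i, |(m i : ℝ)| ≤ C := fun i => (norm_le_pi_norm (toReal m) i).trans (hC _ hm)
  refine ⟨fun i => ?_, fun i => ?_⟩
  · have := (abs_le.1 ((hb i).trans (Int.le_ceil C))).1
    exact_mod_cast this
  · have := (abs_le.1 ((hb i).trans (Int.le_ceil C))).2
    exact_mod_cast this

lemma exists_dotProduct_eq {n : ℕ} (f : (Fin n → ℝ) →L[ℝ] ℝ) :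
    ∃ y : Fin n → ℝ, ∀ x, f x = y ⬝ᵥ x := by
  refine ⟨fun i => f (fun j => if i = j then 1 else 0), fun x => ?_⟩
  have := LinearMap.pi_apply_eq_sum_univ (f : (Fin n → ℝ) →ₗ[ℝ] ℝ) x
  simp only [ContinuousLinearMap.coe_coe] at this
  rw [this, dotProduct]
  exact Finset.sum_congr rfl fun i _ => by rw [smul_eq_mul, mul_comm]

/-! ### The rays of a strongly convex rational cone -/

/-- A rational separation theorem. The real separating functional vanishes on `ℝ a`; it is
approximated by an integral one, and projecting this along `a` restores the vanishing. -/
lemma exists_int_orthogonal_pos {n : ℕ} (a : Fin n → ℤ) (ha : a ≠ 0) (t : Finset (Fin n → ℤ))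
    (h : ∀ c : ℝ, c • toReal a ∉ convexHull ℝ (toReal '' (t : Set (Fin n → ℤ)))) :
    ∃ m : Fin n → ℤ, toReal m ⬝ᵥ toReal a = 0 ∧ ∀ b ∈ t, 0 < toReal m ⬝ᵥ toReal b := by
  have hcomp : IsCompact (convexHull ℝ (toReal '' (t : Set (Fin n → ℤ)))) :=
    (t.finite_toSet.image _).isCompact_convexHull ℝ
  have hdisj : Disjoint (convexHull ℝ (toReal '' (t : Set (Fin n → ℤ))))
      (Submodule.span ℝ {toReal a} : Set (Fin n → ℝ)) := by
    rw [Set.disjoint_right]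
    intro x hx
    obtain ⟨c, rfl⟩ := Submodule.mem_span_singleton.1 hx
    exact h c
  obtain ⟨f, u, v, hf, huv, hv⟩ := geometric_hahn_banach_compact_closed (convex_convexHull ℝ _)
    hcomp (Submodule.convex _) (Submodule.closed_of_finiteDimensional _) hdisj
  have hv0 : v < 0 := by simpa using hv 0 (Submodule.zero_mem _)
  have hfa : f (toReal a) = 0 := by
    by_contra hne
    have := hv ((v / f (toReal a)) • toReal a)
      (Submodule.smul_mem _ _ (Submodule.mem_span_singleton_self _))
    rw [map_smul, smul_eq_mul, div_mul_cancel₀ _ hne] at this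
    exact lt_irrefl _ this
  obtain ⟨y, hy⟩ := exists_dotProduct_eq (-f)
  have hya : y ⬝ᵥ toReal a = 0 := by rw [← hy]; simp [hfa]
  have hyb : ∀ b ∈ t, 0 < y ⬝ᵥ toReal b := fun b hb => by
    rw [← hy]
    have := hf _ (subset_convexHull ℝ _ ⟨b, hb, rfl⟩)
    simp only [_root_.neg_apply]
    linarith
  have haa : 0 < toReal a ⬝ᵥ toReal a := by
    rw [toReal_dotProduct]
    have h0 : 0 ≤ a ⬝ᵥ a := Finset.sum_nonneg fun i _ => mul_self_nonneg _
    have h1 : a ⬝ᵥ a ≠ 0 := fun h => ha (dotProduct_self_eq_zero.1 h)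
    exact_mod_cast lt_of_le_of_ne h0 h1.symm
  -- the functional `g b` is `x ↦ ⟨Φ x, b⟩`, where `Φ` is a multiple of the projection along `a`
  let g : (Fin n → ℤ) → (Fin n → ℝ) → ℝ := fun b x =>
    (toReal a ⬝ᵥ toReal a) * (x ⬝ᵥ toReal b) - (x ⬝ᵥ toReal a) * (toReal a ⬝ᵥ toReal b)
  have hg : ∀ b, Continuous (g b) := fun b => by
    simp only [g, dotProduct]
    fun_prop
  have hgy : ∀ b ∈ t, 0 < g b y := fun b hb => by
    simp only [g, hya, zero_mul, sub_zero]
    exact mul_pos haa (hyb b hb)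
  have hev : ∀ᶠ N : ℕ in atTop, ∀ b ∈ t, 0 < g b (toReal fun i => ⌊(N : ℝ) * y i⌋) := by
    rw [eventually_all_finset]
    intro b hb
    obtain ⟨C, hC⟩ := (isCompact_Icc (a := (0 : Fin n → ℝ)) (b := 1)).bddAbove_image
      (hg b).continuousOn
    obtain ⟨N₀, hN₀⟩ := exists_nat_gt (C / g b y)
    filter_upwards [eventually_ge_atTop N₀] with N hN
    have hfr : g b (fun i => Int.fract ((N : ℝ) * y i)) ≤ C :=
      hC ⟨_, ⟨fun i => Int.fract_nonneg _, fun i => (Int.fract_lt_one _).le⟩, rfl⟩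
    have hdec : (toReal fun i => ⌊(N : ℝ) * y i⌋) =
        (N : ℝ) • y - fun i => Int.fract ((N : ℝ) * y i) := by
      ext i
      simp only [toReal, Pi.sub_apply, Pi.smul_apply, smul_eq_mul, Int.self_sub_fract]
    have hlin : g b (toReal fun i => ⌊(N : ℝ) * y i⌋) =
        N * g b y - g b (fun i => Int.fract ((N : ℝ) * y i)) := by
      rw [hdec]
      simp only [g, sub_dotProduct, smul_dotProduct, smul_eq_mul]
      ring
    have h2 : C < N₀ * g b y := (div_lt_iff₀ (hgy b hb)).1 hN₀
    have h3 : (N₀ : ℝ) * g b y ≤ N * g b y :=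
      mul_le_mul_of_nonneg_right (by exact_mod_cast hN) (hgy b hb).le
    linarith
  obtain ⟨N, hN⟩ := hev.exists
  set m₀ : Fin n → ℤ := fun i => ⌊(N : ℝ) * y i⌋
  refine ⟨(a ⬝ᵥ a) • m₀ - (m₀ ⬝ᵥ a) • a, ?_, fun b hb => ?_⟩
  · simp only [toReal_sub, toReal_zsmul, ← toReal_dotProduct, sub_dotProduct, smul_dotProduct,
      smul_eq_mul]
    ring
  · have := hN b hb
    simp only [toReal_sub, toReal_zsmul, ← toReal_dotProduct, sub_dotProduct, smul_dotProduct,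
      smul_eq_mul]
    exact this

lemma convexHull_le_hull {n : ℕ} (s : Set (Fin n → ℝ)) :
    convexHull ℝ s ⊆ (PointedCone.hull ℝ s : Set (Fin n → ℝ)) :=
  convexHull_min PointedCone.subset_hull (PointedCone.convex _)

lemma smul_mem_cone {n : ℕ} (σ : PointedCone ℝ (Fin n → ℝ)) {c : ℝ} (hc : 0 ≤ c) {x : Fin n → ℝ}
    (hx : x ∈ σ) : c • x ∈ σ := Submodule.smul_mem σ (⟨c, hc⟩ : {c : ℝ // 0 ≤ c}) hx

lemma convex_salient_diff_zero {n : ℕ} (σ : PointedCone ℝ (Fin n → ℝ))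
    (hσ : ∀ v ∈ σ, -v ∈ σ → v = 0) : Convex ℝ {x | x ∈ σ ∧ x ≠ 0} := by
  rintro x ⟨hx, hx0⟩ y ⟨hy, hy0⟩ a b ha hb hab
  have hax := smul_mem_cone σ ha hx
  have hby := smul_mem_cone σ hb hy
  refine ⟨σ.add_mem hax hby, fun h => ?_⟩
  have h1 : a • x = 0 := hσ _ hax (by rwa [neg_eq_of_add_eq_zero_right h])
  have h2 : b • y = 0 := by rwa [h1, zero_add] at h
  have ha0 : a = 0 := (smul_eq_zero.1 h1).resolve_right hx0
  have hb0 : b = 0 := (smul_eq_zero.1 h2).resolve_right hy0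
  simp [ha0, hb0] at hab

/-- An element of a generating set of a strongly convex rational cone which is not in the cone of
the others generates a face. -/
lemma isFace_hull_singleton {n : ℕ} {σ : PointedCone ℝ (Fin n → ℝ)}
    (hσ : ∀ v ∈ σ, -v ∈ σ → v = 0) {a : Fin n → ℤ} {t : Finset (Fin n → ℤ)}
    (hgen : σ = PointedCone.hull ℝ (insert (toReal a) (toReal '' (t : Set (Fin n → ℤ)))))
    (ha : a ≠ 0) (ht : 0 ∉ t)
    (hat : toReal a ∉ PointedCone.hull ℝ (toReal '' (t : Set (Fin n → ℤ)))) :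
    IsFace (PointedCone.hull ℝ {toReal a}) σ := by
  have haσ : toReal a ∈ σ := by
    rw [hgen]; exact PointedCone.subset_hull (Set.mem_insert _ _)
  have htσ : PointedCone.hull ℝ (toReal '' (t : Set (Fin n → ℤ))) ≤ σ := by
    rw [hgen]; exact Submodule.span_mono (Set.subset_insert _ _)
  obtain ⟨m, hma, hmt⟩ := exists_int_orthogonal_pos a ha t fun c hc => by
    have h1 : c • toReal a ∈ {x | x ∈ σ ∧ x ≠ 0} := by
      refine convexHull_min ?_ (convex_salient_diff_zero σ hσ) hc
      rintro _ ⟨b, hb, rfl⟩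
      refine ⟨htσ (PointedCone.subset_hull ⟨b, hb, rfl⟩), fun h0 => ht ?_⟩
      rw [← toReal_zero] at h0
      rwa [← toReal_injective h0]
    rcases le_or_gt c 0 with hc0 | hc0
    · refine h1.2 (hσ _ h1.1 ?_)
      rw [← neg_smul]
      exact smul_mem_cone σ (by linarith) haσ
    · have := smul_mem_cone _ (inv_nonneg.2 hc0.le) (convexHull_le_hull _ hc)
      rw [smul_smul, inv_mul_cancel₀ hc0.ne', one_smul] at this
      exact hat this
  have hpos : ∀ y ∈ PointedCone.hull ℝ (toReal '' (t : Set (Fin n → ℤ))),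
      0 ≤ toReal m ⬝ᵥ y ∧ (toReal m ⬝ᵥ y = 0 → y = 0) := by
    intro y hy
    induction hy using Submodule.span_induction with
    | mem x hx =>
      obtain ⟨b, hb, rfl⟩ := hx
      exact ⟨(hmt b hb).le, fun h => absurd h (hmt b hb).ne'⟩
    | zero => simp
    | add x y _ _ hx hy =>
      rw [dotProduct_add]
      refine ⟨add_nonneg hx.1 hy.1, fun h => ?_⟩
      rw [hx.2 (by linarith [hx.1, hy.1]), hy.2 (by linarith [hx.1, hy.1]), add_zero]
    | smul c x _ hx =>
      have hcx : c • x = (c : ℝ) • x := rfl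
      rw [hcx, dotProduct_smul, smul_eq_mul]
      refine ⟨mul_nonneg c.2 hx.1, fun h => ?_⟩
      rcases mul_eq_zero.1 h with h | h
      · rw [h, zero_smul]
      · rw [hx.2 h, smul_zero]
  have hdec : ∀ v ∈ σ, ∃ c : ℝ, 0 ≤ c ∧
      ∃ y ∈ PointedCone.hull ℝ (toReal '' (t : Set (Fin n → ℤ))), v = c • toReal a + y := by
    intro v hv
    rw [hgen] at hv
    obtain ⟨c, y, hy, rfl⟩ := Submodule.mem_span_insert.1 hv
    exact ⟨c, c.2, y, hy, rfl⟩
  refine ⟨m, fun v hv => ?_, fun v => ⟨fun hv => ?_, fun hv => ?_⟩⟩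
  · obtain ⟨c, hc, y, hy, rfl⟩ := hdec v hv
    rw [dotProduct_add, dotProduct_smul, hma, smul_zero, zero_add]
    exact (hpos y hy).1
  · obtain ⟨c, rfl⟩ := Submodule.mem_span_singleton.1 hv
    refine ⟨smul_mem_cone σ c.2 haσ, ?_⟩
    have hcx : c • toReal a = (c : ℝ) • toReal a := rfl
    rw [hcx, dotProduct_smul, hma, smul_zero]
  · obtain ⟨c, hc, y, hy, rfl⟩ := hdec v hv.1
    have h0 := hv.2
    rw [dotProduct_add, dotProduct_smul, hma, smul_zero, zero_add] at h0
    rw [(hpos y hy).2 h0, add_zero]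
    exact smul_mem_cone _ hc (PointedCone.subset_hull rfl)

lemma exists_primitive {n : ℕ} (a : Fin n → ℤ) (ha : a ≠ 0) :
    ∃ (g : ℤ) (b : Fin n → ℤ), 0 < g ∧ a = g • b ∧
      ∀ (k : ℤ) (w : Fin n → ℤ), b = k • w → IsUnit k := by
  obtain ⟨i₀, hi₀⟩ : ∃ i, a i ≠ 0 := by
    by_contra! h
    exact ha (funext h)
  obtain ⟨b, hb, hgcd⟩ := Finset.extract_gcd a ⟨i₀, Finset.mem_univ i₀⟩
  have hg0 : Finset.univ.gcd a ≠ 0 := fun h => hi₀ (Finset.gcd_eq_zero_iff.1 h i₀ (Finset.mem_univ _))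
  refine ⟨Finset.univ.gcd a, b, ?_, ?_, fun k w hk => ?_⟩
  · refine lt_of_le_of_ne ?_ hg0.symm
    exact Int.nonneg_of_normalize_eq_self Finset.normalize_gcd
  · ext i
    exact hb i (Finset.mem_univ i)
  · refine isUnit_of_dvd_one ?_
    rw [← hgcd]
    exact Finset.dvd_gcd fun i _ => ⟨w i, by rw [hk]; rfl⟩

lemma hull_singleton_smul {n : ℕ} (v : Fin n → ℝ) {g : ℝ} (hg : 0 < g) :
    PointedCone.hull ℝ {g • v} = PointedCone.hull ℝ {v} := by
  refine le_antisymm (Submodule.span_le.2 ?_) (Submodule.span_le.2 ?_)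
  · rintro _ rfl
    exact smul_mem_cone _ hg.le (PointedCone.subset_hull rfl)
  · rw [Set.singleton_subset_iff]
    have := smul_mem_cone (PointedCone.hull ℝ {g • v}) (inv_nonneg.2 hg.le)
      (PointedCone.subset_hull (Set.mem_singleton _))
    rwa [smul_smul, inv_mul_cancel₀ hg.ne', one_smul] at this

/-- Every cone of a fan is generated by its rays. -/
theorem Fan.le_hull_rays {n : ℕ} (Δ : Fan n) {σ : PointedCone ℝ (Fin n → ℝ)} (hσ : σ ∈ Δ.cones) :
    σ ≤ PointedCone.hull ℝ (toReal '' {v | v ∈ Δ.rays ∧ toReal v ∈ σ}) := by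
  classical
  -- a generating set with the least number of elements
  have hex : ∃ k : ℕ, ∃ s : Finset (Fin n → ℤ), s.card = k ∧
      σ = PointedCone.hull ℝ (toReal '' (s : Set (Fin n → ℤ))) := by
    obtain ⟨s, hs⟩ := Δ.rational σ hσ
    exact ⟨_, s, rfl, hs⟩
  obtain ⟨s, hcard, hs⟩ := Nat.find_spec hex
  have hmin : ∀ a ∈ s, toReal a ∉ PointedCone.hull ℝ (toReal '' (s.erase a : Set (Fin n → ℤ))) := by
    intro a ha hmem
    refine Nat.find_min hex (m := (s.erase a).card) ?_ ⟨s.erase a, rfl, ?_⟩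
    · rw [← hcard]; exact Finset.card_erase_lt_of_mem ha
    · refine le_antisymm ?_ ?_
      · rw [hs]
        refine Submodule.span_le.2 ?_
        rintro _ ⟨b, hb, rfl⟩
        by_cases hba : b = a
        · rw [hba]; exact hmem
        · exact PointedCone.subset_hull ⟨b, by simpa [hba] using hb, rfl⟩
      · rw [hs]
        exact Submodule.span_mono (Set.image_mono (by simp))
  have h0 : (0 : Fin n → ℤ) ∉ s := fun h => hmin 0 h (by rw [toReal_zero]; exact zero_mem _)
  conv_lhs => rw [hs]
  refine Submodule.span_le.2 ?_
  rintro _ ⟨a, ha, rfl⟩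
  have ha : a ∈ s := ha
  have ha0 : a ≠ 0 := fun h => h0 (h ▸ ha)
  have hface : IsFace (PointedCone.hull ℝ {toReal a}) σ := by
    refine isFace_hull_singleton (Δ.stronglyConvex σ hσ) (t := s.erase a) ?_ ha0 ?_ (hmin a ha)
    · rw [← Set.image_insert_eq, ← Finset.coe_insert, Finset.insert_erase ha, hs]
    · simp [h0]
  obtain ⟨g, b, hg, hab, hb⟩ := exists_primitive a ha0
  have hg' : (0 : ℝ) < g := by exact_mod_cast hg
  have hcone : PointedCone.hull ℝ {toReal a} = PointedCone.hull ℝ {toReal b} := by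
    rw [hab, toReal_zsmul, hull_singleton_smul _ hg']
  have hbσ : toReal b ∈ σ := by
    have h1 : toReal b ∈ PointedCone.hull ℝ {toReal a} := by
      rw [hcone]; exact PointedCone.subset_hull rfl
    obtain ⟨m, -, hm⟩ := hface
    exact ((hm _).1 h1).1
  rw [hab, toReal_zsmul]
  refine smul_mem_cone _ hg'.le (PointedCone.subset_hull ⟨b, ⟨⟨hb, ?_⟩, hbσ⟩, rfl⟩)
  rw [← hcone]
  exact Δ.face_mem σ hσ _ hface

/-! ### The polytope of a globally generated divisor -/

lemma convex_polytope {n : ℕ} {Δ : Fan n} (D : Δ.TDivisor) : Convex ℝ (polytope D) := by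
  intro x hx y hy a b ha hb hab i
  rw [add_dotProduct, smul_dotProduct, smul_dotProduct, smul_eq_mul, smul_eq_mul]
  have h1 := mul_le_mul_of_nonneg_left (hx i) ha
  have h2 := mul_le_mul_of_nonneg_left (hy i) hb
  have h3 : a * -(D i : ℝ) + b * -(D i : ℝ) = -(D i : ℝ) := by rw [← add_mul, hab, one_mul]
  linarith

/-- A section generating `O(D)` on the chart of `σ` minimizes every functional in `σ` on `P_D`. -/
lemma GeneratesOn.dotProduct_le {n : ℕ} {Δ : Fan n} {D : Δ.TDivisor}
    {σ : PointedCone ℝ (Fin n → ℝ)} (hσ : σ ∈ Δ.cones) {u : Fin n → ℤ} (hu : GeneratesOn D u σ)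
    {x : Fin n → ℝ} (hx : x ∈ polytope D) {v : Fin n → ℝ} (hv : v ∈ σ) :
    toReal u ⬝ᵥ v ≤ x ⬝ᵥ v := by
  have hv' := Δ.le_hull_rays hσ hv
  clear hv
  induction hv' using Submodule.span_induction with
  | mem y hy =>
    obtain ⟨r, ⟨hr, hrσ⟩, rfl⟩ := hy
    have h1 := hu ⟨r, hr⟩ hrσ
    have h2 := hx ⟨r, hr⟩
    rw [toReal_dotProduct]
    have h3 : ((u ⬝ᵥ r : ℤ) : ℝ) + (D ⟨r, hr⟩ : ℝ) = 0 := by exact_mod_cast h1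
    linarith
  | zero => simp
  | add y z _ _ hy hz => rw [dotProduct_add, dotProduct_add]; exact add_le_add hy hz
  | smul c y _ hy =>
    have hcx : c • y = (c : ℝ) • y := rfl
    rw [hcx, dotProduct_smul, dotProduct_smul]
    exact mul_le_mul_of_nonneg_left hy c.2

lemma IsGloballyGenerated.exists_finite {n : ℕ} {Δ : Fan n} (hΔ : Δ.IsComplete)
    {D : Δ.TDivisor} (hD : IsGloballyGenerated D) :
    ∃ U : Set (Fin n → ℤ), U.Finite ∧ U ⊆ latticePoints (polytope D) ∧
      polytope D ⊆ convexHull ℝ (toReal '' U) := by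
  choose! u hu hgen using hD
  refine ⟨u '' Δ.cones, Δ.finite.image u, ?_, fun x hx => ?_⟩
  · rintro _ ⟨σ, hσ, rfl⟩
    exact hu σ hσ
  · by_contra hxU
    have hfin : (toReal '' (u '' Δ.cones)).Finite := (Δ.finite.image u).image _
    obtain ⟨f, c, hf, hc⟩ := geometric_hahn_banach_closed_point (convex_convexHull ℝ _)
      (hfin.isCompact_convexHull ℝ).isClosed hxU
    obtain ⟨y, hy⟩ := exists_dotProduct_eq (-f)
    obtain ⟨σ, hσ, hyσ⟩ := hΔ y
    have h1 := (hgen σ hσ).dotProduct_le hσ hx hyσ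
    rw [dotProduct_comm, ← hy, dotProduct_comm, ← hy] at h1
    have h2 := hf _ (subset_convexHull ℝ _ ⟨_, ⟨σ, hσ, rfl⟩, rfl⟩)
    simp only [_root_.neg_apply] at h1
    linarith

lemma IsGloballyGenerated.isBounded_polytope {n : ℕ} {Δ : Fan n} (hΔ : Δ.IsComplete)
    {D : Δ.TDivisor} (hD : IsGloballyGenerated D) : Bornology.IsBounded (polytope D) := by
  obtain ⟨U, hU, -, hPU⟩ := hD.exists_finite hΔ
  exact ((hU.image toReal).isCompact_convexHull ℝ).isBounded.subset hPU

theorem IsGloballyGenerated.polytope_eq {n : ℕ} {Δ : Fan n} (hΔ : Δ.IsComplete)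
    {D : Δ.TDivisor} (hD : IsGloballyGenerated D) :
    polytope D = convexHull ℝ (toReal '' latticePoints (polytope D)) := by
  refine subset_antisymm ?_ (convexHull_min ?_ (convex_polytope D))
  · obtain ⟨U, -, hUA, hPU⟩ := hD.exists_finite hΔ
    exact hPU.trans (convexHull_mono (Set.image_mono hUA))
  · rintro _ ⟨a, ha, rfl⟩
    exact ha

/-! ### Lengths of quotients by monomial ideals -/

/-- Modulo a monomial ideal with set of exponents `J`, the monomials with exponents in `L` span a
space with basis the monomials with exponents in `L \ J`. -/
lemma finrank_map_mk_span_single (K : Type u) [Field K] {G : Type*} [AddCommMonoid G]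
    (I : Ideal (AddMonoidAlgebra K G)) (J L : Set G)
    (hI : ∀ x, x ∈ I ↔ ∀ m ∈ x.coeff.support, m ∈ J) :
    Module.finrank K ((Submodule.span K
      {x : AddMonoidAlgebra K G | ∃ s ∈ L, x = AddMonoidAlgebra.single s 1}).map
        (Ideal.Quotient.mkₐ K I).toLinearMap) = (L \ J).ncard := by
  let v : ↥(L \ J) → AddMonoidAlgebra K G ⧸ I := fun s =>
    Ideal.Quotient.mkₐ K I (AddMonoidAlgebra.single s.1 1)
  have hv : LinearIndependent K v := by
    rw [linearIndependent_iff']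
    intro t g hg i hi
    have h1 : (∑ i ∈ t, g i • v i) =
        Ideal.Quotient.mkₐ K I (∑ i ∈ t, AddMonoidAlgebra.single i.1 (g i)) := by
      rw [map_sum]
      refine Finset.sum_congr rfl fun i _ => ?_
      rw [← map_smul, AddMonoidAlgebra.smul_single, smul_eq_mul, mul_one]
    rw [h1] at hg
    have hmem := (hI _).1 (Ideal.Quotient.eq_zero_iff_mem.1 hg)
    by_contra hne
    refine i.2.2 (hmem i.1 ?_)
    rw [Finsupp.mem_support_iff, AddMonoidAlgebra.coeff_sum, Finsupp.finsetSum_apply]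
    rw [Finset.sum_eq_single_of_mem i hi]
    · simpa using hne
    · intro b _ hb
      have : b.1 ≠ i.1 := fun h => hb (Subtype.ext h)
      simp [this]
  have hspan : (Submodule.span K
      {x : AddMonoidAlgebra K G | ∃ s ∈ L, x = AddMonoidAlgebra.single s 1}).map
        (Ideal.Quotient.mkₐ K I).toLinearMap = Submodule.span K (Set.range v) := by
    rw [Submodule.map_span]
    refine le_antisymm (Submodule.span_le.2 ?_) (Submodule.span_mono ?_)
    · rintro _ ⟨_, ⟨s, hs, rfl⟩, rfl⟩
      by_cases hsJ : s ∈ J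
      · have h0 : Ideal.Quotient.mkₐ K I (AddMonoidAlgebra.single s (1 : K)) = 0 := by
          refine Ideal.Quotient.eq_zero_iff_mem.2 ((hI _).2 fun m hm => ?_)
          have := Finsupp.support_single_subset hm
          rw [Finset.mem_singleton] at this
          rwa [this]
        change Ideal.Quotient.mkₐ K I (AddMonoidAlgebra.single s (1 : K)) ∈ Submodule.span K _
        rw [h0]
        exact zero_mem _
      · exact Submodule.subset_span ⟨⟨s, hs, hsJ⟩, rfl⟩
    · rintro _ ⟨s, rfl⟩
      exact ⟨_, ⟨s.1, s.2.1, rfl⟩, rfl⟩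
  rw [hspan, Module.finrank_eq_nat_card_basis (Module.Basis.span hv), Nat.card_coe_set_eq]

/-! ### The coordinate semigroup and its ideals -/

/-- The generators `(u, 1)`, `u ∈ P_D ∩ M`, as elements of the coordinate semigroup. -/
def sectionGens {n : ℕ} {Δ : Fan n} (D : Δ.TDivisor) : Set (coordSemigroup D) :=
  {s | ∃ u ∈ latticePoints (polytope D), s.1 = (u, 1)}

lemma exists_sectionGens_add {n : ℕ} {Δ : Fan n} {D : Δ.TDivisor} (s : coordSemigroup D)
    (hs : 0 < s.1.2) : ∃ g ∈ sectionGens D, ∃ s' : coordSemigroup D, s = s' + g := by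
  obtain ⟨s, hsS⟩ := s
  induction hsS using AddSubmonoid.closure_induction_left with
  | zero => simp at hs
  | add_left x hx y hy ih =>
    obtain ⟨u, hu, rfl⟩ := hx
    exact ⟨⟨(u, 1), AddSubmonoid.subset_closure ⟨u, hu, rfl⟩⟩, ⟨u, hu, rfl⟩, ⟨y, hy⟩,
      Subtype.ext (add_comm _ _)⟩

lemma sectionGens_degree {n : ℕ} {Δ : Fan n} {D : Δ.TDivisor} {g : coordSemigroup D}
    (hg : g ∈ sectionGens D) : g.1.2 = 1 := by
  obtain ⟨u, -, h⟩ := hg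
  rw [h]

lemma gradedMaxIdeal_eq (K : Type u) [Field K] {n : ℕ} {Δ : Fan n} (D : Δ.TDivisor) :
    gradedMaxIdeal K D = Ideal.span (AddMonoidAlgebra.of' K (coordSemigroup D) '' sectionGens D) := by
  refine le_antisymm (Ideal.span_le.2 ?_) (Ideal.span_mono ?_)
  · rintro x ⟨j, hj, hx⟩
    have hle : gradedPiece K D j ≤ (Ideal.span (AddMonoidAlgebra.of' K (coordSemigroup D) ''
        sectionGens D)).restrictScalars K := by
      refine Submodule.span_le.2 ?_
      rintro _ ⟨s, hs, rfl⟩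
      obtain ⟨g, hg, s', rfl⟩ := exists_sectionGens_add s (hs ▸ hj)
      have : (AddMonoidAlgebra.single (s' + g) (1 : K)) =
          AddMonoidAlgebra.single s' 1 * AddMonoidAlgebra.single g 1 := by
        rw [AddMonoidAlgebra.single_mul_single, mul_one]
      rw [this]
      exact Ideal.mul_mem_left _ _ (Ideal.subset_span ⟨g, hg, rfl⟩)
    exact hle hx
  · rintro _ ⟨g, hg, rfl⟩
    exact ⟨1, one_pos, Submodule.subset_span ⟨g, sectionGens_degree hg, rfl⟩⟩

/-- In characteristic `p` the Frobenius is additive, so `m^{[q]}` is generated by the `q`-th powers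
of the monomial generators of `m`. -/
lemma bracketPower_gradedMaxIdeal (p : ℕ) [Fact p.Prime] (K : Type u) [Field K] [CharP K p] {n : ℕ}
    {Δ : Fan n} (D : Δ.TDivisor) (N : ℕ) :
    bracketPower (gradedMaxIdeal K D) (p ^ N) = Ideal.span
      (AddMonoidAlgebra.of' K (coordSemigroup D) '' ((fun g => p ^ N • g) '' sectionGens D)) := by
  have : CharP (CoordRing K D) p :=
    charP_of_injective_algebraMap (algebraMap K (CoordRing K D)).injective p
  refine le_antisymm (Ideal.span_le.2 ?_) (Ideal.span_le.2 ?_)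
  · rintro _ ⟨x, hx, rfl⟩
    have hle : gradedMaxIdeal K D ≤ (Ideal.span (AddMonoidAlgebra.of' K (coordSemigroup D) ''
        ((fun g => p ^ N • g) '' sectionGens D))).comap (iterateFrobenius (CoordRing K D) p N) := by
      rw [gradedMaxIdeal_eq, Ideal.span_le]
      rintro _ ⟨g, hg, rfl⟩
      rw [SetLike.mem_coe, Ideal.mem_comap, iterateFrobenius_def, AddMonoidAlgebra.of'_apply, AddMonoidAlgebra.single_pow, one_pow]
      exact Ideal.subset_span ⟨_, ⟨g, hg, rfl⟩, rfl⟩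
    have := hle hx
    rw [Ideal.mem_comap, iterateFrobenius_def] at this
    exact this
  · rintro _ ⟨_, ⟨g, hg, rfl⟩, rfl⟩
    refine Ideal.subset_span ⟨AddMonoidAlgebra.single g 1, ?_, ?_⟩
    · rw [gradedMaxIdeal_eq]
      exact Ideal.subset_span ⟨g, hg, rfl⟩
    · change (AddMonoidAlgebra.single g (1 : K)) ^ p ^ N = AddMonoidAlgebra.single (p ^ N • g) 1
      rw [AddMonoidAlgebra.single_pow, one_pow]

lemma gradedMaxIdeal_pow (K : Type u) [Field K] {n : ℕ} {Δ : Fan n} (D : Δ.TDivisor) (N : ℕ) :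
    gradedMaxIdeal K D ^ N =
      Ideal.span (AddMonoidAlgebra.of' K (coordSemigroup D) '' {s | N ≤ s.1.2}) := by
  refine le_antisymm ?_ (Ideal.span_le.2 ?_)
  · induction N with
    | zero =>
      rw [pow_zero, Ideal.one_eq_top, top_le_iff, Ideal.eq_top_iff_one]
      exact Ideal.subset_span ⟨0, Nat.zero_le _, rfl⟩
    | succ N ih =>
      rw [pow_succ]
      refine (Ideal.mul_mono ih (gradedMaxIdeal_eq K D).le).trans ?_
      rw [Ideal.span_mul_span', Ideal.span_le]
      rintro _ ⟨_, ⟨s, hs, rfl⟩, _, ⟨g, hg, rfl⟩, rfl⟩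
      refine Ideal.subset_span ⟨s + g, ?_, ?_⟩
      · have h1 := sectionGens_degree hg
        have h2 : N ≤ s.1.2 := hs
        have h3 : (s + g).1.2 = s.1.2 + g.1.2 := rfl
        change N + 1 ≤ (s + g).1.2
        omega
      · change AddMonoidAlgebra.single (s + g) (1 : K) =
          AddMonoidAlgebra.single s 1 * AddMonoidAlgebra.single g 1
        rw [AddMonoidAlgebra.single_mul_single, mul_one]
  · rintro _ ⟨s, hs, rfl⟩
    change AddMonoidAlgebra.single s (1 : K) ∈ _
    induction N generalizing s with
    | zero => simp
    | succ N ih =>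
      have hs' : N + 1 ≤ s.1.2 := hs
      obtain ⟨g, hg, s', rfl⟩ := exists_sectionGens_add s (by omega)
      have h1 := sectionGens_degree hg
      have h3 : (s' + g).1.2 = s'.1.2 + g.1.2 := rfl
      have hmul : (AddMonoidAlgebra.single (s' + g) (1 : K)) =
          AddMonoidAlgebra.single s' 1 * AddMonoidAlgebra.single g 1 := by
        rw [AddMonoidAlgebra.single_mul_single, mul_one]
      rw [hmul, pow_succ]
      refine Ideal.mul_mem_mul (ih s' (by change N ≤ s'.1.2; omega)) ?_
      rw [gradedMaxIdeal_eq]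
      exact Ideal.subset_span ⟨g, hg, rfl⟩

/-- The exponents `x` of the monomials `χ^{(x, j)}` of degree `j`. -/
def degreeSet {n : ℕ} {Δ : Fan n} (D : Δ.TDivisor) (j : ℕ) : Set (Fin n → ℤ) :=
  {x | (x, j) ∈ coordSemigroup D}

/-- `ℓ((R / m^{[q]})_j)` counts the monomials of degree `j` which are not divisible by any
`χ^{q(u, 1)}`. -/
theorem quotientLength_bracketPower (p : ℕ) [Fact p.Prime] (K : Type u) [Field K] [CharP K p]
    {n : ℕ} {Δ : Fan n} (D : Δ.TDivisor) (N j : ℕ) :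
    quotientLength K D (bracketPower (gradedMaxIdeal K D) (p ^ N)) j =
      {x ∈ degreeSet D j | p ^ N ≤ j → ∀ u ∈ latticePoints (polytope D),
        x - p ^ N • u ∉ degreeSet D (j - p ^ N)}.ncard := by
  have hpiece : gradedPiece K D j = Submodule.span K {x : CoordRing K D |
      ∃ s ∈ {s : coordSemigroup D | s.1.2 = j}, x = AddMonoidAlgebra.single s 1} := rfl
  rw [quotientLength, hpiece, finrank_map_mk_span_single K _
    {s | ∃ m' ∈ (fun g => p ^ N • g) '' sectionGens D, ∃ d, s = d + m'}]
  · rw [← Set.ncard_image_of_injective {x ∈ degreeSet D j | p ^ N ≤ j →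
      ∀ u ∈ latticePoints (polytope D), x - p ^ N • u ∉ degreeSet D (j - p ^ N)}
        (f := fun x => (x, j)) (fun x y h => (Prod.ext_iff.1 h).1),
      ← Set.ncard_image_of_injective _ (Subtype.val_injective (p := (· ∈ coordSemigroup D)))]
    congr 1
    ext ⟨x, i⟩
    constructor
    · rintro ⟨⟨⟨x', i'⟩, hs⟩, ⟨hsj, hsJ⟩, h⟩
      have h : (x', i') = (x, i) := h
      obtain ⟨rfl, rfl⟩ := Prod.ext_iff.1 h
      have hsj : i' = j := hsj
      subst hsj
      refine ⟨x', ⟨hs, fun hij u hu hmem => hsJ ?_⟩, rfl⟩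
      refine ⟨_, ⟨⟨(u, 1), AddSubmonoid.subset_closure ⟨u, hu, rfl⟩⟩, ⟨u, hu, rfl⟩, rfl⟩,
        ⟨_, hmem⟩, Subtype.ext ?_⟩
      simp [hij]
    · rintro ⟨x', ⟨hx, h⟩, hxi⟩
      have hxi : (x', j) = (x, i) := hxi
      obtain ⟨rfl, rfl⟩ := Prod.ext_iff.1 hxi
      refine ⟨⟨(x', j), hx⟩, ⟨rfl, ?_⟩, rfl⟩
      rintro ⟨_, ⟨g, ⟨u, hu, hg⟩, rfl⟩, ⟨⟨y, i⟩, hd⟩, hs⟩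
      have hs' : (x', j) = (y, i) + p ^ N • g.1 := congrArg Subtype.val hs
      rw [hg] at hs'
      simp only [Prod.smul_mk, Prod.mk_add_mk, Prod.mk.injEq, smul_eq_mul, mul_one] at hs'
      refine h (by omega) u hu ?_
      have h1 : x' - p ^ N • u = y := by rw [hs'.1]; abel
      have h2 : j - p ^ N = i := by omega
      rw [h1, h2]
      exact hd
  · intro x
    rw [bracketPower_gradedMaxIdeal, AddMonoidAlgebra.mem_ideal_span_of'_image]
    rfl

/-- `ℓ(R / m^N)` counts the monomials of degree less than `N`. -/
theorem finrank_quotient_gradedMaxIdeal_pow (K : Type u) [Field K] {n : ℕ} {Δ : Fan n}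
    (D : Δ.TDivisor) (hfin : ∀ j, (degreeSet D j).Finite) (N : ℕ) :
    Module.finrank K (CoordRing K D ⧸ gradedMaxIdeal K D ^ N) =
      ∑ j ∈ Finset.range N, (degreeSet D j).ncard := by
  have htop : Submodule.span K {x : CoordRing K D |
      ∃ s ∈ (Set.univ : Set (coordSemigroup D)), x = AddMonoidAlgebra.single s 1} = ⊤ := by
    rw [eq_top_iff]
    intro x _
    induction x using AddMonoidAlgebra.induction_linear with
    | zero => exact zero_mem _
    | add f g hf hg => exact add_mem (hf trivial) (hg trivial)
    | single s c =>
      have : AddMonoidAlgebra.single s c = c • AddMonoidAlgebra.single s (1 : K) := by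
        rw [AddMonoidAlgebra.smul_single, smul_eq_mul, mul_one]
      rw [this]
      exact Submodule.smul_mem _ _ (Submodule.subset_span ⟨s, trivial, rfl⟩)
  have hrank := finrank_map_mk_span_single K (gradedMaxIdeal K D ^ N)
    {s : coordSemigroup D | N ≤ s.1.2} Set.univ (fun x => by
      rw [gradedMaxIdeal_pow, AddMonoidAlgebra.mem_ideal_span_of'_image]
      refine forall₂_congr fun m _ => ⟨?_, fun hm => ⟨m, hm, 0, (zero_add m).symm⟩⟩
      rintro ⟨m', hm', d, rfl⟩
      have h1 : N ≤ m'.1.2 := hm'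
      have h2 : (d + m').1.2 = d.1.2 + m'.1.2 := rfl
      change N ≤ (d + m').1.2
      omega)
  rw [htop, Submodule.map_top, LinearMap.range_eq_top.2 (by
    exact Ideal.Quotient.mk_surjective), finrank_top] at hrank
  rw [hrank]
  clear hrank htop
  rw [← Set.ncard_image_of_injective _ (Subtype.val_injective (p := (· ∈ coordSemigroup D)))]
  have hU : (Subtype.val '' (Set.univ \ {s : coordSemigroup D | N ≤ s.1.2})) =
      ⋃ j ∈ Finset.range N, (fun x => (x, j)) '' degreeSet D j := by
    ext ⟨x, i⟩
    simp only [Set.mem_iUnion, Finset.mem_range, Set.mem_image, Prod.mk.injEq]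
    constructor
    · rintro ⟨⟨s, hs⟩, hsN, rfl⟩
      exact ⟨i, by simpa using hsN, x, hs, rfl, rfl⟩
    · rintro ⟨j, hj, y, hy, rfl, rfl⟩
      exact ⟨⟨(y, j), hy⟩, by simpa using hj, rfl⟩
  rw [hU]
  have hinj : ∀ j : ℕ, Function.Injective (fun x : Fin n → ℤ => (x, j)) :=
    fun j x y h => (Prod.ext_iff.1 h).1
  induction N with
  | zero => simp
  | succ N ih =>
    rw [Finset.sum_range_succ, Finset.range_add_one, Finset.set_biUnion_insert, Set.union_comm,
      Set.ncard_union_eq ?_ ?_ ((hfin N).image _), Set.ncard_image_of_injective _ (hinj N)]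
    · congr 1
      refine ih ?_
      ext ⟨x, i⟩
      simp only [Set.mem_iUnion, Finset.mem_range, Set.mem_image, Prod.mk.injEq]
      constructor
      · rintro ⟨⟨s, hs⟩, hsN, rfl⟩
        exact ⟨i, by simpa using hsN, x, hs, rfl, rfl⟩
      · rintro ⟨j, hj, y, hy, rfl, rfl⟩
        exact ⟨⟨(y, j), hy⟩, by simpa using hj, rfl⟩
    · rw [Set.disjoint_left]
      rintro ⟨x, i⟩ h1 ⟨y, _, h2⟩
      simp only [Set.mem_iUnion, Finset.mem_range, Set.mem_image, Prod.mk.injEq] at h1 h2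
      obtain ⟨j, hj, z, -, -, h3⟩ := h1
      omega
    · exact (Finset.finite_toSet _).biUnion fun j _ => (hfin j).image _

open scoped Pointwise

/-! ### Volumes of periodic sets -/

lemma volume_setOf_add_mem {n : ℕ} (c : Fin n → ℝ) (S : Set (Fin n → ℝ)) :
    volume {x | x + c ∈ S} = volume S := measure_preimage_add_right volume c S

lemma volume_setOf_sub_mem {n : ℕ} (c : Fin n → ℝ) (S : Set (Fin n → ℝ)) :
    volume {x | x - c ∈ S} = volume S := by
  simpa only [sub_eq_add_neg] using volume_setOf_add_mem (-c) S

lemma volume_unitCube {n : ℕ} : volume (Set.Icc (0 : Fin n → ℝ) 1) = 1 := by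
  simp [Real.volume_Icc_pi]

/-- A set is periodic if it is stable under the translations by `ℤⁿ`. -/
def IsPeriodic {n : ℕ} (F : Set (Fin n → ℝ)) : Prop :=
  ∀ (u : Fin n → ℤ) (x : Fin n → ℝ), x + toReal u ∈ F ↔ x ∈ F

/-- The measure of a periodic set in a unit cell does not depend on the (real) position of the
cell. -/
lemma IsPeriodic.volume_cell {n : ℕ} {F : Set (Fin n → ℝ)} (hF : IsPeriodic F)
    (hm : MeasurableSet F) (a : Fin n → ℝ) :
    volume {t | t ∈ Set.Icc (0 : Fin n → ℝ) 1 ∧ a + t ∈ F} = volume (Set.Icc 0 1 ∩ F) := by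
  have hfd := ZSpan.isAddFundamentalDomain (Pi.basisFun ℝ (Fin n)) volume
  have hfd' := hfd.vadd_of_comm a
  have hmeas : VAddInvariantMeasure (Submodule.span ℤ (Set.range (Pi.basisFun ℝ (Fin n))))
      (Fin n → ℝ) volume := ⟨fun g s _ => measure_preimage_add volume g.1 s⟩
  have hinv : ∀ g : Submodule.span ℤ (Set.range (Pi.basisFun ℝ (Fin n))),
      (fun x => g +ᵥ x) ⁻¹' F = F := by
    rintro ⟨g, hg⟩
    obtain ⟨u, rfl⟩ : ∃ u, toReal u = g := by
      rw [Module.Basis.mem_span_iff_repr_mem] at hg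
      choose u hu using hg
      exact ⟨u, by ext i; simpa [toReal] using hu i⟩
    ext x
    have h1 : (⟨toReal u, hg⟩ : Submodule.span ℤ (Set.range (Pi.basisFun ℝ (Fin n)))) +ᵥ x =
        x + toReal u := add_comm _ _
    rw [Set.mem_preimage, h1, hF u x]
  have key := hfd'.measure_set_eq hfd hm hinv
  rw [ZSpan.fundamentalDomain_pi_basisFun] at key
  have hae : (Set.univ.pi fun _ : Fin n => Set.Ico (0 : ℝ) 1) =ᵐ[volume]
      Set.Icc (0 : Fin n → ℝ) 1 := Measure.univ_pi_Ico_ae_eq_Icc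
  have h2 : volume (F ∩ Set.univ.pi fun _ : Fin n => Set.Ico (0 : ℝ) 1) =
      volume (Set.Icc 0 1 ∩ F) := by
    rw [Set.inter_comm]
    exact measure_congr (hae.inter (ae_eq_refl _))
  rw [← h2, ← key, ← volume_setOf_add_mem a (F ∩ _)]
  have hS : {x | x + a ∈ F ∩ (a +ᵥ Set.univ.pi fun _ : Fin n => Set.Ico (0 : ℝ) 1)} =
      (Set.univ.pi fun _ : Fin n => Set.Ico (0 : ℝ) 1) ∩ {t | a + t ∈ F} := by
    ext t
    have : t + a ∈ (a +ᵥ Set.univ.pi fun _ : Fin n => Set.Ico (0 : ℝ) 1) ↔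
        t ∈ Set.univ.pi fun _ : Fin n => Set.Ico (0 : ℝ) 1 := by
      rw [add_comm, ← vadd_eq_add, Set.vadd_mem_vadd_set_iff]
    simp only [Set.mem_ofPred_eq, Set.mem_inter_iff, this, add_comm a t, and_comm]
  rw [hS]
  exact measure_congr (hae.symm.inter (ae_eq_refl _))

/-- Averaging over the translates by the unit cube: `∫_{t ∈ W} vol {a ∈ A | a + t ∈ F}` is
`vol A · vol (W ∩ F)`. -/
lemma IsPeriodic.lintegral_translates {n : ℕ} {F : Set (Fin n → ℝ)} (hF : IsPeriodic F)
    (hm : MeasurableSet F) {A : Set (Fin n → ℝ)} (hA : MeasurableSet A) :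
    ∫⁻ t in Set.Icc (0 : Fin n → ℝ) 1, volume {a | a ∈ A ∧ a + t ∈ F} =
      volume A * volume (Set.Icc 0 1 ∩ F) := by
  have hmF : MeasurableSet {z : (Fin n → ℝ) × (Fin n → ℝ) | z.1 + z.2 ∈ F} :=
    (measurable_fst.add measurable_snd) hm
  have h1 := Measure.prod_apply (μ := volume.restrict A)
    (ν := volume.restrict (Set.Icc (0 : Fin n → ℝ) 1)) hmF
  rw [Measure.prod_apply_symm hmF] at h1
  have h2 : ∀ t, (volume.restrict A) ((fun x => (x, t)) ⁻¹' {z | z.1 + z.2 ∈ F}) =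
      volume {a | a ∈ A ∧ a + t ∈ F} := fun t => by
    rw [Measure.restrict_apply' hA, Set.inter_comm]
    rfl
  have h3 : ∀ a, (volume.restrict (Set.Icc (0 : Fin n → ℝ) 1))
      (Prod.mk a ⁻¹' {z | z.1 + z.2 ∈ F}) = volume (Set.Icc 0 1 ∩ F) := fun a => by
    rw [Measure.restrict_apply' measurableSet_Icc, Set.inter_comm]
    exact hF.volume_cell hm a
  simp only [h2, h3] at h1
  rw [h1, lintegral_const, Measure.restrict_apply_univ, mul_comm]

lemma IsPeriodic.mul_le_volume {n : ℕ} {F : Set (Fin n → ℝ)} (hF : IsPeriodic F)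
    (hm : MeasurableSet F) {A B : Set (Fin n → ℝ)} (hA : MeasurableSet A)
    (hAB : ∀ t ∈ Set.Icc (0 : Fin n → ℝ) 1, ∀ a ∈ A, a + t ∈ B) :
    volume A * volume (Set.Icc 0 1 ∩ F) ≤ volume (B ∩ F) := by
  rw [← hF.lintegral_translates hm hA]
  calc ∫⁻ t in Set.Icc (0 : Fin n → ℝ) 1, volume {a | a ∈ A ∧ a + t ∈ F}
      ≤ ∫⁻ t in Set.Icc (0 : Fin n → ℝ) 1, volume (B ∩ F) := by
        refine setLIntegral_mono measurable_const fun t ht => ?_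
        rw [← volume_setOf_add_mem t (B ∩ F)]
        exact measure_mono fun a ha => ⟨hAB t ht a ha.1, ha.2⟩
    _ = volume (B ∩ F) := by rw [setLIntegral_const, volume_unitCube, mul_one]

lemma IsPeriodic.volume_le_mul {n : ℕ} {F : Set (Fin n → ℝ)} (hF : IsPeriodic F)
    (hm : MeasurableSet F) {A B : Set (Fin n → ℝ)} (hA : MeasurableSet A)
    (hAB : ∀ t ∈ Set.Icc (0 : Fin n → ℝ) 1, ∀ a, a + t ∈ B → a ∈ A) :
    volume (B ∩ F) ≤ volume A * volume (Set.Icc 0 1 ∩ F) := by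
  rw [← hF.lintegral_translates hm hA]
  calc volume (B ∩ F)
      = ∫⁻ t in Set.Icc (0 : Fin n → ℝ) 1, volume (B ∩ F) := by
        rw [setLIntegral_const, volume_unitCube, mul_one]
    _ ≤ ∫⁻ t in Set.Icc (0 : Fin n → ℝ) 1, volume {a | a ∈ A ∧ a + t ∈ F} := by
        refine setLIntegral_mono' measurableSet_Icc fun t ht => ?_
        rw [← volume_setOf_add_mem t (B ∩ F)]
        exact measure_mono fun a ha => ⟨hAB t ht a ha.1, ha.2⟩

/-! ### The part of space not covered by the lattice translates of a convex body -/

/-- The points outside of all the translates `u + μQ`, `u ∈ ℤⁿ`. -/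
def uncovered {n : ℕ} (Q : Set (Fin n → ℝ)) (μ : ℝ) : Set (Fin n → ℝ) :=
  {x | ∀ u : Fin n → ℤ, x - toReal u ∉ μ • Q}

/-- The volume of the uncovered part of a unit cell. -/
def uncoveredDensity {n : ℕ} (Q : Set (Fin n → ℝ)) (μ : ℝ) : ℝ :=
  volume.real (Set.Icc (0 : Fin n → ℝ) 1 ∩ uncovered Q μ)

lemma isPeriodic_uncovered {n : ℕ} (Q : Set (Fin n → ℝ)) (μ : ℝ) :
    IsPeriodic (uncovered Q μ) := by
  intro u x
  refine ⟨fun h v => ?_, fun h v => ?_⟩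
  · have := h (v + u)
    rwa [toReal_add, add_sub_add_right_eq_sub] at this
  · have := h (v - u)
    rwa [toReal_sub, sub_sub_eq_add_sub] at this

lemma measurableSet_uncovered {n : ℕ} {Q : Set (Fin n → ℝ)} (hk : IsCompact Q) (μ : ℝ) :
    MeasurableSet (uncovered Q μ) := by
  have : uncovered Q μ = ⋂ u : Fin n → ℤ, (fun x => x - toReal u) ⁻¹' (μ • Q)ᶜ := by
    ext x; simp [uncovered]
  rw [this]
  exact MeasurableSet.iInter fun u =>
    (measurable_id.sub_const _) (hk.smul μ).measurableSet.compl

lemma uncoveredDensity_mem_Icc {n : ℕ} (Q : Set (Fin n → ℝ)) (μ : ℝ) :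
    uncoveredDensity Q μ ∈ Set.Icc (0 : ℝ) 1 := by
  refine ⟨measureReal_nonneg, ?_⟩
  have h : volume.real (Set.Icc (0 : Fin n → ℝ) 1) = 1 := by
    rw [measureReal_def, volume_unitCube, ENNReal.toReal_one]
  rw [← h]
  exact measureReal_mono Set.inter_subset_left (by rw [volume_unitCube]; exact ENNReal.one_ne_top)

lemma smul_mono_of_zero_mem {n : ℕ} {Q : Set (Fin n → ℝ)} (hc : Convex ℝ Q) (h0 : 0 ∈ Q)
    {a b : ℝ} (ha : 0 ≤ a) (hab : a ≤ b) : a • Q ⊆ b • Q := by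
  intro x hx
  have : b = a + (b - a) := by ring
  rw [this, hc.add_smul ha (sub_nonneg.2 hab)]
  have h := Set.add_mem_add hx (Set.smul_mem_smul_set (a := b - a) h0)
  rwa [smul_zero, add_zero] at h

lemma volume_real_smul {n : ℕ} (Q : Set (Fin n → ℝ)) {a : ℝ} (ha : 0 ≤ a) :
    volume.real (a • Q) = a ^ n * volume.real Q := by
  rw [measureReal_def, Measure.addHaar_smul_of_nonneg _ ha, ENNReal.toReal_mul,
    ENNReal.toReal_ofReal (by positivity), Module.finrank_fin_fun, measureReal_def]

/-- Replacing `Q` by a translate only translates the uncovered set. -/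
lemma uncoveredDensity_translate {n : ℕ} {Q : Set (Fin n → ℝ)} (hk : IsCompact Q)
    (c : Fin n → ℝ) (μ : ℝ) :
    uncoveredDensity {x | x + c ∈ Q} μ = uncoveredDensity Q μ := by
  have hset : ∀ x, x ∈ μ • {x | x + c ∈ Q} ↔ μ • c + x ∈ μ • Q := by
    intro x
    constructor
    · rintro ⟨y, hy, rfl⟩
      exact ⟨y + c, hy, by simp [smul_add, add_comm]⟩
    · rintro ⟨y, hy, hyx⟩
      refine ⟨y - c, by simpa using hy, ?_⟩
      have hyx : μ • y = μ • c + x := hyx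
      simp [smul_sub, hyx]
  have h := (isPeriodic_uncovered Q μ).volume_cell (measurableSet_uncovered hk μ) (μ • c)
  rw [uncoveredDensity, uncoveredDensity, measureReal_def, measureReal_def, ← h]
  congr 2
  ext x
  simp only [uncovered, Set.mem_inter_iff, Set.mem_ofPred_eq, hset, add_sub_assoc]

lemma uncoveredDensity_anti {n : ℕ} {Q : Set (Fin n → ℝ)} (hc : Convex ℝ Q) (h0 : 0 ∈ Q)
    {a b : ℝ} (ha : 0 ≤ a) (hab : a ≤ b) : uncoveredDensity Q b ≤ uncoveredDensity Q a := by
  refine measureReal_mono (fun x hx => ⟨hx.1, fun u hu => hx.2 u ?_⟩) ?_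
  · exact smul_mono_of_zero_mem hc h0 ha hab hu
  · exact measure_ne_top_of_subset Set.inter_subset_left (by rw [volume_unitCube]; exact ENNReal.one_ne_top)

/-- Only finitely many translates of `BQ` meet the unit cell, and the volumes of these grow like
`μ^n`; this bounds the decrease of the uncovered volume. -/
lemma exists_uncoveredDensity_sub_le {n : ℕ} {Q : Set (Fin n → ℝ)} (hc : Convex ℝ Q)
    (hk : IsCompact Q) (h0 : 0 ∈ Q) (B : ℝ) :
    ∃ C : ℝ, 0 ≤ C ∧ ∀ a b : ℝ, 0 ≤ a → a ≤ b → b ≤ B →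
      uncoveredDensity Q a - uncoveredDensity Q b ≤ C * (b ^ n - a ^ n) := by
  have hfin : (latticePoints (Set.Icc (0 : Fin n → ℝ) 1 - B • Q)).Finite :=
    finite_latticePoints (isCompact_Icc.isBounded.sub (hk.smul B).isBounded)
  refine ⟨hfin.toFinset.card * volume.real Q, by positivity, fun a b ha hab hbB => ?_⟩
  have hsub : Set.Icc 0 1 ∩ uncovered Q a ⊆ (Set.Icc 0 1 ∩ uncovered Q b) ∪
      ⋃ u ∈ hfin.toFinset, {x | x - toReal u ∈ b • Q \ a • Q} := by
    rintro x ⟨hxW, hxa⟩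
    by_cases hxb : x ∈ uncovered Q b
    · exact Or.inl ⟨hxW, hxb⟩
    · simp only [uncovered, Set.mem_ofPred_eq, not_forall, not_not] at hxb
      obtain ⟨u, hu⟩ := hxb
      refine Or.inr (Set.mem_biUnion ?_ ⟨hu, hxa u⟩)
      rw [Finset.mem_coe, Set.Finite.mem_toFinset]
      exact ⟨x, hxW, x - toReal u, smul_mono_of_zero_mem hc h0 (ha.trans hab) hbB hu,
        sub_sub_cancel _ _⟩
  have hdiff : ∀ u : Fin n → ℤ, volume.real {x | x - toReal u ∈ b • Q \ a • Q} =
      (b ^ n - a ^ n) * volume.real Q := by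
    intro u
    rw [measureReal_def, volume_setOf_sub_mem, ← measureReal_def,
      measureReal_sdiff (smul_mono_of_zero_mem hc h0 ha hab) (hk.smul a).measurableSet
        (hk.smul b).measure_ne_top, volume_real_smul Q ha,
      volume_real_smul Q (ha.trans hab)]
    ring
  have hne : ∀ u : Fin n → ℤ, volume {x | x - toReal u ∈ b • Q \ a • Q} ≠ ⊤ := fun u => by
    rw [volume_setOf_sub_mem]
    exact measure_ne_top_of_subset Set.sdiff_subset (hk.smul b).measure_ne_top
  have hle := (measureReal_mono hsub (measure_union_ne_top (measure_ne_top_of_subset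
      Set.inter_subset_left (by rw [volume_unitCube]; exact ENNReal.one_ne_top)) (by
        refine ((measure_biUnion_finset_le _ _).trans_lt ?_).ne
        exact ENNReal.sum_lt_top.2 fun u _ => (hne u).lt_top))).trans
    ((measureReal_union_le _ _).trans (add_le_add le_rfl (measureReal_biUnion_finset_le _ _)))
  simp only [hdiff, Finset.sum_const, nsmul_eq_mul] at hle
  have : uncoveredDensity Q a ≤ uncoveredDensity Q b +
    hfin.toFinset.card * ((b ^ n - a ^ n) * volume.real Q) := hle
  linarith

lemma continuousOn_uncoveredDensity {n : ℕ} {Q : Set (Fin n → ℝ)} (hc : Convex ℝ Q)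
    (hk : IsCompact Q) (h0 : 0 ∈ Q) : ContinuousOn (uncoveredDensity Q) (Set.Ici 0) := by
  intro a ha
  obtain ⟨C, hC, h⟩ := exists_uncoveredDensity_sub_le hc hk h0 (a + 1)
  have hbound : ∀ b ∈ Set.Ici (0 : ℝ), b ≤ a + 1 →
      |uncoveredDensity Q b - uncoveredDensity Q a| ≤ C * |b ^ n - a ^ n| := by
    intro b hb hb1
    have hb : 0 ≤ b := hb
    have ha : 0 ≤ a := ha
    rcases le_total a b with hab | hab
    · have h1 := h a b ha hab hb1
      have h2 := uncoveredDensity_anti hc h0 ha hab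
      rw [abs_of_nonpos (by linarith), abs_of_nonneg (by linarith [pow_le_pow_left₀ ha hab n])]
      linarith
    · have h1 := h b a hb hab (by linarith)
      have h2 := uncoveredDensity_anti hc h0 hb hab
      rw [abs_of_nonneg (by linarith), abs_of_nonpos (by linarith [pow_le_pow_left₀ hb hab n])]
      linarith
  rw [ContinuousWithinAt, tendsto_iff_dist_tendsto_zero]
  refine squeeze_zero' (Eventually.of_forall fun _ => dist_nonneg) (g := fun b => C * |b ^ n - a ^ n|)
    ?_ ?_
  · have h1 : ∀ᶠ b in 𝓝[Set.Ici 0] a, b ≤ a + 1 :=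
      nhdsWithin_le_nhds ((eventually_lt_nhds (by linarith : a < a + 1)).mono fun _ => le_of_lt)
    filter_upwards [h1, self_mem_nhdsWithin] with b hb hb0
    rw [Real.dist_eq]
    exact hbound b hb0 hb
  · have : Tendsto (fun b : ℝ => C * |b ^ n - a ^ n|) (𝓝 a) (𝓝 (C * |a ^ n - a ^ n|)) := by
      apply Continuous.tendsto
      fun_prop
    simpa using this.mono_left nhdsWithin_le_nhds

/-! ### Decomposing dilates of a lattice polytope -/

/-- If `μ ≥ |B|` then in a combination of the vertices `B` with nonnegative coefficients of sum
`1 + μ` some coefficient is at least one, and a vertex can be split off. -/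
lemma exists_sub_mem_smul_convexHull {n : ℕ} {B : Finset (Fin n → ℤ)} (hB : B.Nonempty) {μ : ℝ}
    (hμ : (B.card : ℝ) ≤ μ) {x : Fin n → ℝ}
    (hx : x ∈ (1 + μ) • convexHull ℝ (toReal '' (B : Set (Fin n → ℤ)))) :
    ∃ b ∈ B, x - toReal b ∈ μ • convexHull ℝ (toReal '' (B : Set (Fin n → ℤ))) := by
  classical
  have hcard : (1 : ℝ) ≤ B.card := by exact_mod_cast hB.card_pos
  have hμ0 : 0 < μ := by linarith
  obtain ⟨y, hy, rfl⟩ := hx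
  have himg : toReal '' (B : Set (Fin n → ℤ)) = ((B.image toReal : Finset (Fin n → ℝ)) : Set _) := by
    simp
  rw [himg, Finset.mem_convexHull'] at hy
  obtain ⟨w, hw0, hw1, rfl⟩ := hy
  rw [Finset.sum_image fun _ _ _ _ h => toReal_injective h] at hw1
  simp only [Finset.sum_image fun _ _ _ _ h => toReal_injective h]
  obtain ⟨b, hb, hle⟩ := Finset.exists_le_of_sum_le hB
    (f := fun _ => (1 : ℝ)) (g := fun b => (1 + μ) * w (toReal b)) (by
      rw [← Finset.mul_sum, hw1]
      simp only [Finset.sum_const, nsmul_eq_mul, mul_one]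
      linarith)
  refine ⟨b, hb, ∑ a ∈ B, (((1 + μ) * w (toReal a) - if a = b then 1 else 0) / μ) • toReal a,
    ?_, ?_⟩
  · refine (convex_convexHull ℝ _).sum_mem (fun a ha => ?_) ?_ fun a ha =>
      subset_convexHull ℝ _ ⟨a, ha, rfl⟩
    · refine div_nonneg ?_ hμ0.le
      split_ifs with h
      · subst h; linarith
      · have := hw0 _ (Finset.mem_image_of_mem _ ha)
        rw [sub_zero]
        positivity
    · rw [← Finset.sum_div, Finset.sum_sub_distrib, ← Finset.mul_sum, hw1, Finset.sum_ite_eq' B b,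
        if_pos hb]
      field_simp
      ring
  · have h1 : ∀ a ∈ B, μ • ((((1 + μ) * w (toReal a) - if a = b then 1 else 0) / μ) • toReal a) =
        (1 + μ) • (w (toReal a) • toReal a) - if a = b then toReal a else 0 := by
      intro a _
      rw [smul_smul, mul_div_cancel₀ _ hμ0.ne', sub_smul, smul_smul]
      split_ifs <;> simp
    change μ • _ = (1 + μ) • _ - _
    rw [Finset.smul_sum, Finset.sum_congr rfl h1, Finset.sum_sub_distrib, ← Finset.smul_sum,
      Finset.sum_ite_eq' B b, if_pos hb]

lemma exists_mem_smul_sub_mem_smul {n : ℕ} {B : Finset (Fin n → ℤ)} (hB : B.Nonempty) {μ : ℝ}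
    (hμ : (B.card : ℝ) ≤ μ) (k : ℕ) {x : Fin n → ℝ}
    (hx : x ∈ (k + μ) • convexHull ℝ (toReal '' (B : Set (Fin n → ℤ)))) :
    ∃ u : Fin n → ℤ, toReal u ∈ (k : ℝ) • convexHull ℝ (toReal '' (B : Set (Fin n → ℤ))) ∧
      x - toReal u ∈ μ • convexHull ℝ (toReal '' (B : Set (Fin n → ℤ))) := by
  induction k generalizing x with
  | zero =>
    refine ⟨0, ?_, by simpa [toReal_zero] using hx⟩
    obtain ⟨b, hb⟩ := hB
    refine ⟨toReal b, subset_convexHull ℝ _ ⟨b, hb, rfl⟩, ?_⟩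
    simp [toReal_zero]
  | succ k ih =>
    have h1 : ((k + 1 : ℕ) : ℝ) + μ = 1 + (k + μ) := by push_cast; ring
    rw [h1] at hx
    have hk : (0 : ℝ) ≤ k := k.cast_nonneg
    obtain ⟨b, hb, hxb⟩ := exists_sub_mem_smul_convexHull hB (by linarith) hx
    obtain ⟨u, hu, hxu⟩ := ih hxb
    refine ⟨u + b, ?_, ?_⟩
    · rw [Nat.cast_succ, (convex_convexHull ℝ _).add_smul hk zero_le_one, toReal_add]
      refine Set.add_mem_add hu ?_
      rw [one_smul]
      exact subset_convexHull ℝ _ ⟨b, hb, rfl⟩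
    · rw [toReal_add, add_comm, ← sub_sub]
      exact hxu

/-! ### The volume estimate -/

/-- The part of `(k + μ)Q` not covered by the translates `u + μQ` with `u ∈ kQ ∩ ℤⁿ`. -/
def remainder {n : ℕ} (Q : Set (Fin n → ℝ)) (k μ : ℝ) : Set (Fin n → ℝ) :=
  {x | x ∈ (k + μ) • Q ∧ ∀ u ∈ latticePoints (k • Q), x - toReal u ∉ μ • Q}

lemma pow_sub_pow_le_of_le {n : ℕ} {x y : ℝ} (hy : 0 ≤ y) (hyx : y ≤ x) :
    x ^ n - y ^ n ≤ (x - y) * n * x ^ (n - 1) := by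
  have h := abs_pow_sub_pow_le x y n
  rw [abs_of_nonneg (sub_nonneg.2 hyx), abs_of_nonneg (hy.trans hyx), abs_of_nonneg hy,
    max_eq_left hyx] at h
  exact (le_abs_self _).trans h

lemma mem_smul_of_norm_le {n : ℕ} {Q : Set (Fin n → ℝ)} {c : Fin n → ℝ} {ρ s r : ℝ} (hs : 0 < s)
    (hr : s * ρ = r) (hball : Metric.closedBall c ρ ⊆ Q) {z : Fin n → ℝ} (hz : ‖z‖ ≤ r) :
    s • c + z ∈ s • Q := by
  refine ⟨c + s⁻¹ • z, hball ?_, ?_⟩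
  · rw [Metric.mem_closedBall, dist_eq_norm, add_sub_cancel_left, norm_smul, Real.norm_eq_abs,
      abs_of_pos (inv_pos.2 hs), inv_mul_le_iff₀ hs, hr]
    exact hz
  · simp [smul_add, hs.ne']

lemma norm_le_one_of_mem_unitCube {n : ℕ} {t : Fin n → ℝ} (ht : t ∈ Set.Icc (0 : Fin n → ℝ) 1) :
    ‖t‖ ≤ 1 := by
  rw [pi_norm_le_iff_of_nonneg zero_le_one]
  intro i
  rw [Real.norm_eq_abs, abs_of_nonneg (ht.1 i)]
  exact ht.2 i

/-- For large `μ` the translates of `μQ` cover everything. -/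
lemma uncoveredDensity_eq_zero {n : ℕ} {B : Finset (Fin n → ℤ)} {Q : Set (Fin n → ℝ)}
    (hQ : Q = convexHull ℝ (toReal '' (B : Set (Fin n → ℤ)))) (h0 : 0 ∈ Q)
    (hint : (interior Q).Nonempty) {μ : ℝ} (hμ : (B.card : ℝ) ≤ μ) : uncoveredDensity Q μ = 0 := by
  have hc : Convex ℝ Q := hQ ▸ convex_convexHull ℝ _
  have hB : B.Nonempty := by
    by_contra h
    rw [Finset.not_nonempty_iff_eq_empty] at h
    simp [hQ, h] at h0
  have hμ0 : 0 ≤ μ := le_trans (Nat.cast_nonneg _) hμ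
  obtain ⟨c, hcQ⟩ := hint
  obtain ⟨ρ, hρ, hball⟩ := Metric.nhds_basis_closedBall.mem_iff.1 (mem_interior_iff_mem_nhds.1 hcQ)
  obtain ⟨k, hk⟩ := exists_nat_gt (2 / ρ)
  have hk0 : (0 : ℝ) < k := lt_trans (by positivity) hk
  have hkρ : 2 ≤ k * ρ := ((div_lt_iff₀ hρ).1 hk).le
  have hempty : Set.Icc (0 : Fin n → ℝ) 1 ∩ uncovered Q μ = ∅ := by
    rw [Set.eq_empty_iff_forall_notMem]
    rintro x ⟨hxW, hx⟩
    -- translate `x` by a lattice point close to `k c`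
    let v : Fin n → ℤ := fun i => ⌊(k : ℝ) * c i⌋
    have hz : ‖x - fun i => Int.fract ((k : ℝ) * c i)‖ ≤ k * ρ := by
      refine le_trans (norm_sub_le _ _) (le_trans (add_le_add (norm_le_one_of_mem_unitCube hxW)
        (norm_le_one_of_mem_unitCube ?_)) (by linarith))
      exact ⟨fun i => Int.fract_nonneg _, fun i => (Int.fract_lt_one _).le⟩
    have h1 := mem_smul_of_norm_le hk0 rfl hball hz
    have h2 : (k : ℝ) • c + (x - fun i => Int.fract ((k : ℝ) * c i)) = x + toReal v := by
      ext i
      have := Int.self_sub_fract ((k : ℝ) * c i)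
      simp only [Pi.add_apply, Pi.smul_apply, Pi.sub_apply, smul_eq_mul, toReal, v]
      linarith
    rw [h2] at h1
    have h3 := smul_mono_of_zero_mem hc h0 hk0.le (by linarith : (k : ℝ) ≤ k + μ) h1
    rw [hQ] at h3
    obtain ⟨u, -, hu⟩ := exists_mem_smul_sub_mem_smul hB hμ k h3
    rw [← hQ] at hu
    refine hx (u - v) ?_
    rwa [toReal_sub, sub_sub_eq_add_sub]
  rw [uncoveredDensity, hempty, measureReal_empty]

lemma remainder_eq_empty {n : ℕ} {B : Finset (Fin n → ℤ)} {Q : Set (Fin n → ℝ)}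
    (hQ : Q = convexHull ℝ (toReal '' (B : Set (Fin n → ℤ)))) (h0 : 0 ∈ Q) {μ : ℝ}
    (hμ : (B.card : ℝ) ≤ μ) (k : ℕ) : remainder Q k μ = ∅ := by
  have hB : B.Nonempty := by
    by_contra h
    rw [Finset.not_nonempty_iff_eq_empty] at h
    simp [hQ, h] at h0
  rw [Set.eq_empty_iff_forall_notMem]
  rintro x ⟨hx, hxu⟩
  rw [hQ] at hx
  obtain ⟨u, hu, hxu'⟩ := exists_mem_smul_sub_mem_smul hB hμ k hx
  rw [← hQ] at hu hxu'
  exact hxu u hu hxu'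

/-- The volume of `remainder Q k μ` is `k^n vol(Q)` times the uncovered density, up to
`O(k^{n-1})`. For `μ ≥ |B|` both vanish. For smaller `μ` only translates with `u` near the boundary
of `kQ` distinguish `remainder Q k μ` from the periodic set `uncovered Q μ`, and the sets in question
lie between a translate of `(k - s)Q` and a translate of `(k + s)Q`. -/
theorem exists_abs_volume_remainder_sub_le {n : ℕ} (hn : 1 ≤ n) {B : Finset (Fin n → ℤ)}
    {Q : Set (Fin n → ℝ)} (hQ : Q = convexHull ℝ (toReal '' (B : Set (Fin n → ℤ)))) (h0 : 0 ∈ Q)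
    (hint : (interior Q).Nonempty) :
    ∃ C : ℝ, ∀ k : ℕ, 1 ≤ k → ∀ μ : ℝ, 0 ≤ μ →
      |volume.real (remainder Q k μ) - (k : ℝ) ^ n * volume.real Q * uncoveredDensity Q μ| ≤
        C * (k : ℝ) ^ (n - 1) := by
  have hc : Convex ℝ Q := hQ ▸ convex_convexHull ℝ _
  have hk : IsCompact Q := hQ ▸ (B.finite_toSet.image _).isCompact_convexHull ℝ
  obtain ⟨M, hM⟩ := hk.isBounded.exists_norm_le
  have hM0 : 0 ≤ M := (norm_nonneg _).trans (hM 0 h0)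
  obtain ⟨c, hcQ⟩ := hint
  obtain ⟨ρ, hρ, hball⟩ := Metric.nhds_basis_closedBall.mem_iff.1 (mem_interior_iff_mem_nhds.1 hcQ)
  set b : ℝ := (B.card : ℝ)
  have hb0 : 0 ≤ b := Nat.cast_nonneg _
  -- perturbations of norm at most `r` are absorbed by `s Q`
  set r : ℝ := 1 + b * M
  have hr1 : 1 ≤ r := by have := mul_nonneg hb0 hM0; simp only [r]; linarith
  set s : ℝ := r / ρ
  have hs : 0 < s := div_pos (by linarith) hρ
  have hsr : s * ρ = r := div_mul_cancel₀ _ hρ.ne'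
  set V : ℝ := volume.real Q
  have hV : 0 ≤ V := measureReal_nonneg
  refine ⟨2 * V * ((b + s + s) * n * (1 + (b + s)) ^ (n - 1)), fun k hk1 μ hμ => ?_⟩
  have hk1' : (1 : ℝ) ≤ k := by exact_mod_cast hk1
  have hk0 : (0 : ℝ) ≤ k := by linarith
  rcases le_or_gt b μ with hbμ | hbμ
  · rw [remainder_eq_empty hQ h0 hbμ, uncoveredDensity_eq_zero hQ h0 ⟨c, hcQ⟩ hbμ]
    simp only [measureReal_empty, mul_zero, sub_zero, abs_zero]
    positivity
  set ψ := uncoveredDensity Q μ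
  obtain ⟨hψ0, hψ1⟩ : 0 ≤ ψ ∧ ψ ≤ 1 := uncoveredDensity_mem_Icc Q μ
  have hF := isPeriodic_uncovered Q μ
  have hFm := measurableSet_uncovered hk μ
  have hfinW : volume (Set.Icc (0 : Fin n → ℝ) 1 ∩ uncovered Q μ) ≠ ⊤ :=
    measure_ne_top_of_subset Set.inter_subset_left
      (by rw [volume_unitCube]; exact ENNReal.one_ne_top)
  -- the inner set, which is empty for `k < s`
  set A : Set (Fin n → ℝ) := {x | s ≤ k ∧ x - s • c ∈ ((k : ℝ) - s) • Q}
  set Y : ℝ := max ((k : ℝ) - s) 0 ^ n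
  have hAm : MeasurableSet A := by
    by_cases hsk : s ≤ k
    · simp only [A, hsk, true_and]
      exact (measurable_id.sub_const _) (hk.smul _).measurableSet
    · simp only [A, hsk, false_and]
      exact MeasurableSet.empty
  have hAvol : volume.real A = Y * V := by
    by_cases hsk : s ≤ k
    · simp only [A, hsk, true_and, Y]
      rw [measureReal_def, volume_setOf_sub_mem, ← measureReal_def,
        volume_real_smul Q (sub_nonneg.2 hsk), max_eq_left (sub_nonneg.2 hsk)]
    · simp only [A, hsk, false_and, Y]
      rw [max_eq_right (by linarith), zero_pow (by omega), zero_mul]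
      exact measureReal_empty
  have hinner : ∀ x ∈ A, ∀ z : Fin n → ℝ, ‖z‖ ≤ r → x + z ∈ (k : ℝ) • Q := by
    rintro x ⟨hsk, hx⟩ z hz
    have h1 := Set.add_mem_add hx (mem_smul_of_norm_le hs hsr hball hz)
    rw [← hc.add_smul (sub_nonneg.2 hsk) hs.le] at h1
    have e1 : x - s • c + (s • c + z) = x + z := by abel
    rwa [e1, sub_add_cancel] at h1
  -- the outer set
  set A' : Set (Fin n → ℝ) := {x | x + s • c ∈ ((k : ℝ) + μ + s) • Q}
  have hA'm : MeasurableSet A' := (measurable_id.add_const _) (hk.smul _).measurableSet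
  set X : ℝ := ((k : ℝ) + (b + s)) ^ n
  have hA'vol : volume.real A' ≤ X * V := by
    rw [measureReal_def, volume_setOf_add_mem, ← measureReal_def, volume_real_smul Q (by linarith)]
    refine mul_le_mul_of_nonneg_right (pow_le_pow_left₀ (by linarith) (by linarith) n) hV
  have houter : ∀ x ∈ ((k : ℝ) + μ) • Q, ∀ z : Fin n → ℝ, ‖z‖ ≤ r → x + z ∈ A' := by
    intro x hx z hz
    have h1 := Set.add_mem_add hx (mem_smul_of_norm_le hs hsr hball hz)
    rw [← hc.add_smul (by linarith) hs.le] at h1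
    have e1 : x + (s • c + z) = x + z + s • c := by abel
    rwa [e1] at h1
  have hYk : Y ≤ (k : ℝ) ^ n := pow_le_pow_left₀ (le_max_right _ _) (max_le (by linarith) hk0) n
  have hkX : (k : ℝ) ^ n ≤ X := pow_le_pow_left₀ hk0 (by linarith) n
  have hremfin : volume (remainder Q k μ) ≠ ⊤ :=
    measure_ne_top_of_subset (fun x hx => hx.1) (hk.smul _).measure_ne_top
  have hkμb : ((k : ℝ) + μ) • Q ⊆ ((k : ℝ) + b) • Q :=
    smul_mono_of_zero_mem hc h0 (by linarith) (by linarith)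
  have hlower : (k : ℝ) ^ n * V * ψ - volume.real (remainder Q k μ) ≤ (X - Y) * V := by
    have h1 : Y * V * ψ ≤ volume.real ((k : ℝ) • Q ∩ uncovered Q μ) := by
      have := hF.mul_le_volume hFm hAm (B := (k : ℝ) • Q) fun t ht a ha =>
        hinner a ha t ((norm_le_one_of_mem_unitCube ht).trans hr1)
      rw [← hAvol, measureReal_def, measureReal_def]
      have h2 := ENNReal.toReal_mono (measure_ne_top_of_subset Set.inter_subset_left
        (hk.smul _).measure_ne_top) this
      rwa [ENNReal.toReal_mul] at h2
    have h2 : volume.real ((k : ℝ) • Q ∩ uncovered Q μ) ≤ volume.real (remainder Q k μ) := by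
      refine measureReal_mono (fun x hx => ⟨?_, fun u _ => hx.2 u⟩) hremfin
      exact smul_mono_of_zero_mem hc h0 hk0 (by linarith) hx.1
    have h3 : ((k : ℝ) ^ n - Y) * V * ψ ≤ (X - Y) * V * 1 := by
      refine mul_le_mul (mul_le_mul_of_nonneg_right (by linarith) hV) hψ1 hψ0 ?_
      exact mul_nonneg (by linarith) hV
    linarith
  have hupper : volume.real (remainder Q k μ) - (k : ℝ) ^ n * V * ψ ≤ 2 * ((X - Y) * V) := by
    have hsub : remainder Q k μ ⊆
        (((k : ℝ) + μ) • Q ∩ uncovered Q μ) ∪ (((k : ℝ) + b) • Q \ A) := by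
      rintro x ⟨hx, hxu⟩
      by_cases hxF : x ∈ uncovered Q μ
      · exact Or.inl ⟨hx, hxF⟩
      · refine Or.inr ⟨hkμb hx, fun hxA => ?_⟩
        simp only [uncovered, Set.mem_ofPred_eq, not_forall, not_not] at hxF
        obtain ⟨u, hu⟩ := hxF
        refine hxu u ?_ hu
        have hz : ‖-(x - toReal u)‖ ≤ r := by
          obtain ⟨q, hq, hqx⟩ := hu
          have hqx : μ • q = x - toReal u := hqx
          rw [norm_neg, ← hqx, norm_smul, Real.norm_eq_abs, abs_of_nonneg hμ]
          have := mul_le_mul hbμ.le (hM q hq) (norm_nonneg _) hb0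
          simp only [r]
          linarith
        have := hinner x hxA _ hz
        rwa [neg_sub, add_sub_cancel] at this
    have h1 : volume.real (((k : ℝ) + μ) • Q ∩ uncovered Q μ) ≤ X * V * ψ := by
      have := hF.volume_le_mul hFm hA'm (B := ((k : ℝ) + μ) • Q) fun t ht a ha => by
        have h2 := houter _ ha (-t) (by
          rw [norm_neg]; exact (norm_le_one_of_mem_unitCube ht).trans hr1)
        rwa [add_neg_cancel_right] at h2
      have hne : volume A' ≠ ⊤ := by
        rw [volume_setOf_add_mem]; exact (hk.smul _).measure_ne_top
      have h2 := ENNReal.toReal_mono (ENNReal.mul_ne_top hne hfinW) this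
      rw [ENNReal.toReal_mul] at h2
      exact h2.trans (mul_le_mul_of_nonneg_right hA'vol hψ0)
    have h2 : volume.real (((k : ℝ) + b) • Q \ A) ≤ (X - Y) * V := by
      have hsubA : A ⊆ ((k : ℝ) + b) • Q := fun x hx => by
        have := hinner x hx 0 (by rw [norm_zero]; linarith)
        rw [add_zero] at this
        exact smul_mono_of_zero_mem hc h0 hk0 (by linarith) this
      rw [measureReal_sdiff hsubA hAm (hk.smul ((k : ℝ) + b)).measure_ne_top, hAvol,
        volume_real_smul Q (by linarith), sub_mul]
      have : ((k : ℝ) + b) ^ n ≤ X := pow_le_pow_left₀ (by linarith) (by linarith) n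
      have := mul_le_mul_of_nonneg_right this hV
      linarith
    have h3 := (measureReal_mono (μ := volume) hsub (measure_union_ne_top
      (measure_ne_top_of_subset Set.inter_subset_left (hk.smul ((k : ℝ) + μ)).measure_ne_top)
      (measure_ne_top_of_subset Set.sdiff_subset (hk.smul ((k : ℝ) + b)).measure_ne_top))).trans
      (measureReal_union_le _ _)
    have h4 : (X - (k : ℝ) ^ n) * V * ψ ≤ (X - Y) * V * 1 := by
      refine mul_le_mul (mul_le_mul_of_nonneg_right (by linarith) hV) hψ1 hψ0 ?_
      exact mul_nonneg (by linarith) hV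
    linarith
  have hXY : X - Y ≤ (b + s + s) * n * (1 + (b + s)) ^ (n - 1) * (k : ℝ) ^ (n - 1) := by
    have hle : max ((k : ℝ) - s) 0 ≤ k + (b + s) := max_le (by linarith) (by linarith)
    refine (pow_sub_pow_le_of_le (le_max_right _ _) hle).trans ?_
    rw [mul_assoc ((b + s + s) * n), ← mul_pow]
    have h1 : (k : ℝ) + (b + s) - max ((k : ℝ) - s) 0 ≤ b + s + s := by
      have := le_max_left ((k : ℝ) - s) 0
      linarith
    have h2 : (k : ℝ) + (b + s) ≤ (1 + (b + s)) * k := by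
      have : (b + s) * 1 ≤ (b + s) * k := mul_le_mul_of_nonneg_left hk1' (by linarith)
      linarith
    refine mul_le_mul (mul_le_mul_of_nonneg_right h1 (Nat.cast_nonneg _))
      (pow_le_pow_left₀ (by linarith) h2 _) (by positivity) (by positivity)
  have hXYV := mul_le_mul_of_nonneg_right hXY hV
  have hpos : 0 ≤ (X - Y) * V := mul_nonneg (by linarith) hV
  rw [abs_le]
  constructor <;> nlinarith [hlower, hupper, hXYV, hpos]

/-! ### Divisors with spanning sections -/

/-- The combinatorial consequences of very ampleness on which the estimates rest: `P_D` is a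
nonempty lattice polytope, and the differences of its lattice points generate `ℤⁿ`. -/
structure HasSpanningSections {n : ℕ} {Δ : Fan n} (D : Δ.TDivisor) : Prop where
  isBounded : Bornology.IsBounded (polytope D)
  eq_convexHull : polytope D = convexHull ℝ (toReal '' latticePoints (polytope D))
  nonempty : (latticePoints (polytope D)).Nonempty
  differenceLattice_eq_top : differenceLattice (latticePoints (polytope D)) = ⊤

lemma IsVeryAmple.hasSpanningSections {K : Type u} [Field K] {n : ℕ} {Δ : Fan n}
    (hΔ : Δ.IsComplete) {D : Δ.TDivisor} (hD : IsVeryAmple K D) : HasSpanningSections D where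
  isBounded := hD.globallyGenerated.isBounded_polytope hΔ
  eq_convexHull := hD.globallyGenerated.polytope_eq hΔ
  nonempty := by
    obtain ⟨w, hw, -⟩ := hD.globallyGenerated ⊥ Δ.bot_mem
    exact ⟨w, hw⟩
  differenceLattice_eq_top := hD.differenceLattice_eq_top

lemma polytope_nsmul {n : ℕ} {Δ : Fan n} (D : Δ.TDivisor) {k : ℕ} (hk : 1 ≤ k) :
    polytope (k • D) = (k : ℝ) • polytope D := by
  have hk' : (0 : ℝ) < k := by exact_mod_cast hk
  ext x
  rw [Set.mem_smul_set_iff_inv_smul_mem₀ hk'.ne']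
  refine forall_congr' fun i => ?_
  rw [smul_dotProduct, smul_eq_mul, le_inv_mul_iff₀ hk']
  simp

lemma HasSpanningSections.nsmul {n : ℕ} {Δ : Fan n} {D : Δ.TDivisor} (hD : HasSpanningSections D)
    {k : ℕ} (hk : 1 ≤ k) : HasSpanningSections (k • D) := by
  have hmem : ∀ a ∈ latticePoints (polytope D), k • a ∈ latticePoints (polytope (k • D)) := by
    intro a ha
    change toReal (k • a) ∈ polytope (k • D)
    rw [polytope_nsmul D hk, toReal_nsmul]
    exact Set.smul_mem_smul_set ha
  obtain ⟨w, hw⟩ := hD.nonempty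
  refine ⟨?_, ?_, ⟨_, hmem w hw⟩, ?_⟩
  · rw [polytope_nsmul D hk]
    exact hD.isBounded.smul₀ _
  · refine subset_antisymm ?_ (convexHull_min ?_ (convex_polytope _))
    · conv_lhs => rw [polytope_nsmul D hk, hD.eq_convexHull, ← convexHull_smul]
      refine convexHull_mono ?_
      rintro _ ⟨_, ⟨a, ha, rfl⟩, rfl⟩
      exact ⟨k • a, hmem a ha, toReal_nsmul k a⟩
    · rintro _ ⟨a, ha, rfl⟩
      exact ha
  · rw [eq_top_iff, ← hD.differenceLattice_eq_top]
    refine (AddSubgroup.closure_le _).2 ?_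
    rintro _ ⟨a, ha, b, hb, rfl⟩
    have hmem' : ∀ a ∈ latticePoints (polytope D),
        a + (k - 1) • w ∈ latticePoints (polytope (k • D)) := by
      intro a ha
      change toReal _ ∈ polytope (k • D)
      have h1 : (k : ℝ) = 1 + ((k - 1 : ℕ) : ℝ) := by
        rw [Nat.cast_sub hk]; push_cast; ring
      rw [polytope_nsmul D hk, toReal_add, toReal_nsmul, h1,
        (convex_polytope D).add_smul zero_le_one (Nat.cast_nonneg _), one_smul]
      exact Set.add_mem_add ha (Set.smul_mem_smul_set hw)
    refine AddSubgroup.subset_closure ⟨_, hmem' a ha, _, hmem' b hb, ?_⟩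
    abel

lemma isClosed_polytope {n : ℕ} {Δ : Fan n} (D : Δ.TDivisor) : IsClosed (polytope D) := by
  have : polytope D = ⋂ i : Δ.rays, {u | -(D i : ℝ) ≤ u ⬝ᵥ toReal i.1} := by
    ext u; simp [polytope]
  rw [this]
  exact isClosed_iInter fun i => isClosed_le continuous_const (by unfold dotProduct; fun_prop)

/-- Lattice points whose differences generate `ℤⁿ` have a convex hull with nonempty interior. -/
lemma interior_convexHull_nonempty {n : ℕ} {A : Set (Fin n → ℤ)} (hA : A.Nonempty)
    (h : differenceLattice A = ⊤) : (interior (convexHull ℝ (toReal '' A))).Nonempty := by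
  rw [interior_convexHull_nonempty_iff_affineSpan_eq_top,
    AffineSubspace.affineSpan_eq_top_iff_vectorSpan_eq_top_of_nonempty ℝ _ _ (hA.image _)]
  have hint : ∀ m : Fin n → ℤ, toReal m ∈ vectorSpan ℝ (toReal '' A) := by
    intro m
    have hm : m ∈ differenceLattice A := by rw [h]; trivial
    induction hm using AddSubgroup.closure_induction with
    | mem x hx =>
      obtain ⟨a, ha, b, hb, rfl⟩ := hx
      rw [toReal_sub]
      exact vsub_mem_vectorSpan ℝ ⟨a, ha, rfl⟩ ⟨b, hb, rfl⟩
    | zero => rw [toReal_zero]; exact zero_mem _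
    | add x y _ _ hx hy => rw [toReal_add]; exact add_mem hx hy
    | neg x _ hx => rw [toReal_neg]; exact neg_mem hx
  rw [eq_top_iff]
  intro x _
  have hx : x = ∑ i, x i • toReal (Pi.single i 1) := by
    ext j
    simp [toReal, Finset.sum_apply, Pi.single_apply]
  rw [hx]
  exact Submodule.sum_mem _ fun i _ => Submodule.smul_mem _ _ (hint _)

/-- The translate `P_D - w`, which contains the origin if `w ∈ P_D`. -/
def shiftedPolytope {n : ℕ} {Δ : Fan n} (D : Δ.TDivisor) (w : Fin n → ℤ) : Set (Fin n → ℝ) :=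
  {x | x + toReal w ∈ polytope D}

lemma zero_mem_shiftedPolytope {n : ℕ} {Δ : Fan n} {D : Δ.TDivisor} {w : Fin n → ℤ}
    (hw : w ∈ latticePoints (polytope D)) : 0 ∈ shiftedPolytope D w := by
  change 0 + toReal w ∈ polytope D
  rw [zero_add]
  exact hw

lemma convex_shiftedPolytope {n : ℕ} {Δ : Fan n} (D : Δ.TDivisor) (w : Fin n → ℤ) :
    Convex ℝ (shiftedPolytope D w) := (convex_polytope D).translate_preimage_left (toReal w)

lemma HasSpanningSections.isCompact_polytope {n : ℕ} {Δ : Fan n} {D : Δ.TDivisor}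
    (hD : HasSpanningSections D) : IsCompact (polytope D) :=
  Metric.isCompact_of_isClosed_isBounded (isClosed_polytope D) hD.isBounded

lemma HasSpanningSections.isCompact_shiftedPolytope {n : ℕ} {Δ : Fan n} {D : Δ.TDivisor}
    (hD : HasSpanningSections D) (w : Fin n → ℤ) : IsCompact (shiftedPolytope D w) :=
  (Homeomorph.addRight (toReal w)).isCompact_preimage.2 hD.isCompact_polytope

lemma HasSpanningSections.interior_nonempty {n : ℕ} {Δ : Fan n} {D : Δ.TDivisor}
    (hD : HasSpanningSections D) (w : Fin n → ℤ) : (interior (shiftedPolytope D w)).Nonempty := by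
  have h1 : interior (shiftedPolytope D w) =
      (Homeomorph.addRight (toReal w)) ⁻¹' interior (polytope D) :=
    ((Homeomorph.addRight (toReal w)).preimage_interior _).symm
  have h2 := interior_convexHull_nonempty hD.nonempty hD.differenceLattice_eq_top
  rw [← hD.eq_convexHull] at h2
  rw [h1]
  exact h2.preimage (Homeomorph.addRight (toReal w)).surjective

lemma HasSpanningSections.exists_shiftedPolytope_eq {n : ℕ} {Δ : Fan n} {D : Δ.TDivisor}
    (hD : HasSpanningSections D) (w : Fin n → ℤ) :
    ∃ B : Finset (Fin n → ℤ), (∀ b ∈ B, b + w ∈ latticePoints (polytope D)) ∧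
      shiftedPolytope D w = convexHull ℝ (toReal '' (B : Set (Fin n → ℤ))) := by
  have hfin := (finite_latticePoints hD.isBounded).image fun a => a - w
  refine ⟨hfin.toFinset, fun b hb => ?_, ?_⟩
  · rw [Set.Finite.mem_toFinset] at hb
    obtain ⟨a, ha, rfl⟩ := hb
    simpa using ha
  · have h1 : toReal '' (hfin.toFinset : Set (Fin n → ℤ)) =
        (-toReal w) +ᵥ (toReal '' latticePoints (polytope D)) := by
      rw [Set.Finite.coe_toFinset, Set.image_image, ← Set.image_vadd, Set.image_image]
      refine Set.image_congr fun a _ => ?_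
      rw [toReal_sub, vadd_eq_add, sub_eq_neg_add]
    rw [h1, convexHull_vadd, ← hD.eq_convexHull]
    ext x
    rw [Set.mem_vadd_set_iff_neg_vadd_mem, neg_neg, vadd_eq_add, add_comm]
    rfl

/-! ### The graded pieces of the coordinate semigroup -/

/-- The exponents of degree `j`, translated by `-jw`. -/
def shiftedDegreeSet {n : ℕ} {Δ : Fan n} (D : Δ.TDivisor) (w : Fin n → ℤ) (j : ℕ) :
    Set (Fin n → ℤ) := {y | y + j • w ∈ degreeSet D j}

section ShiftedDegreeSet

variable {n : ℕ} {Δ : Fan n} {D : Δ.TDivisor} {w : Fin n → ℤ}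

lemma add_mem_shiftedDegreeSet {i j : ℕ} {x y : Fin n → ℤ} (hx : x ∈ shiftedDegreeSet D w i)
    (hy : y ∈ shiftedDegreeSet D w j) : x + y ∈ shiftedDegreeSet D w (i + j) := by
  have h := (coordSemigroup D).add_mem hx hy
  have e : ((x + i • w, i) : (Fin n → ℤ) × ℕ) + (y + j • w, j) = (x + y + (i + j) • w, i + j) := by
    rw [Prod.mk_add_mk, add_smul]
    congr 1
    abel
  rw [e] at h
  exact h

lemma zero_mem_shiftedDegreeSet_zero : (0 : Fin n → ℤ) ∈ shiftedDegreeSet D w 0 := by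
  have h : ((0 : Fin n → ℤ), 0) ∈ coordSemigroup D := (coordSemigroup D).zero_mem
  simpa [shiftedDegreeSet, degreeSet] using h

lemma mem_shiftedDegreeSet_one {b : Fin n → ℤ} (hb : b + w ∈ latticePoints (polytope D)) :
    b ∈ shiftedDegreeSet D w 1 := by
  change (b + 1 • w, 1) ∈ coordSemigroup D
  rw [one_smul]
  exact AddSubmonoid.subset_closure ⟨_, hb, rfl⟩

lemma sum_mem_shiftedDegreeSet {ι : Type*} (s : Finset ι) (f : ι → Fin n → ℤ) (i : ι → ℕ)
    (h : ∀ a ∈ s, f a ∈ shiftedDegreeSet D w (i a)) :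
    ∑ a ∈ s, f a ∈ shiftedDegreeSet D w (∑ a ∈ s, i a) := by
  classical
  induction s using Finset.induction_on with
  | empty => simpa using zero_mem_shiftedDegreeSet_zero
  | insert a s ha ih =>
    rw [Finset.sum_insert ha, Finset.sum_insert ha]
    exact add_mem_shiftedDegreeSet (h a (Finset.mem_insert_self _ _))
      (ih fun b hb => h b (Finset.mem_insert_of_mem hb))

lemma nsmul_mem_shiftedDegreeSet {b : Fin n → ℤ} (hb : b ∈ shiftedDegreeSet D w 1) (m : ℕ) :
    m • b ∈ shiftedDegreeSet D w m := by
  have := sum_mem_shiftedDegreeSet (Finset.range m) (fun _ => b) (fun _ => 1) fun _ _ => hb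
  simpa using this

lemma shiftedDegreeSet_mono (hw : w ∈ latticePoints (polytope D)) {i j : ℕ} (hij : i ≤ j) :
    shiftedDegreeSet D w i ⊆ shiftedDegreeSet D w j := by
  intro x hx
  have h0 : (0 : Fin n → ℤ) ∈ shiftedDegreeSet D w 1 :=
    mem_shiftedDegreeSet_one (by rwa [zero_add])
  have := add_mem_shiftedDegreeSet hx (nsmul_mem_shiftedDegreeSet h0 (j - i))
  rwa [smul_zero, add_zero, Nat.add_sub_cancel' hij] at this

lemma shiftedDegreeSet_subset (hw : w ∈ latticePoints (polytope D)) (j : ℕ) :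
    shiftedDegreeSet D w j ⊆ latticePoints ((j : ℝ) • shiftedPolytope D w) := by
  have key : ∀ s ∈ coordSemigroup D,
      toReal s.1 - (s.2 : ℝ) • toReal w ∈ (s.2 : ℝ) • shiftedPolytope D w := by
    intro s hs
    induction hs using AddSubmonoid.closure_induction with
    | mem x hx =>
      obtain ⟨u, hu, rfl⟩ := hx
      simp only [Nat.cast_one, one_smul]
      change toReal u - toReal w + toReal w ∈ polytope D
      rw [sub_add_cancel]
      exact hu
    | zero =>
      refine ⟨0, zero_mem_shiftedPolytope hw, ?_⟩
      simp [toReal_zero]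
    | add x y _ _ hx hy =>
      have h := Set.add_mem_add hx hy
      rw [← (convex_shiftedPolytope D w).add_smul (Nat.cast_nonneg _) (Nat.cast_nonneg _)] at h
      rw [Prod.snd_add, Prod.fst_add, Nat.cast_add, toReal_add, add_smul]
      convert h using 1
      abel
  intro y hy
  have h := key _ hy
  simp only [toReal_add, toReal_nsmul, add_sub_cancel_right] at h
  exact h

lemma HasSpanningSections.finite_latticePoints_smul (hD : HasSpanningSections D) (r : ℝ) :
    (latticePoints (r • shiftedPolytope D w)).Finite :=
  finite_latticePoints ((hD.isCompact_shiftedPolytope w).smul r).isBounded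

lemma HasSpanningSections.finite_shiftedDegreeSet (hD : HasSpanningSections D)
    (hw : w ∈ latticePoints (polytope D)) (j : ℕ) : (shiftedDegreeSet D w j).Finite :=
  (hD.finite_latticePoints_smul _).subset (shiftedDegreeSet_subset hw j)

lemma ncard_shiftedDegreeSet (j : ℕ) :
    (shiftedDegreeSet D w j).ncard = (degreeSet D j).ncard := by
  have : shiftedDegreeSet D w j = (Equiv.addRight (j • w)) ⁻¹' degreeSet D j := rfl
  rw [this, ← Equiv.image_symm_eq_preimage, Set.ncard_image_of_injective _ (Equiv.injective _)]

lemma HasSpanningSections.exists_sub_eq (hD : HasSpanningSections D)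
    (w : Fin n → ℤ) (y : Fin n → ℤ) :
    ∃ i, ∃ s ∈ shiftedDegreeSet D w i, ∃ s' ∈ shiftedDegreeSet D w i, y = s - s' := by
  have hy : y ∈ differenceLattice (latticePoints (polytope D)) := by
    rw [hD.differenceLattice_eq_top]; trivial
  induction hy using AddSubgroup.closure_induction with
  | mem x hx =>
    obtain ⟨a, ha, b, hb, rfl⟩ := hx
    exact ⟨1, a - w, mem_shiftedDegreeSet_one (by rwa [sub_add_cancel]), b - w,
      mem_shiftedDegreeSet_one (by rwa [sub_add_cancel]), by abel⟩
  | zero => exact ⟨0, 0, zero_mem_shiftedDegreeSet_zero, 0, zero_mem_shiftedDegreeSet_zero,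
      (sub_zero 0).symm⟩
  | add x y _ _ hx hy =>
    obtain ⟨i, s, hs, s', hs', rfl⟩ := hx
    obtain ⟨j, t, ht, t', ht', rfl⟩ := hy
    exact ⟨i + j, s + t, add_mem_shiftedDegreeSet hs ht, s' + t', add_mem_shiftedDegreeSet hs' ht',
      by abel⟩
  | neg x _ hx =>
    obtain ⟨i, s, hs, s', hs', rfl⟩ := hx
    exact ⟨i, s', hs', s, hs, by abel⟩

/-- The semigroup contains a translate of its saturation. A lattice point of `jQ` is a sum of
vertices and of a fractional part, and there are only finitely many fractional parts, each a
difference of elements of the semigroup. -/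
theorem HasSpanningSections.exists_conductor (hD : HasSpanningSections D)
    (hw : w ∈ latticePoints (polytope D)) :
    ∃ (c : Fin n → ℤ) (m₀ : ℕ), ∀ j : ℕ, ∀ y ∈ latticePoints ((j : ℝ) • shiftedPolytope D w),
      y + c ∈ shiftedDegreeSet D w (j + m₀) := by
  classical
  obtain ⟨B, hBmem, hB⟩ := hD.exists_shiftedPolytope_eq w
  set R : ℝ := ∑ b ∈ B, ‖toReal b‖
  have hZ : (latticePoints (Metric.closedBall (0 : Fin n → ℝ) R)).Finite :=
    finite_latticePoints Metric.isBounded_closedBall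
  choose i s hs s' hs' hss using hD.exists_sub_eq w
  refine ⟨∑ z ∈ hZ.toFinset, s' z, ∑ z ∈ hZ.toFinset, i z, fun j y hy => ?_⟩
  obtain ⟨x, hx, hxy⟩ : toReal y ∈ (j : ℝ) • shiftedPolytope D w := hy
  have hxy : (j : ℝ) • x = toReal y := hxy
  have himg : toReal '' (B : Set (Fin n → ℤ)) = ((B.image toReal : Finset (Fin n → ℝ)) : Set _) := by
    simp
  rw [hB, himg, Finset.mem_convexHull'] at hx
  obtain ⟨v, hv0, hv1, rfl⟩ := hx
  rw [Finset.sum_image fun _ _ _ _ h => toReal_injective h] at hv1 hxy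
  have hc0 : ∀ b ∈ B, 0 ≤ (j : ℝ) * v (toReal b) := fun b hb =>
    mul_nonneg (Nat.cast_nonneg _) (hv0 _ (Finset.mem_image_of_mem _ hb))
  set f : (Fin n → ℤ) → ℕ := fun b => ⌊(j : ℝ) * v (toReal b)⌋₊
  have hfj : ∑ b ∈ B, f b ≤ j := by
    have h1 : ((∑ b ∈ B, f b : ℕ) : ℝ) ≤ j := by
      rw [Nat.cast_sum]
      calc ∑ b ∈ B, (f b : ℝ) ≤ ∑ b ∈ B, (j : ℝ) * v (toReal b) :=
            Finset.sum_le_sum fun b hb => Nat.floor_le (hc0 b hb)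
        _ = j := by rw [← Finset.mul_sum, hv1, mul_one]
    exact_mod_cast h1
  have hint : ∑ b ∈ B, f b • b ∈ shiftedDegreeSet D w j :=
    shiftedDegreeSet_mono hw hfj (sum_mem_shiftedDegreeSet B _ _ fun b hb =>
      nsmul_mem_shiftedDegreeSet (mem_shiftedDegreeSet_one (hBmem b hb)) _)
  set z : Fin n → ℤ := y - ∑ b ∈ B, f b • b
  have hzB : z ∈ hZ.toFinset := by
    rw [Set.Finite.mem_toFinset]
    change toReal z ∈ Metric.closedBall 0 R
    have hsum : toReal (∑ b ∈ B, f b • b) = ∑ b ∈ B, (f b : ℝ) • toReal b := by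
      ext a
      simp [toReal, Finset.sum_apply]
    rw [mem_closedBall_zero_iff, toReal_sub, hsum, ← hxy, Finset.smul_sum, ← Finset.sum_sub_distrib]
    refine (norm_sum_le _ _).trans (Finset.sum_le_sum fun b hb => ?_)
    rw [smul_smul, ← sub_smul, norm_smul]
    have h1 := Nat.floor_le (hc0 b hb)
    have h2 := Nat.lt_floor_add_one ((j : ℝ) * v (toReal b))
    have h3 : ‖(j : ℝ) * v (toReal b) - f b‖ ≤ 1 := by
      rw [Real.norm_eq_abs, abs_le]
      constructor <;> simp only [f] <;> linarith
    exact mul_le_of_le_one_left (norm_nonneg _) h3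
  have hrest : ∑ a ∈ hZ.toFinset.erase z, s' a ∈
      shiftedDegreeSet D w (∑ a ∈ hZ.toFinset.erase z, i a) :=
    sum_mem_shiftedDegreeSet _ _ _ fun a _ => hs' a
  have h := add_mem_shiftedDegreeSet hint (add_mem_shiftedDegreeSet (hs z) hrest)
  rw [Finset.add_sum_erase _ i hzB] at h
  convert h using 1
  rw [← Finset.add_sum_erase _ s' hzB]
  have h1 : s z = z + s' z := by
    nth_rewrite 2 [hss z]
    abel
  rw [h1]
  simp only [z]
  abel

end ShiftedDegreeSet

/-! ### Counting lattice points -/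

lemma ncard_latticePoints_smul {n : ℕ} (s : Set (Fin n → ℝ)) {x : ℝ} (hx : 0 < x) :
    (latticePoints (x • s)).ncard =
      Nat.card ↑(s ∩ x⁻¹ • (Submodule.span ℤ (Set.range (Pi.basisFun ℝ (Fin n))) :
        Set (Fin n → ℝ))) := by
  have hinj : Function.Injective (fun m : Fin n → ℤ => x⁻¹ • toReal m) :=
    (smul_right_injective _ (inv_pos.2 hx).ne').comp toReal_injective
  rw [← Set.ncard_image_of_injective _ hinj, ← Nat.card_coe_set_eq]
  congr 2
  ext y
  constructor
  · rintro ⟨m, hm, rfl⟩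
    refine ⟨?_, Set.smul_mem_smul_set ?_⟩
    · exact (Set.mem_smul_set_iff_inv_smul_mem₀ hx.ne' _ _).1 hm
    · rw [SetLike.mem_coe, Module.Basis.mem_span_iff_repr_mem]
      exact fun i => ⟨m i, by simp [toReal]⟩
  · rintro ⟨hy, z, hz, rfl⟩
    rw [SetLike.mem_coe, Module.Basis.mem_span_iff_repr_mem] at hz
    choose m hm using hz
    have hmz : toReal m = z := by ext i; simpa [toReal] using hm i
    refine ⟨m, ?_, by rw [← hmz]⟩
    change toReal m ∈ x • s
    rw [Set.mem_smul_set_iff_inv_smul_mem₀ hx.ne', hmz]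
    exact hy

lemma tendsto_ncard_latticePoints_smul {n : ℕ} {s : Set (Fin n → ℝ)} (hs : Bornology.IsBounded s)
    (hm : MeasurableSet s) (hf : volume (frontier s) = 0) :
    Tendsto (fun q : ℕ => ((latticePoints ((q : ℝ) • s)).ncard : ℝ) / (q : ℝ) ^ n) atTop
      (𝓝 (volume.real s)) := by
  have h := tendsto_card_div_pow_atTop_volume s hs hm hf
  rw [Fintype.card_fin] at h
  refine h.congr' ?_
  filter_upwards [eventually_gt_atTop 0] with q hq
  rw [ncard_latticePoints_smul s (by exact_mod_cast hq)]

/-- If `g(i) = o(i^n)` and `i_q = O(q)`, then `g(i_q) = o(q^n)`. The indices `i_q` need not tend to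
infinity. -/
lemma tendsto_comp_div_pow {n : ℕ} (hn : 1 ≤ n) {g : ℕ → ℝ} (hg0 : ∀ i, 0 ≤ g i)
    (hg : Tendsto (fun i : ℕ => g i / (i : ℝ) ^ n) atTop (𝓝 0)) {i : ℕ → ℕ} {C : ℝ} (hC : 0 ≤ C)
    (hi : ∀ q, (i q : ℝ) ≤ C * q) :
    Tendsto (fun q : ℕ => g (i q) / (q : ℝ) ^ n) atTop (𝓝 0) := by
  have hbound : ∀ ε > 0, ∃ K : ℝ, 0 ≤ K ∧ ∀ j : ℕ, g j ≤ ε * (j : ℝ) ^ n + K := by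
    intro ε hε
    obtain ⟨N, hN⟩ := eventually_atTop.1 (hg.eventually (gt_mem_nhds hε))
    refine ⟨∑ j ∈ Finset.range (N + 1), g j, Finset.sum_nonneg fun j _ => hg0 j, fun j => ?_⟩
    rcases le_or_gt (N + 1) j with h | h
    · have hj : (0 : ℝ) < (j : ℝ) ^ n := by
        have : 0 < j := by omega
        positivity
      have h1 := (div_lt_iff₀ hj).1 (hN j (by omega))
      have h2 : 0 ≤ ∑ j ∈ Finset.range (N + 1), g j := Finset.sum_nonneg fun j _ => hg0 j
      linarith
    · have h1 := Finset.single_le_sum (f := g) (fun j _ => hg0 j) (Finset.mem_range.2 h)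
      have h2 : 0 ≤ ε * (j : ℝ) ^ n := by positivity
      linarith
  rw [Metric.tendsto_atTop]
  intro ε hε
  obtain ⟨K, hK0, hK⟩ := hbound (ε / (2 * (C ^ n + 1))) (by positivity)
  obtain ⟨N, hN⟩ := exists_nat_gt (2 * K / ε)
  refine ⟨max N 1, fun q hq => ?_⟩
  have hq1 : (1 : ℝ) ≤ q := by exact_mod_cast (le_max_right N 1).trans hq
  have hqN : (N : ℝ) ≤ q := by exact_mod_cast (le_max_left N 1).trans hq
  have hqn : (q : ℝ) ≤ (q : ℝ) ^ n := le_self_pow₀ hq1 (by omega)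
  have hqn0 : (0 : ℝ) < (q : ℝ) ^ n := by positivity
  rw [Real.dist_eq, sub_zero, abs_of_nonneg (div_nonneg (hg0 _) hqn0.le), div_lt_iff₀ hqn0]
  have h1 : (i q : ℝ) ^ n ≤ C ^ n * (q : ℝ) ^ n := by
    rw [← mul_pow]; exact pow_le_pow_left₀ (Nat.cast_nonneg _) (hi q) n
  have h2 : ε / (2 * (C ^ n + 1)) * (i q : ℝ) ^ n ≤ ε / 2 * (q : ℝ) ^ n := by
    calc ε / (2 * (C ^ n + 1)) * (i q : ℝ) ^ n
        ≤ ε / (2 * (C ^ n + 1)) * ((C ^ n + 1) * (q : ℝ) ^ n) := by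
          refine mul_le_mul_of_nonneg_left (h1.trans ?_) (by positivity)
          exact mul_le_mul_of_nonneg_right (by linarith) hqn0.le
      _ = ε / 2 * (q : ℝ) ^ n := by
          field_simp
  have h3 : K < ε / 2 * (q : ℝ) ^ n := by
    have h4 : 2 * K < N * ε := (div_lt_iff₀ hε).1 hN
    have h5 : (N : ℝ) * ε ≤ (q : ℝ) ^ n * ε := mul_le_mul_of_nonneg_right (hqN.trans hqn) hε.le
    linarith
  have h6 := hK (i q)
  linarith

section Counting

variable {n : ℕ} {Δ : Fan n} {D : Δ.TDivisor} {w : Fin n → ℤ}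

lemma HasSpanningSections.tendsto_ncard_latticePoints (hD : HasSpanningSections D) :
    Tendsto (fun q : ℕ => ((latticePoints ((q : ℝ) • shiftedPolytope D w)).ncard : ℝ) / (q : ℝ) ^ n)
      atTop (𝓝 (volume.real (shiftedPolytope D w))) :=
  tendsto_ncard_latticePoints_smul (hD.isCompact_shiftedPolytope w).isBounded
    (hD.isCompact_shiftedPolytope w).measurableSet
    ((convex_shiftedPolytope D w).addHaar_frontier volume)

/-- Shifting the argument by a constant does not change polynomial asymptotics. -/
lemma tendsto_shift_div_pow {f : ℕ → ℝ} {V : ℝ} {n : ℕ} (m : ℕ)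
    (hf : Tendsto (fun q : ℕ => f q / (q : ℝ) ^ n) atTop (𝓝 V)) :
    Tendsto (fun q : ℕ => f (q + m) / (q : ℝ) ^ n) atTop (𝓝 V) := by
  have h1 : Tendsto (fun q : ℕ => f (q + m) / ((q + m : ℕ) : ℝ) ^ n) atTop (𝓝 V) :=
    hf.comp (tendsto_add_atTop_nat m)
  have h2 : Tendsto (fun q : ℕ => (((q + m : ℕ) : ℝ) / (q : ℝ)) ^ n) atTop (𝓝 (1 ^ n)) := by
    refine Tendsto.pow ?_ n
    have h3 : Tendsto (fun q : ℕ => 1 + (m : ℝ) / (q : ℝ)) atTop (𝓝 (1 + 0)) :=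
      tendsto_const_nhds.add (tendsto_const_div_atTop_nhds_zero_nat _)
    rw [add_zero] at h3
    refine h3.congr' ?_
    filter_upwards [eventually_gt_atTop 0] with q hq
    have hq' : (0 : ℝ) < q := by exact_mod_cast hq
    push_cast
    field_simp
  have h3 := h1.mul h2
  rw [one_pow, mul_one] at h3
  refine h3.congr' ?_
  filter_upwards [eventually_gt_atTop 0] with q hq
  have hq' : (0 : ℝ) < q := by exact_mod_cast hq
  have hqm : (0 : ℝ) < ((q + m : ℕ) : ℝ) := by positivity
  rw [div_pow]
  field_simp

lemma HasSpanningSections.tendsto_ncard_shiftedDegreeSet (hD : HasSpanningSections D)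
    (hw : w ∈ latticePoints (polytope D)) :
    Tendsto (fun j : ℕ => ((shiftedDegreeSet D w j).ncard : ℝ) / (j : ℝ) ^ n) atTop
      (𝓝 (volume.real (shiftedPolytope D w))) := by
  obtain ⟨c, m₀, hc⟩ := hD.exists_conductor hw
  have h1 := hD.tendsto_ncard_latticePoints (w := w)
  have hlow : ∀ j : ℕ, (latticePoints ((j : ℝ) • shiftedPolytope D w)).ncard ≤
      (shiftedDegreeSet D w (j + m₀)).ncard := fun j =>
    Set.ncard_le_ncard_of_injOn (fun y => y + c) (hc j) (fun _ _ _ _ h => add_right_cancel h)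
      (hD.finite_shiftedDegreeSet hw _)
  have hup : ∀ j : ℕ, (shiftedDegreeSet D w j).ncard ≤
      (latticePoints ((j : ℝ) • shiftedPolytope D w)).ncard := fun j =>
    Set.ncard_le_ncard (shiftedDegreeSet_subset hw j) (hD.finite_latticePoints_smul _)
  have h2 : Tendsto (fun j : ℕ => ((shiftedDegreeSet D w (j + m₀)).ncard : ℝ) / (j : ℝ) ^ n) atTop
      (𝓝 (volume.real (shiftedPolytope D w))) := by
    refine tendsto_of_tendsto_of_tendsto_of_le_of_le h1 (tendsto_shift_div_pow m₀ h1)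
      (fun j => ?_) fun j => ?_
    · exact div_le_div_of_nonneg_right (Nat.cast_le.2 (hlow j)) (by positivity)
    · exact div_le_div_of_nonneg_right (Nat.cast_le.2 (hup (j + m₀))) (by positivity)
  rw [← tendsto_add_atTop_iff_nat m₀]
  have h3 : Tendsto (fun q : ℕ => ((q : ℝ) / ((q + m₀ : ℕ) : ℝ)) ^ n) atTop (𝓝 (1 ^ n)) := by
    refine Tendsto.pow ?_ n
    have := tendsto_natCast_div_add_atTop (m₀ : ℝ)
    exact this.congr fun q => by push_cast; rfl
  have h4 := h2.mul h3
  rw [one_pow, mul_one] at h4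
  refine h4.congr' ?_
  filter_upwards [eventually_gt_atTop 0] with q hq
  have hq' : (0 : ℝ) < q := by exact_mod_cast hq
  have hqm : (0 : ℝ) < ((q + m₀ : ℕ) : ℝ) := by positivity
  rw [div_pow]
  field_simp

/-- The number of lattice points of `(i + 1)Q` which do not come from the semigroup. -/
def defect (D : Δ.TDivisor) (w : Fin n → ℤ) (i : ℕ) : ℕ :=
  (latticePoints (((i + 1 : ℕ) : ℝ) • shiftedPolytope D w) \ shiftedDegreeSet D w i).ncard

lemma HasSpanningSections.tendsto_defect (hD : HasSpanningSections D)
    (hw : w ∈ latticePoints (polytope D)) :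
    Tendsto (fun i : ℕ => (defect D w i : ℝ) / (i : ℝ) ^ n) atTop (𝓝 0) := by
  have h1 := tendsto_shift_div_pow 1 (hD.tendsto_ncard_latticePoints (w := w))
  have h2 := hD.tendsto_ncard_shiftedDegreeSet hw
  have h3 := h1.sub h2
  rw [sub_self] at h3
  refine h3.congr fun i => ?_
  have hsub : shiftedDegreeSet D w i ⊆
      latticePoints (((i + 1 : ℕ) : ℝ) • shiftedPolytope D w) := fun y hy =>
    smul_mono_of_zero_mem (convex_shiftedPolytope D w) (zero_mem_shiftedPolytope hw)
      (Nat.cast_nonneg _) (by push_cast; linarith) (shiftedDegreeSet_subset hw i hy)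
  have h4 := Set.ncard_sdiff_add_ncard_of_subset hsub (hD.finite_latticePoints_smul _)
  rw [← h4, ← sub_div, Nat.cast_add, add_sub_cancel_right]
  rfl

/-! ### The Hilbert-Kunz density function -/

/-- The region of `tQ` outside the translates `v + (t - 1)Q`, `v ∈ Q ∩ ℤⁿ` (none if `t < 1`). -/
def hkRegion (Q : Set (Fin n → ℝ)) (t : ℝ) : Set (Fin n → ℝ) :=
  {x | x ∈ t • Q ∧ (1 ≤ t → ∀ v ∈ latticePoints Q, x - toReal v ∉ (t - 1) • Q)}

lemma hkRegion_eq_inter (Q : Set (Fin n → ℝ)) {t : ℝ} (ht : 1 ≤ t) :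
    hkRegion Q t = t • Q ∩ ⋂ v ∈ latticePoints Q, {x | x - toReal v ∈ (t - 1) • Q}ᶜ := by
  ext x
  simp [hkRegion, ht]

lemma hkRegion_eq_smul (Q : Set (Fin n → ℝ)) {t : ℝ} (ht : t < 1) : hkRegion Q t = t • Q := by
  ext x
  simp [hkRegion, not_le.2 ht]

lemma volume_frontier_biInter_compl {s : Set (Fin n → ℤ)} (hs : s.Finite)
    {Q : Set (Fin n → ℝ)} (hc : Convex ℝ Q) :
    volume (frontier (⋂ v ∈ s, {x | x - toReal v ∈ Q}ᶜ)) = 0 := by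
  induction s, hs using Set.Finite.induction_on with
  | empty => simp
  | insert _ _ ih =>
    rw [Set.biInter_insert]
    refine null_frontier_inter ?_ ih
    rw [frontier_compl]
    refine Convex.addHaar_frontier volume ?_
    simp only [sub_eq_add_neg]
    exact hc.translate_preimage_left _

lemma volume_frontier_hkRegion {Q : Set (Fin n → ℝ)} (hc : Convex ℝ Q) (hk : IsCompact Q)
    (t : ℝ) : volume (frontier (hkRegion Q t)) = 0 := by
  rcases lt_or_ge t 1 with ht | ht
  · rw [hkRegion_eq_smul Q ht]
    exact (hc.smul t).addHaar_frontier volume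
  · rw [hkRegion_eq_inter Q ht]
    exact null_frontier_inter ((hc.smul t).addHaar_frontier volume)
      (volume_frontier_biInter_compl (finite_latticePoints hk.isBounded) (hc.smul _))

lemma measurableSet_hkRegion {Q : Set (Fin n → ℝ)} (hk : IsCompact Q) (t : ℝ) :
    MeasurableSet (hkRegion Q t) := by
  rcases lt_or_ge t 1 with ht | ht
  · rw [hkRegion_eq_smul Q ht]
    exact (hk.smul t).measurableSet
  · rw [hkRegion_eq_inter Q ht]
    refine (hk.smul t).measurableSet.inter (MeasurableSet.biInter (Set.to_countable _) fun v _ => ?_)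
    exact ((measurable_id.sub_const _) (hk.smul _).measurableSet).compl

/-- The exponents counted by `ℓ((R / m^{[q]})_j)`, translated by `-jw`. -/
def residualSet (D : Δ.TDivisor) (w : Fin n → ℤ) (q j : ℕ) : Set (Fin n → ℤ) :=
  {y | y ∈ shiftedDegreeSet D w j ∧ (q ≤ j → ∀ v ∈ latticePoints (shiftedPolytope D w),
    y - q • v ∉ shiftedDegreeSet D w (j - q))}

lemma ncard_residualSet (q j : ℕ) :
    (residualSet D w q j).ncard = {x ∈ degreeSet D j | q ≤ j → ∀ u ∈ latticePoints (polytope D),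
        x - q • u ∉ degreeSet D (j - q)}.ncard := by
  have : residualSet D w q j = (Equiv.addRight (j • w)) ⁻¹'
      {x ∈ degreeSet D j | q ≤ j → ∀ u ∈ latticePoints (polytope D),
        x - q • u ∉ degreeSet D (j - q)} := by
    ext y
    refine and_congr Iff.rfl (forall_congr' fun hqj => ?_)
    have e : ∀ v, y - q • v + (j - q) • w = y + j • w - q • (v + w) := by
      intro v
      have : j • w = (j - q) • w + q • w := by rw [← add_smul, Nat.sub_add_cancel hqj]
      rw [this, smul_add]
      abel
    have hv : ∀ v, v ∈ latticePoints (shiftedPolytope D w) ↔ v + w ∈ latticePoints (polytope D) :=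
      fun v => by
        change toReal v + toReal w ∈ polytope D ↔ toReal (v + w) ∈ polytope D
        rw [toReal_add]
    constructor
    · intro h u hu hmem
      refine h (u - w) ((hv _).2 (by rwa [sub_add_cancel])) ?_
      change y - q • (u - w) + (j - q) • w ∈ degreeSet D (j - q)
      rw [e, sub_add_cancel]
      exact hmem
    · intro h v hv' hmem
      refine h (v + w) ((hv _).1 hv') ?_
      have hmem : y - q • v + (j - q) • w ∈ degreeSet D (j - q) := hmem
      rw [e] at hmem
      exact hmem
  rw [this, ← Equiv.image_symm_eq_preimage, Set.ncard_image_of_injective _ (Equiv.injective _)]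

/-- The monomials counted in degree `⌊qt⌋` agree with the lattice points of `q · hkRegion Q t` up to
lattice points not in the semigroup. -/
lemma HasSpanningSections.abs_ncard_residualSet_sub_le (hD : HasSpanningSections D)
    (hw : w ∈ latticePoints (polytope D)) {t : ℝ} (ht : 0 ≤ t) {q : ℕ} (hq : 0 < q) :
    |((residualSet D w q ⌊(q : ℝ) * t⌋₊).ncard : ℝ) -
        (latticePoints ((q : ℝ) • hkRegion (shiftedPolytope D w) t)).ncard| ≤
      defect D w ⌊(q : ℝ) * t⌋₊ + (latticePoints (shiftedPolytope D w)).ncard *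
        defect D w (⌊(q : ℝ) * t⌋₊ - q) := by
  set Q := shiftedPolytope D w with hQdef
  have hc : Convex ℝ Q := convex_shiftedPolytope D w
  have h0 : 0 ∈ Q := zero_mem_shiftedPolytope hw
  have hk : IsCompact Q := hD.isCompact_shiftedPolytope w
  have hq' : (0 : ℝ) < q := by exact_mod_cast hq
  have hqt : 0 ≤ (q : ℝ) * t := by positivity
  set j := ⌊(q : ℝ) * t⌋₊
  have hj1 : (j : ℝ) ≤ q * t := Nat.floor_le hqt
  have hj2 : (q : ℝ) * t ≤ (j + 1 : ℕ) := by
    push_cast; exact (Nat.lt_floor_add_one _).le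
  have hqj : q ≤ j ↔ 1 ≤ t := by
    rw [Nat.le_floor_iff hqt]
    exact le_mul_iff_one_le_right hq'
  set N := residualSet D w q j
  set M := latticePoints ((q : ℝ) • hkRegion Q t)
  have hlat : (latticePoints Q).Finite := finite_latticePoints hk.isBounded
  let X₁ := latticePoints (((j + 1 : ℕ) : ℝ) • Q) \ shiftedDegreeSet D w j
  let X₂ : (Fin n → ℤ) → Set (Fin n → ℤ) := fun v => (fun y => y - q • v) ⁻¹'
    (latticePoints (((j - q + 1 : ℕ) : ℝ) • Q) \ shiftedDegreeSet D w (j - q))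
  set X := X₁ ∪ ⋃ v ∈ hlat.toFinset, X₂ v
  have hX₂ : ∀ v, X₂ v = (Equiv.addRight (q • v)) ''
      (latticePoints (((j - q + 1 : ℕ) : ℝ) • Q) \ shiftedDegreeSet D w (j - q)) := fun v => by
    rw [Equiv.image_eq_preimage_symm]
    rfl
  have hX₁fin : X₁.Finite := (hD.finite_latticePoints_smul _).subset Set.sdiff_subset
  have hX₂fin : ∀ v, (X₂ v).Finite := fun v => by
    rw [hX₂]
    exact ((hD.finite_latticePoints_smul _).subset Set.sdiff_subset).image _
  have hXfin : X.Finite := hX₁fin.union ((Finset.finite_toSet _).biUnion fun v _ => hX₂fin v)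
  have hXcard : X.ncard ≤ defect D w j + (latticePoints Q).ncard * defect D w (j - q) := by
    refine (Set.ncard_union_le _ _).trans (add_le_add le_rfl ?_)
    refine (Finset.set_ncard_biUnion_le _ _).trans ?_
    have : ∀ v ∈ hlat.toFinset, (X₂ v).ncard ≤ defect D w (j - q) := fun v _ => by
      rw [hX₂, Set.ncard_image_of_injective _ (Equiv.injective _)]
      exact le_rfl
    refine (Finset.sum_le_card_nsmul _ _ _ this).trans ?_
    rw [smul_eq_mul, Set.ncard_eq_toFinset_card _ hlat]
  -- translates of `(t - 1)Q` before and after scaling by `q`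
  have hscale : ∀ (x : Fin n → ℝ) (y v : Fin n → ℤ), (q : ℝ) • x = toReal y →
      (x - toReal v ∈ (t - 1) • Q ↔ toReal (y - q • v) ∈ ((q : ℝ) * t - q) • Q) := by
    intro x y v hxy
    have e1 : (q : ℝ) * t - q = q * (t - 1) := by ring
    rw [toReal_sub, toReal_nsmul, ← hxy, ← smul_sub, e1, mul_smul,
      Set.smul_mem_smul_set_iff₀ hq'.ne']
  have hNM : N ⊆ M ∪ X := by
    rintro y ⟨hy, hyv⟩
    by_cases hyM : y ∈ M
    · exact Or.inl hyM
    · refine Or.inr (Or.inr ?_)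
      have h1 : toReal y ∈ (q : ℝ) • (t • Q) := by
        rw [← mul_smul]
        exact smul_mono_of_zero_mem hc h0 (Nat.cast_nonneg _) hj1 (shiftedDegreeSet_subset hw j hy)
      obtain ⟨x, hx, hxy⟩ := h1
      have hxy : (q : ℝ) • x = toReal y := hxy
      have h2 : ¬ (1 ≤ t → ∀ v ∈ latticePoints Q, x - toReal v ∉ (t - 1) • Q) := fun h =>
        hyM ⟨x, ⟨hx, h⟩, hxy⟩
      push Not at h2
      obtain ⟨h1t, v, hv, hxv⟩ := h2
      have hqj' : q ≤ j := hqj.2 h1t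
      refine Set.mem_biUnion (by rwa [Finset.mem_coe, Set.Finite.mem_toFinset]) ⟨?_, hyv hqj' v hv⟩
      refine smul_mono_of_zero_mem hc h0 ?_ ?_ ((hscale x y v hxy).1 hxv)
      · nlinarith
      · push_cast [Nat.cast_sub hqj'] at hj2 ⊢
        linarith
  have hMN : M ⊆ N ∪ X := by
    rintro y ⟨x, ⟨hx, hxv⟩, hxy⟩
    have hxy : (q : ℝ) • x = toReal y := hxy
    by_cases hyN : y ∈ N
    · exact Or.inl hyN
    · refine Or.inr (Or.inl ⟨?_, fun hyj => hyN ⟨hyj, fun hqj' v hv hmem => ?_⟩⟩)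
      · change toReal y ∈ ((j + 1 : ℕ) : ℝ) • Q
        rw [← hxy]
        refine smul_mono_of_zero_mem hc h0 hqt hj2 ?_
        rw [mul_smul]
        exact Set.smul_mem_smul_set hx
      · refine hxv (hqj.1 hqj') v hv ((hscale x y v hxy).2 ?_)
        refine smul_mono_of_zero_mem hc h0 (Nat.cast_nonneg _) ?_
          (shiftedDegreeSet_subset hw _ hmem)
        rw [Nat.cast_sub hqj']
        linarith
  have hNfin : N.Finite := (hD.finite_shiftedDegreeSet hw j).subset fun y hy => hy.1
  have hMfin : M.Finite := by
    refine finite_latticePoints (((hk.smul t).isBounded.subset ?_).smul₀ _)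
    exact fun x hx => hx.1
  have h1 : N.ncard ≤ M.ncard + X.ncard :=
    (Set.ncard_le_ncard hNM (hMfin.union hXfin)).trans (Set.ncard_union_le _ _)
  have h2 : M.ncard ≤ N.ncard + X.ncard :=
    (Set.ncard_le_ncard hMN (hNfin.union hXfin)).trans (Set.ncard_union_le _ _)
  have h1' : (N.ncard : ℝ) ≤ M.ncard + X.ncard := by exact_mod_cast h1
  have h2' : (M.ncard : ℝ) ≤ N.ncard + X.ncard := by exact_mod_cast h2
  have h3' : (X.ncard : ℝ) ≤ defect D w j + (latticePoints Q).ncard * defect D w (j - q) := by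
    exact_mod_cast hXcard
  rw [abs_le]
  constructor <;> linarith

lemma HasSpanningSections.tendsto_ncard_residualSet (hn : 1 ≤ n) (hD : HasSpanningSections D)
    (hw : w ∈ latticePoints (polytope D)) {t : ℝ} (ht : 0 ≤ t) :
    Tendsto (fun q : ℕ => ((residualSet D w q ⌊(q : ℝ) * t⌋₊).ncard : ℝ) / (q : ℝ) ^ n) atTop
      (𝓝 (volume.real (hkRegion (shiftedPolytope D w) t))) := by
  set Q := shiftedPolytope D w
  have hk : IsCompact Q := hD.isCompact_shiftedPolytope w
  have hM := tendsto_ncard_latticePoints_smul (s := hkRegion Q t)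
    ((hk.smul t).isBounded.subset fun x hx => hx.1) (measurableSet_hkRegion hk t)
    (volume_frontier_hkRegion (convex_shiftedPolytope D w) hk t)
  have hdef := hD.tendsto_defect hw
  have hfl : ∀ q : ℕ, ((⌊(q : ℝ) * t⌋₊ : ℕ) : ℝ) ≤ t * q := fun q => by
    rw [mul_comm t]
    exact Nat.floor_le (by positivity)
  have hd1 := tendsto_comp_div_pow hn (fun i => Nat.cast_nonneg (defect D w i)) hdef ht hfl
  have hd2 := tendsto_comp_div_pow hn (fun i => Nat.cast_nonneg (defect D w i)) hdef
    (i := fun q => ⌊(q : ℝ) * t⌋₊ - q) ht fun q =>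
      le_trans (by exact_mod_cast Nat.sub_le _ _) (hfl q)
  have hsum := hd1.add (hd2.const_mul ((latticePoints Q).ncard : ℝ))
  rw [mul_zero, add_zero] at hsum
  have hdiff : Tendsto (fun q : ℕ => ((residualSet D w q ⌊(q : ℝ) * t⌋₊).ncard : ℝ) / (q : ℝ) ^ n -
      ((latticePoints ((q : ℝ) • hkRegion Q t)).ncard : ℝ) / (q : ℝ) ^ n) atTop (𝓝 0) := by
    refine squeeze_zero_norm' ?_ hsum
    filter_upwards [eventually_gt_atTop 0] with q hq
    have hq' : (0 : ℝ) < (q : ℝ) ^ n := by positivity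
    rw [← sub_div, Real.norm_eq_abs, abs_div, abs_of_pos hq', mul_div_assoc', ← add_div]
    exact div_le_div_of_nonneg_right (hD.abs_ncard_residualSet_sub_le hw ht hq) hq'.le
  have := hdiff.add hM
  simpa using this

/-- The Hilbert-Kunz density function is the volume of the region of `tP_D` not covered by the
translates of `(t - 1)P_D` by the lattice points of `P_D`. -/
theorem HasSpanningSections.tendsto_hkDensitySeq (p : ℕ) [Fact p.Prime] (K : Type u) [Field K]
    [CharP K p] (hn : 1 ≤ n) (hD : HasSpanningSections D)
    (hw : w ∈ latticePoints (polytope D)) {t : ℝ} (ht : 0 ≤ t) :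
    Tendsto (fun N => hkDensitySeq p K D N t) atTop
      (𝓝 (volume.real (hkRegion (shiftedPolytope D w) t))) := by
  have hp : Tendsto (fun N : ℕ => p ^ N) atTop atTop :=
    tendsto_pow_atTop_atTop_of_one_lt (Fact.out : p.Prime).one_lt
  refine ((hD.tendsto_ncard_residualSet hn hw ht).comp hp).congr fun N => ?_
  simp only [Function.comp_apply, hkDensitySeq, quotientLength_bracketPower, ncard_residualSet,
    Nat.cast_pow]

/-! ### The multiplicity -/

/-- If `f(j) / j^n → V` then `∑_{j < N} f(j)` is asymptotic to `V N^{n+1} / (n + 1)`. -/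
lemma tendsto_sum_div_pow_succ {f : ℕ → ℝ} {V : ℝ} {n : ℕ}
    (hf : Tendsto (fun j : ℕ => f j / (j : ℝ) ^ n) atTop (𝓝 V)) :
    Tendsto (fun N : ℕ => (n + 1) * (∑ j ∈ Finset.range N, f j) / (N : ℝ) ^ (n + 1)) atTop
      (𝓝 V) := by
  -- compare with the telescoping sum of `(j + 1)^(n + 1) - j^(n + 1)`
  have hdiff : Tendsto (fun j : ℕ => (((j + 1 : ℕ) : ℝ) ^ (n + 1) - (j : ℝ) ^ (n + 1)) /
      (j : ℝ) ^ n) atTop (𝓝 (n + 1)) := by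
    have hup := tendsto_shift_div_pow (f := fun j : ℕ => (n + 1 : ℝ) * (j : ℝ) ^ n) (V := n + 1)
      (n := n) 1 (by
        refine tendsto_const_nhds.congr' ?_
        filter_upwards [eventually_gt_atTop 0] with j hj
        have : (0 : ℝ) < j := by exact_mod_cast hj
        field_simp)
    refine tendsto_of_tendsto_of_tendsto_of_le_of_le' tendsto_const_nhds hup ?_ ?_
    · filter_upwards [eventually_gt_atTop 0] with j hj
      have hj' : (0 : ℝ) < (j : ℝ) := by exact_mod_cast hj
      rw [le_div_iff₀ (by positivity)]
      have h1 : (1 : ℝ) + ((n + 1 : ℕ) : ℝ) * (1 / j) ≤ (1 + 1 / j) ^ (n + 1) :=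
        one_add_mul_le_pow (by have : (0 : ℝ) ≤ 1 / j := by positivity
                               linarith) _
      have h2 : ((j + 1 : ℕ) : ℝ) ^ (n + 1) = (1 + 1 / j) ^ (n + 1) * (j : ℝ) ^ (n + 1) := by
        rw [← mul_pow]
        congr 1
        push_cast
        field_simp
      have h3 := mul_le_mul_of_nonneg_right h1 (by positivity : (0 : ℝ) ≤ (j : ℝ) ^ (n + 1))
      have h4 : (1 + ((n + 1 : ℕ) : ℝ) * (1 / j)) * (j : ℝ) ^ (n + 1) =
          (j : ℝ) ^ (n + 1) + (n + 1) * (j : ℝ) ^ n := by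
        push_cast
        field_simp
        ring
      rw [h2]
      linarith
    · filter_upwards [] with j
      refine div_le_div_of_nonneg_right ?_ (by positivity)
      have h1 := pow_sub_pow_le_of_le (n := n + 1) (Nat.cast_nonneg j : (0 : ℝ) ≤ j)
        (by push_cast; linarith : (j : ℝ) ≤ ((j + 1 : ℕ) : ℝ))
      refine h1.trans (le_of_eq ?_)
      push_cast
      simp
  have hzero : Tendsto (fun j : ℕ => ((n + 1) * f j -
      V * (((j + 1 : ℕ) : ℝ) ^ (n + 1) - (j : ℝ) ^ (n + 1))) / (j : ℝ) ^ n) atTop (𝓝 0) := by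
    have h := (hf.const_mul ((n : ℝ) + 1)).sub (hdiff.const_mul V)
    rw [mul_comm V, sub_self] at h
    refine h.congr fun j => ?_
    ring
  have hlo : (fun j : ℕ => (n + 1) * f j -
      V * (((j + 1 : ℕ) : ℝ) ^ (n + 1) - (j : ℝ) ^ (n + 1))) =o[atTop]
        fun j : ℕ => ((j : ℝ) ^ n) := by
    rw [Asymptotics.isLittleO_iff_tendsto' ?_]
    · exact hzero
    · filter_upwards [eventually_gt_atTop 0] with j hj h
      have : (0 : ℝ) < (j : ℝ) ^ n := by positivity
      exact absurd h this.ne'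
  have hdiv : Tendsto (fun N : ℕ => ∑ j ∈ Finset.range N, (j : ℝ) ^ n) atTop atTop := by
    rw [← tendsto_add_atTop_iff_nat 2]
    have hge : ∀ N : ℕ, (N : ℝ) ≤ ∑ j ∈ Finset.range (N + 2), (j : ℝ) ^ n := fun N => by
      induction N with
      | zero => simpa using Finset.sum_nonneg fun (j : ℕ) _ => by positivity
      | succ N ih =>
        rw [Finset.sum_range_succ]
        have : (1 : ℝ) ≤ ((N + 2 : ℕ) : ℝ) ^ n :=
          one_le_pow₀ (by push_cast; linarith [(Nat.cast_nonneg N : (0 : ℝ) ≤ N)])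
        push_cast at this ⊢
        linarith
    exact tendsto_atTop_mono hge tendsto_natCast_atTop_atTop
  have hsum := hlo.sum_range (fun j => by positivity) hdiv
  have hbig : (fun N : ℕ => ∑ j ∈ Finset.range N, (j : ℝ) ^ n) =O[atTop]
      fun N : ℕ => (N : ℝ) ^ (n + 1) := by
    refine Asymptotics.IsBigO.of_bound 1 (Eventually.of_forall fun N => ?_)
    rw [Real.norm_of_nonneg (Finset.sum_nonneg fun j _ => by positivity),
      Real.norm_of_nonneg (by positivity), one_mul]
    calc ∑ j ∈ Finset.range N, (j : ℝ) ^ n ≤ ∑ j ∈ Finset.range N, (N : ℝ) ^ n :=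
          Finset.sum_le_sum fun j hj => pow_le_pow_left₀ (Nat.cast_nonneg _)
            (by exact_mod_cast (Finset.mem_range.1 hj).le) n
      _ = (N : ℝ) ^ (n + 1) := by
          rw [Finset.sum_const, Finset.card_range, nsmul_eq_mul, pow_succ, mul_comm]
  have hfin := (hsum.trans_isBigO hbig).tendsto_div_nhds_zero
  have h := hfin.add_const V
  rw [zero_add] at h
  refine h.congr' ?_
  filter_upwards [eventually_gt_atTop 0] with N hN
  have hN' : (0 : ℝ) < N := by exact_mod_cast hN
  rw [Finset.sum_sub_distrib, ← Finset.mul_sum, ← Finset.mul_sum]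
  have htel : ∑ j ∈ Finset.range N, (((j + 1 : ℕ) : ℝ) ^ (n + 1) - (j : ℝ) ^ (n + 1)) =
      (N : ℝ) ^ (n + 1) := by
    rw [Finset.sum_range_sub (fun j : ℕ => (j : ℝ) ^ (n + 1))]
    simp
  rw [htel]
  field_simp
  ring

theorem HasSpanningSections.tendsto_multiplicitySeq (K : Type u) [Field K]
    (hD : HasSpanningSections D) (hw : w ∈ latticePoints (polytope D)) :
    Tendsto (multiplicitySeq K D) atTop
      (𝓝 ((Nat.factorial n : ℝ) * volume.real (shiftedPolytope D w))) := by
  have hfin : ∀ j, (degreeSet D j).Finite := fun j => by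
    have : degreeSet D j = (Equiv.addRight (j • w)) '' shiftedDegreeSet D w j := by
      rw [Equiv.image_eq_preimage_symm]
      ext x
      simp [shiftedDegreeSet]
    rw [this]
    exact (hD.finite_shiftedDegreeSet hw j).image _
  have h1 := hD.tendsto_ncard_shiftedDegreeSet hw
  simp only [ncard_shiftedDegreeSet] at h1
  refine ((tendsto_sum_div_pow_succ h1).const_mul (Nat.factorial n : ℝ)).congr fun N => ?_
  rw [multiplicitySeq, finrank_quotient_gradedMaxIdeal_pow K D hfin, Nat.factorial_succ]
  push_cast
  ring

end Counting

/-! ### The function `φ_D` as an uncovered density -/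

section Phi

variable {n : ℕ} {Δ : Fan n} {D : Δ.TDivisor} {w : Fin n → ℤ}

lemma mem_polytopeCone_iff (hne : (polytope D).Nonempty) {y : Fin n → ℝ} {t : ℝ} :
    (y, t) ∈ polytopeCone D ↔ 0 ≤ t ∧ y ∈ t • polytope D := by
  constructor
  · intro h
    have key : ∀ z ∈ polytopeCone D, 0 ≤ z.2 ∧ z.1 ∈ z.2 • polytope D := by
      intro z hz
      induction hz using Submodule.span_induction with
      | mem x hx =>
        have h2 : x.2 = 1 := hx.2
        rw [h2, one_smul]
        exact ⟨zero_le_one, hx.1⟩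
      | zero =>
        obtain ⟨a, ha⟩ := hne
        exact ⟨le_rfl, a, ha, by simp⟩
      | add x y _ _ hx hy =>
        refine ⟨add_nonneg hx.1 hy.1, ?_⟩
        rw [Prod.snd_add, Prod.fst_add, (convex_polytope D).add_smul hx.1 hy.1]
        exact Set.add_mem_add hx.2 hy.2
      | smul c x _ hx =>
        refine ⟨mul_nonneg c.2 hx.1, ?_⟩
        have h1 : (c • x).2 = (c : ℝ) * x.2 := rfl
        have h2 : (c • x).1 = (c : ℝ) • x.1 := rfl
        rw [h1, h2, mul_smul]
        exact Set.smul_mem_smul_set hx.2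
    exact key _ h
  · rintro ⟨ht, a, ha, rfl⟩
    have h : ((a, 1) : (Fin n → ℝ) × ℝ) ∈ polytopeCone D :=
      PointedCone.subset_hull ⟨ha, rfl⟩
    have h2 := Submodule.smul_mem (polytopeCone D) (⟨t, ht⟩ : {c : ℝ // 0 ≤ c}) h
    have e : (⟨t, ht⟩ : {c : ℝ // 0 ≤ c}) • ((a, 1) : (Fin n → ℝ) × ℝ) = (t • a, t) := by
      change (t • a, t * 1) = _
      rw [mul_one]
    rwa [e] at h2

lemma mem_translatedCone_iff (hne : (polytope D).Nonempty) {u : Fin n → ℤ} {x : Fin n → ℝ} {t : ℝ}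
    (ht : 0 ≤ t) : (x, t + 1) ∈ translatedCone D u ↔ x - toReal u ∈ t • polytope D := by
  have h : (x, t + 1) ∈ translatedCone D u ↔ (x - toReal u, t) ∈ polytopeCone D := by
    constructor
    · rintro ⟨⟨y, s⟩, hc, hxy⟩
      simp only [Prod.mk_add_mk, Prod.mk.injEq] at hxy
      obtain ⟨rfl, hs⟩ := hxy
      have hs' : s = t := by linarith
      subst hs'
      rwa [add_sub_cancel_left]
    · intro hc
      exact ⟨_, hc, by simp [add_comm]⟩
  rw [h, mem_polytopeCone_iff hne]
  simp [ht]

lemma HasSpanningSections.polytope_nonempty (hD : HasSpanningSections D) :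
    (polytope D).Nonempty := by
  obtain ⟨w, hw⟩ := hD.nonempty
  exact ⟨_, hw⟩

lemma HasSpanningSections.uncoveredVolume_eq (hD : HasSpanningSections D) (v : Fin n → ℤ) {t : ℝ}
    (ht : 0 ≤ t) : uncoveredVolume D v t = uncoveredDensity (polytope D) t := by
  have hset : {x | x ∈ unitCell v ∧ (x, t + 1) ∉ ⋃ u : Fin n → ℤ, translatedCone D u} =
      {x | x ∈ unitCell v ∧ x ∈ uncovered (polytope D) t} := by
    ext x
    refine and_congr Iff.rfl ?_
    simp only [Set.mem_iUnion, not_exists, uncovered, Set.mem_ofPred_eq]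
    exact forall_congr' fun u => not_congr (mem_translatedCone_iff hD.polytope_nonempty ht)
  rw [uncoveredVolume, hset, uncoveredDensity, measureReal_def,
    ← (isPeriodic_uncovered (polytope D) t).volume_cell
      (measurableSet_uncovered hD.isCompact_polytope t) (toReal v),
    ← volume_setOf_add_mem (toReal v)]
  congr 2
  ext x
  have h1 : toReal v + x ∈ unitCell v ↔ x ∈ Set.Icc (0 : Fin n → ℝ) 1 := by
    constructor
    · rintro ⟨y, hy, hxy⟩
      rwa [← add_left_cancel hxy]
    · exact fun hx => ⟨x, hx, rfl⟩
  simp only [Set.mem_ofPred_eq, add_comm x, h1]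

lemma HasSpanningSections.phi_eq (hD : HasSpanningSections D) (w : Fin n → ℤ) {t : ℝ}
    (ht : 0 ≤ t) : phi D t = uncoveredDensity (shiftedPolytope D w) t := by
  rw [phi, hD.uncoveredVolume_eq 0 ht]
  exact (uncoveredDensity_translate hD.isCompact_polytope (toReal w) t).symm

lemma HasSpanningSections.phi_nsmul (hD : HasSpanningSections D) {k : ℕ} (hk : 1 ≤ k) {t : ℝ}
    (ht : 0 ≤ t) : phi (k • D) t = phi D (k * t) := by
  rw [phi, phi, (hD.nsmul hk).uncoveredVolume_eq 0 ht, hD.uncoveredVolume_eq 0 (by positivity),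
    uncoveredDensity, uncoveredDensity, uncovered, uncovered, polytope_nsmul D hk, smul_smul,
    mul_comm t]

lemma shiftedPolytope_nsmul (D : Δ.TDivisor) (w : Fin n → ℤ) {k : ℕ} (hk : 1 ≤ k) :
    shiftedPolytope (k • D) (k • w) = (k : ℝ) • shiftedPolytope D w := by
  have hk' : (k : ℝ) ≠ 0 := by
    have : k ≠ 0 := by omega
    exact_mod_cast this
  ext x
  rw [Set.mem_smul_set_iff_inv_smul_mem₀ hk']
  change x + toReal (k • w) ∈ polytope (k • D) ↔ (k : ℝ)⁻¹ • x + toReal w ∈ polytope D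
  rw [polytope_nsmul D hk, Set.mem_smul_set_iff_inv_smul_mem₀ hk', toReal_nsmul, smul_add,
    inv_smul_smul₀ hk']

lemma hkRegion_smul (Q : Set (Fin n → ℝ)) (k : ℝ) {t : ℝ} (ht : 0 ≤ t) :
    hkRegion (k • Q) (t + 1) = remainder Q k (k * t) := by
  ext x
  have e1 : (t + 1) * k = k + k * t := by ring
  have e2 : (t + 1 - 1) * k = k * t := by ring
  have e3 : (1 : ℝ) ≤ t + 1 := by linarith
  simp only [hkRegion, remainder, Set.mem_ofPred_eq, smul_smul, e1, e2, e3, true_imp_iff]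

end Phi

end ToricHK
end

open ToricHK
theorem proposition1p2 (p : ℕ) [Fact p.Prime] (K : Type*) [Field K] [IsAlgClosed K]
    [CharP K p] (n : ℕ) (hn : 1 ≤ n) (Δ : Fan n) (hΔ : Δ.IsComplete) (D : Δ.TDivisor)
    (hD : IsVeryAmple K D) :
    -- the limits that define `HKd(X, kD)` and `e₀(X, D)` exist
    (∀ k : ℕ, 1 ≤ k → ∀ t : ℝ, 0 ≤ t →
      Tendsto (fun N => hkDensitySeq p K (k • D) N t) atTop (𝓝 (HKd p K (k • D) t))) ∧
    Tendsto (multiplicitySeq K D) atTop (𝓝 (e₀ K D)) ∧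
    -- the function `φ_{kD}` does not depend on the unit cell, has values in `[0, 1]`, and is
    -- continuous and compactly supported on `[0, ∞)`
    (∀ k : ℕ, 1 ≤ k →
      (∀ v : Fin n → ℤ, ∀ t : ℝ, 0 ≤ t → uncoveredVolume (k • D) v t = phi (k • D) t) ∧
      (∀ t : ℝ, 0 ≤ t → phi (k • D) t ∈ Set.Icc (0 : ℝ) 1) ∧
      ContinuousOn (phi (k • D)) (Set.Ici 0) ∧
      ∃ B : ℝ, ∀ t : ℝ, B ≤ t → phi (k • D) t = 0) ∧
    -- `φ_{kD}(λ) = φ_D(k λ)`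
    (∀ k : ℕ, 1 ≤ k → ∀ t : ℝ, 0 ≤ t → phi (k • D) t = phi D (k * t)) ∧
    -- the asymptotic formula, where `d - 1 = n`, with an error term uniform in `λ ≥ 0`
    ∃ C : ℝ, ∀ k : ℕ, 1 ≤ k → ∀ t : ℝ, 0 ≤ t →
      |HKd p K (k • D) (t + 1) -
          e₀ K D * (k : ℝ) ^ n / (Nat.factorial n : ℝ) * phi (k • D) t| ≤
        C * (k : ℝ) ^ (n - 1) := by
  have hS := hD.hasSpanningSections hΔ
  obtain ⟨w, hw⟩ := hS.nonempty
  have hw' : ∀ k : ℕ, 1 ≤ k → k • w ∈ latticePoints (polytope (k • D)) := fun k hk => by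
    change toReal (k • w) ∈ polytope (k • D)
    rw [polytope_nsmul D hk, toReal_nsmul]
    exact Set.smul_mem_smul_set hw
  have hHK : ∀ k : ℕ, 1 ≤ k → ∀ t : ℝ, 0 ≤ t →
      Tendsto (fun N => hkDensitySeq p K (k • D) N t) atTop
        (𝓝 (volume.real (hkRegion (shiftedPolytope (k • D) (k • w)) t))) := fun k hk t ht =>
    (hS.nsmul hk).tendsto_hkDensitySeq p K hn (hw' k hk) ht
  have hE := hS.tendsto_multiplicitySeq K hw
  obtain ⟨B, -, hB⟩ := hS.exists_shiftedPolytope_eq w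
  have h0 := zero_mem_shiftedPolytope hw
  have hint := hS.interior_nonempty w
  refine ⟨fun k hk t ht => ?_, ?_, fun k hk => ⟨fun v t ht => ?_, fun t ht => ?_, ?_, ?_⟩,
    fun k hk t ht => hS.phi_nsmul hk ht, ?_⟩
  · exact tendsto_nhds_limUnder ⟨_, hHK k hk t ht⟩
  · exact tendsto_nhds_limUnder ⟨_, hE⟩
  · rw [phi, (hS.nsmul hk).uncoveredVolume_eq v ht, (hS.nsmul hk).uncoveredVolume_eq 0 ht]
  · rw [(hS.nsmul hk).phi_eq (k • w) ht]
    exact uncoveredDensity_mem_Icc _ _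
  · refine (continuousOn_uncoveredDensity (convex_shiftedPolytope (k • D) (k • w))
      ((hS.nsmul hk).isCompact_shiftedPolytope _)
      (zero_mem_shiftedPolytope (hw' k hk))).congr fun t ht => ?_
    exact (hS.nsmul hk).phi_eq (k • w) ht
  · refine ⟨B.card, fun t ht => ?_⟩
    have ht0 : 0 ≤ t := (Nat.cast_nonneg _).trans ht
    have hk' : (1 : ℝ) ≤ k := by exact_mod_cast hk
    rw [hS.phi_nsmul hk ht0, hS.phi_eq w (by positivity)]
    exact uncoveredDensity_eq_zero hB h0 hint (ht.trans (le_mul_of_one_le_left ht0 hk'))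
  · obtain ⟨C, hC⟩ := exists_abs_volume_remainder_sub_le hn hB h0 hint
    refine ⟨C, fun k hk t ht => ?_⟩
    have h1 : HKd p K (k • D) (t + 1) =
        volume.real (remainder (shiftedPolytope D w) k (k * t)) := by
      rw [HKd, (hHK k hk (t + 1) (by linarith)).limUnder_eq, shiftedPolytope_nsmul D w hk,
        hkRegion_smul _ _ ht]
    have h2 : e₀ K D = Nat.factorial n * volume.real (shiftedPolytope D w) := hE.limUnder_eq
    have h3 : e₀ K D * (k : ℝ) ^ n / (Nat.factorial n : ℝ) * phi (k • D) t =
        (k : ℝ) ^ n * volume.real (shiftedPolytope D w) *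
          uncoveredDensity (shiftedPolytope D w) (k * t) := by
      have hfac : (Nat.factorial n : ℝ) ≠ 0 := by exact_mod_cast Nat.factorial_ne_zero n
      rw [h2, hS.phi_nsmul hk ht, hS.phi_eq w (by positivity)]
      field_simp
    rw [h1, h3]
    exact hC k hk (k * t) (by positivity)
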